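/- **Setting.** Let $u^1,\dots,u^n$ be functions of $x$, $u^i_\sigma=\partial_x^\sigma u^i$. A *differential function* is a $C^\infty$ function of finitely many jet coordinates $u^i_\sigma$ on an open set of jets; $\partial_x$ denotes the total derivative. A matrix differential operator $A^{ij}=\sum_\sigma A^{ij\sigma}\partial_x^\sigma$ has differential functions as coefficients. For vector functions put $$\ell_F(X)^k=\frac{\partial F^k}{\partial u^i_\sigma}\partial_x^\sigma X^i,\qquad \ell_F^*(\psi)_i=(-1)^\sigma\partial_x^\sigma\Big(\frac{\partial F^k}{\partial u^i_\sigma}\psi_k\Big),\qquad \ell_{A,X}(Y)^i=\frac{\partial A^{ij\sigma}}{\partial u^k_\mu}\,\partial_x^\sigma X^j\,\partial_x^\mu Y^k .$$ $A$ is *Hamiltonian* if it is formally skew-adjoint and $[A,A]=0$, where the Schouten bracket of skew-adjoint operators is $$[A,A'](\psi_1,\psi_2,\psi_3)=\sum_{\rm cyc}\Big(\langle\ell_{A,\psi_1}(A'\psi_2),\psi_3\rangle+\langle\ell_{A',\psi_1}(A\psi_2),\psi_3\rangle\Big)$$ modulo (local) total $x$-derivatives. An operator $B$ is *symplectic* if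 it is formally skew-adjoint and $\sum_{\rm cyc}\langle\ell_{B,X_1}(X_2),X_3\rangle$ is (locally) a total $x$-derivative for all $X_1,X_2,X_3$. For a covector $\psi$, $e_1(\psi)=\ell_\psi-\ell_\psi^*$. The Lie derivative of $A$ along $\tau=\tau^i\,\partial/\partial u^i$ is $(L_\tau A)(\xi)=\ell_{A,\xi}(\tau)-\ell_\tau(A\xi)-A(\ell_\tau^*\xi)$. **Data.** Let $K=(K^{ij})$ be a constant symmetric invertible real matrix, $M=K^{-1}$, $A_1=K\partial_x$, and let $A_2$ be a Hamiltonian operator on an open set $U$ of jets of $u$ with $[A_1,A_2]=0$. Introduce potentials by $u^i=\varphi^i_x$, let $W$ be the set of jets of $\varphi$ for which the jet of $u=\varphi_x$ lies in $U$, and put $B_{ij}=-M_{ip}A_2^{pq}M_{qj}$, an operator on $W$. **Theorem.** 1. $B$ is symplectic on $W$. Let $(h_k)_{k\ge0}$ be densities and $(\gamma_k)$ covectors on an open subset of $W$, with $\delta H_k/\delta\varphi=-\partial_x\gamma_k$ (so $\gamma_k=\delta H_k/\delta u$) and $A_2\gamma_k=A_1\gamma_{k+1}$, i.e. $u_{t^k}=A_2\,\delta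 H_k/\delta u=A_1\,\delta H_{k+1}/\delta u$ for all $k\ge 0$. Then the flows $\varphi_{t^k}=K\gamma_{k+1}$ satisfy $B\varphi_{t^k}=\delta H_{k+2}/\delta\varphi$. 2. Near every point of $W$ there are differential functions $L_n=L_n(\varphi,\varphi_x,\varphi_{xx},\dots)$ such that $\psi=-(L_n)$ is a potential of $B$ in the variational sequence: $e_1(\psi)=B$. 3. For every vector $(L_n)$ of differential functions on an open subset of $W$ such that $\psi=-(L_n)$ satisfies $e_1(\psi)=B$, and for every density $h(\varphi,\varphi_x,\dots)$, in particular $h=h_{k+2}$, the Euler–Lagrange expressions of $L_n\varphi^n_t-h$ are $$\frac{\delta(L_n\varphi^n_t-h)}{\delta\varphi^i}=B_{im}\varphi^m_t-\frac{\delta H}{\delta\varphi^i},\qquad H=\int h\,dx,$$ so that $L_n\varphi^n_{t^k}-h_{k+2}$ is a Lagrangian of the system $B\varphi_{t^k}=\delta H_{k+2}/\delta\varphi$. Moreover $A_2=L_\tau A_1$ with $\tau=-K^{in}L_n\,\partial/\partial u^i$. Here, as $\tau^i$ may depend on $\varphi$ itself, the linearization of $\tau$ with respect to $u=\varphi_x$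 is $\ell_\tau\circ\partial_x^{-1}$ and its adjoint is $-\partial_x^{-1}\circ\ell_\tau^*$, with $\ell_\tau,\ell_\tau^*$ taken in $\varphi$; that is, $(L_\tau A_1)(\xi)=-\ell_\tau(K\xi)+K\ell_\tau^*(\xi)$. 4. If $(L_n)$ as in 3 depends only on $u=\varphi_x,u_x,\dots$, then $\tau=-K^{in}L_n\,\partial/\partial u^i$ is a generalized vector field in the variables $u$, and $A_2=L_\tau A_1$ in these variables, in the sense of the general formula above. Near a given jet in $U$ such $(L_n)$ exist if and only if the zero-order coefficients $A_2^{ij0}$ of $A_2$ are total $x$-derivatives of differential functions of $u$ near that jet. -/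

import Mathlib

open scoped ContDiff

namespace JetCalc

section General

variable {ι κ : Type*}

/-- `f` is a differential function on the set `U` of jets: on `U` it is a `C^∞` function of
finitely many of the jet coordinates. (For `U` open in the product topology, the projection
`S.restrict '' U` to finitely many coordinates is open.) -/
def IsDiffFun (U : Set (ι → ℝ)) (f : (ι → ℝ) → ℝ) : Prop :=
  ∃ (S : Finset ι) (F : (S → ℝ) → ℝ),
    ContDiffOn ℝ ∞ F (S.restrict '' U) ∧ ∀ p ∈ U, f p = F (S.restrict p)

/-- The vector function `X` has differential functions on `U` as components. -/
def IsDiffVec {n : ℕ} (U : Set (ι → ℝ)) (X : Fin n → (ι → ℝ) → ℝ) : Prop :=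
  ∀ i, IsDiffFun U (X i)

/-- The partial derivative with respect to the jet coordinate with label `a`. -/
noncomputable def pd [DecidableEq ι] (a : ι) (f : (ι → ℝ) → ℝ) : (ι → ℝ) → ℝ :=
  fun p => deriv (fun s => f (Function.update p a s)) (p a)

/-- The total derivative for which the derivative of the coordinate `a` is the coordinate `s a`.
For a differential function the sum is finite. -/
noncomputable def totalD [DecidableEq ι] (s : ι → ι) (f : (ι → ℝ) → ℝ) : (ι → ℝ) → ℝ :=
  fun p => ∑ᶠ a, p (s a) * pd a f p

/-- A matrix differential operator `A^{ij} = ∑_{σ ≤ order} A^{ijσ} ∂_x^σ`; the coefficient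
`A^{ijσ}`, a function on jets, is `coeff σ i j`, and only those with `σ ≤ order` matter. -/
structure MatDiffOp (ι : Type*) (n : ℕ) where
  order : ℕ
  coeff : ℕ → Fin n → Fin n → (ι → ℝ) → ℝ

/-- The coefficients are differential functions on `U`. -/
def MatDiffOp.IsSmoothOn {n : ℕ} (A : MatDiffOp ι n) (U : Set (ι → ℝ)) : Prop :=
  ∀ σ ≤ A.order, ∀ i j, IsDiffFun U (A.coeff σ i j)

/-- The operator whose coefficients are those of `A`, composed with a map of jets. -/
def MatDiffOp.pullback {n : ℕ} (A : MatDiffOp ι n) (f : (κ → ℝ) → (ι → ℝ)) : MatDiffOp κ n where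
  order := A.order
  coeff σ i j := A.coeff σ i j ∘ f

/-- `A(X)^i = A^{ijσ} ∂_x^σ X^j`, for a given total derivative `∂_x = D`. -/
noncomputable def MatDiffOp.act {n : ℕ} (A : MatDiffOp ι n)
    (D : ((ι → ℝ) → ℝ) → (ι → ℝ) → ℝ) (X : Fin n → (ι → ℝ) → ℝ) : Fin n → (ι → ℝ) → ℝ :=
  fun i p => ∑ σ ∈ Finset.range (A.order + 1), ∑ j, A.coeff σ i j p * (D^[σ] (X j)) p

/-- A constant matrix acting on a vector function. -/
def matAct {n : ℕ} (K : Matrix (Fin n) (Fin n) ℝ) (X : Fin n → (ι → ℝ) → ℝ) :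
    Fin n → (ι → ℝ) → ℝ :=
  fun i p => ∑ j, K i j * X j p

end General

/-- Infinite jets of `n` functions of the single independent variable `x`: the coordinate
`(σ, i)` is the `σ`-th `x`-derivative of the `i`-th field, `u^i_σ` or `φ^i_σ`. -/
abbrev Jet (n : ℕ) := ℕ × Fin n → ℝ

/-- Infinite jets of `n` functions of `x` and `t`: the coordinate `(σ, k, i)` is
`∂_x^σ ∂_t^k φ^i`. -/
abbrev Jet2 (n : ℕ) := ℕ × ℕ × Fin n → ℝ

section OneVariable

variable {n : ℕ}

/-- The total `x`-derivative on `Jet n`. -/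
noncomputable def Dx (f : Jet n → ℝ) : Jet n → ℝ := totalD (fun a => (a.1 + 1, a.2)) f

/-- `ℓ_F(X)^k = (∂F^k/∂u^i_σ) ∂_x^σ X^i`. -/
noncomputable def lin (F X : Fin n → Jet n → ℝ) : Fin n → Jet n → ℝ :=
  fun k p => ∑ᶠ a : ℕ × Fin n, pd a (F k) p * (Dx^[a.1] (X a.2)) p

/-- `ℓ_F^*(ψ)_i = (-1)^σ ∂_x^σ ((∂F^k/∂u^i_σ) ψ_k)`. -/
noncomputable def linAdj (F ψ : Fin n → Jet n → ℝ) : Fin n → Jet n → ℝ :=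
  fun i p => ∑ᶠ σ : ℕ, (-1) ^ σ * (Dx^[σ] (fun q => ∑ k, pd (σ, i) (F k) q * ψ k q)) p

/-- The variational derivative `δH/δu^i = (-1)^σ ∂_x^σ (∂h/∂u^i_σ)` of `H = ∫ h dx`. -/
noncomputable def euler (h : Jet n → ℝ) : Fin n → Jet n → ℝ :=
  fun i p => ∑ᶠ σ : ℕ, (-1) ^ σ * (Dx^[σ] (pd (σ, i) h)) p

/-- `ℓ_{A,X}(Y)^i = (∂A^{ijσ}/∂u^k_μ) ∂_x^σ X^j ∂_x^μ Y^k`. -/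
noncomputable def linOp (A : MatDiffOp (ℕ × Fin n) n) (X Y : Fin n → Jet n → ℝ) :
    Fin n → Jet n → ℝ :=
  fun i p => ∑ σ ∈ Finset.range (A.order + 1), ∑ j, ∑ᶠ a : ℕ × Fin n,
    pd a (A.coeff σ i j) p * (Dx^[σ] (X j)) p * (Dx^[a.1] (Y a.2)) p

/-- The formal adjoint, `A^*(X)^i = (-1)^σ ∂_x^σ (A^{jiσ} X^j)`. -/
noncomputable def adjAct (A : MatDiffOp (ℕ × Fin n) n) (X : Fin n → Jet n → ℝ) :
    Fin n → Jet n → ℝ :=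
  fun i p => ∑ σ ∈ Finset.range (A.order + 1),
    (-1) ^ σ * (Dx^[σ] (fun q => ∑ j, A.coeff σ j i q * X j q)) p

/-- `A^* = -A` on `U`. -/
def IsSkewAdjoint (U : Set (Jet n)) (A : MatDiffOp (ℕ × Fin n) n) : Prop :=
  ∀ X, IsDiffVec U X → ∀ p ∈ U, ∀ i, adjAct A X i p = - A.act Dx X i p

/-- The density `f` is, locally on `U`, a total `x`-derivative: it defines the zero functional. -/
def IsTrivialDensity (U : Set (Jet n)) (f : Jet n → ℝ) : Prop :=
  ∀ p ∈ U, ∃ V : Set (Jet n), IsOpen V ∧ p ∈ V ∧ V ⊆ U ∧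
    ∃ g, IsDiffFun V g ∧ ∀ q ∈ V, f q = Dx g q

/-- The pairing `X^i Y_i` of vector functions. -/
def pair (X Y : Fin n → Jet n → ℝ) : Jet n → ℝ := fun p => ∑ i, X i p * Y i p

/-- The density `⟨ℓ_{A,ψ₁}(A'(ψ₂)), ψ₃⟩` summed over cyclic permutations of `ψ₁, ψ₂, ψ₃`. -/
noncomputable def cyclicBracket (A A' : MatDiffOp (ℕ × Fin n) n) (ψ₁ ψ₂ ψ₃ : Fin n → Jet n → ℝ) :
    Jet n → ℝ :=
  pair (linOp A ψ₁ (A'.act Dx ψ₂)) ψ₃ + pair (linOp A ψ₂ (A'.act Dx ψ₃)) ψ₁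
    + pair (linOp A ψ₃ (A'.act Dx ψ₁)) ψ₂

/-- The Schouten bracket `[A, A']` of two skew-adjoint operators vanishes on `U`: as a three-vector,
evaluated on arbitrary covectors, it is zero modulo total derivatives. -/
def SchoutenVanishes (U : Set (Jet n)) (A A' : MatDiffOp (ℕ × Fin n) n) : Prop :=
  ∀ ψ₁ ψ₂ ψ₃, IsDiffVec U ψ₁ → IsDiffVec U ψ₂ → IsDiffVec U ψ₃ →
    IsTrivialDensity U (cyclicBracket A A' ψ₁ ψ₂ ψ₃ + cyclicBracket A' A ψ₁ ψ₂ ψ₃)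

/-- Hamiltonian operators: formally skew-adjoint with `[A, A] = 0`. -/
def IsHamiltonian (U : Set (Jet n)) (A : MatDiffOp (ℕ × Fin n) n) : Prop :=
  IsSkewAdjoint U A ∧ SchoutenVanishes U A A

/-- Symplectic operators: formally skew-adjoint, and closed as variational two-forms. -/
def IsSymplectic (U : Set (Jet n)) (B : MatDiffOp (ℕ × Fin n) n) : Prop :=
  IsSkewAdjoint U B ∧
    ∀ X₁ X₂ X₃, IsDiffVec U X₁ → IsDiffVec U X₂ → IsDiffVec U X₃ →
      IsTrivialDensity U
        (pair (linOp B X₁ X₂) X₃ + pair (linOp B X₂ X₃) X₁ + pair (linOp B X₃ X₁) X₂)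

/-- `e_1(ψ) = B` in the variational sequence: `B = ℓ_ψ - ℓ_ψ^*` on `U`. -/
def IsPotential (U : Set (Jet n)) (ψ : Fin n → Jet n → ℝ) (B : MatDiffOp (ℕ × Fin n) n) : Prop :=
  ∀ X, IsDiffVec U X → ∀ p ∈ U, ∀ i, B.act Dx X i p = lin ψ X i p - linAdj ψ X i p

/-- The Lie derivative of an operator along the generalized vector field `τ^i ∂/∂u^i`, evaluated on
a covector: `(L_τ A)(ξ) = ℓ_{A,ξ}(τ) - ℓ_τ(A(ξ)) - A(ℓ_τ^*(ξ))`. -/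
noncomputable def lieDeriv (τ : Fin n → Jet n → ℝ) (A : MatDiffOp (ℕ × Fin n) n)
    (ξ : Fin n → Jet n → ℝ) : Fin n → Jet n → ℝ :=
  fun i p => linOp A ξ τ i p - lin τ (A.act Dx ξ) i p - A.act Dx (linAdj τ ξ) i p

/-- The operator `K ∂_x`. -/
def constOp (K : Matrix (Fin n) (Fin n) ℝ) : MatDiffOp (ℕ × Fin n) n where
  order := 1
  coeff σ i j := fun _ => if σ = 1 then K i j else 0

/-- The potential substitution `u^i = φ^i_x`: the jet of `φ` is sent to the jet of `u`. -/
def shift (p : Jet n) : Jet n := fun a => p (a.1 + 1, a.2)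

/-- The Lie derivative of `A = K ∂_x` along a field `τ^i ∂/∂u^i` whose components are functions of
the potentials, `τ^i = τ^i(φ, φ_x, …)`, `u = φ_x`. By the chain rule the linearization of `τ` with
respect to `u` is `ℓ_τ ∘ ∂_x⁻¹`, and its adjoint is `-∂_x⁻¹ ∘ ℓ_τ^*`, where `ℓ_τ`, `ℓ_τ^*` are taken
with respect to `φ`. In `ℓ_{A,ξ}(τ) - (ℓ_τ ∘ ∂_x⁻¹)(K ∂_x ξ) + K ∂_x (∂_x⁻¹ ∘ ℓ_τ^*)(ξ)`
the first term is zero and `∂_x⁻¹` cancels. -/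
noncomputable def lieDerivPot (τ : Fin n → Jet n → ℝ) (K : Matrix (Fin n) (Fin n) ℝ)
    (ξ : Fin n → Jet n → ℝ) : Fin n → Jet n → ℝ :=
  fun i p => - lin τ (matAct K ξ) i p + matAct K (linAdj τ ξ) i p

/-- `B = - M A M` with `M = K⁻¹`, in the potential variables. -/
noncomputable def sympOp (K : Matrix (Fin n) (Fin n) ℝ) (A : MatDiffOp (ℕ × Fin n) n) :
    MatDiffOp (ℕ × Fin n) n where
  order := A.order
  coeff σ i j := fun p => - ∑ r, ∑ s, K⁻¹ i r * A.coeff σ r s (shift p) * K⁻¹ s j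

/-- The hierarchy `u_{t^k} = A(δH_k/δu) = K ∂_x (δH_{k+1}/δu)`, `k ≥ 0`, in potential variables, on a
set `V` of jets of `φ`. The densities `h k` may depend on `φ` itself; `γ k` is the covector
`δH_k/δu`, related to the variational derivative in `φ` by `δH_k/δφ = - ∂_x (δH_k/δu)`. -/
structure IsHierarchy (V : Set (Jet n)) (K : Matrix (Fin n) (Fin n) ℝ)
    (A : MatDiffOp (ℕ × Fin n) n) (h : ℕ → Jet n → ℝ) (γ : ℕ → Fin n → Jet n → ℝ) : Prop where
  density : ∀ k, IsDiffFun V (h k)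
  covector : ∀ k, IsDiffVec V (γ k)
  var_deriv : ∀ k, ∀ p ∈ V, ∀ i, euler (h k) i p = - Dx (γ k i) p
  flow : ∀ k, ∀ p ∈ V, ∀ i,
    (A.pullback shift).act Dx (γ k) i p = (constOp K).act Dx (γ (k + 1)) i p

end OneVariable

section TwoVariables

variable {n : ℕ}

/-- The total `x`-derivative on `Jet2 n`. -/
noncomputable def Dx2 (f : Jet2 n → ℝ) : Jet2 n → ℝ := totalD (fun a => (a.1 + 1, a.2.1, a.2.2)) f

/-- The total `t`-derivative on `Jet2 n`. -/
noncomputable def Dt2 (f : Jet2 n → ℝ) : Jet2 n → ℝ := totalD (fun a => (a.1, a.2.1 + 1, a.2.2)) f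

/-- The Euler–Lagrange expressions `(-1)^{σ+k} ∂_x^σ ∂_t^k (∂Λ/∂φ^i_{σ,k})` of the Lagrangian density
`Λ` in the two independent variables `x` and `t`. -/
noncomputable def euler2 (Λ : Jet2 n → ℝ) : Fin n → Jet2 n → ℝ :=
  fun i P => ∑ᶠ a : ℕ × ℕ,
    (-1) ^ (a.1 + a.2) * (Dx2^[a.1] (Dt2^[a.2] (pd (a.1, a.2, i) Λ))) P

/-- The jet in `x` that underlies a jet in `x` and `t`. -/
def spaceJet (P : Jet2 n) : Jet n := fun a => P (a.1, 0, a.2)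

/-- The vector function `φ_t`. -/
def phiT : Fin n → Jet2 n → ℝ := fun m P => P (0, 1, m)

/-- The Lagrangian density `L_m φ^m_t - h`. -/
def lagrangianRep (L : Fin n → Jet n → ℝ) (h : Jet n → ℝ) : Jet2 n → ℝ :=
  fun P => (∑ m, L m (spaceJet P) * phiT m P) - h (spaceJet P)

end TwoVariables

end JetCalc

open JetCalc

/-!
The operator `B = -M A₂ M` on jets of `φ` corresponds to the variational two-form `⟨B X, Y⟩`, and
all six assertions follow from two identities for its coefficients. A multilinear differential
operator is represented by its family of coefficients, which lie in the ring `DF V` of differential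
functions on an open set `V` of jets; `slot₂` and `slot₃` are the effect of the total derivative on
the coefficients of bilinear and trilinear operators.

Integration by parts shows that an operator whose values on all arguments are locally total
derivatives is the total derivative of an operator (`exists_eq_slot₂`, `exists_eq_slot₃`). Two facts
about differential functions enter: a differential operator that vanishes on coordinates of high
order has zero coefficients (`DF.faithful`), and a covector `E` for which all `E_i Y^i` are locally
total derivatives vanishes, since a total derivative is affine in the coordinates of highest order
(`DF.eq_zero_of_isTrivial`). As `K ∂_x M X = ∂_x X`, the linearization of `A₂` along the covector
`M X` in the direction `K ∂_x M X` is the linearization of `B` along `X` in the potentials. Therefore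
skew-adjointness of `A₂` and `[K ∂_x, A₂] = 0` say precisely that `B` is skew-adjoint and closed, as
identities between coefficients (`isClosedSkew_sympR`). These identities are local in the jets and
can be transported to the jets of `φ`, which gives the symplectic property.

For the potentials, let `Ω` be the alternating two-form of `B`. Then `dΩ = D θ` with a three-form `θ`
and the total derivative `D`. Since `D` is injective on forms of positive degree, `dθ = 0`. On a set of
jets that is star-shaped about a point the radial homotopy gives `θ = dη`, then `Ω - D η = dα`, and
integrating `α` by parts gives a covector `L` with `B = dL` modulo total derivatives
(`exists_potential`, `exists_isPotential`). For functions of `u = φ_x` the coordinates `φ` have weight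
zero in the homotopy, so terms `z_{ij} dφ^i dφ^j` remain, with `z_{ij}` a function of `u` without
derivatives, which is the zero-order coefficient of `B` up to a total derivative. If the zero-order
coefficients of `A₂` are total derivatives, then so is `z_{ij}`; being of order zero it vanishes
(`exists_isPotential_shift`). Conversely, the value of `A₂ = L_τ(K ∂_x)` on a constant covector is a
total derivative (`exists_coeff_zero_eq`).

That `-L` is a potential of `B` means `B = dL + D η` for the coefficients
(`exists_eq_of_isPotential`). Such an identity survives the passage to jets in `x` and `t`, where it is
evaluated on `φ_t`. The Euler–Lagrange expressions of `L_m φ^m_t` are `ℓ_L^*(φ_t) - ∂_t L`, and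
`∂_t L = ℓ_L(φ_t)`; hence they equal `B φ_t` (`euler2_lagrangianRep`). The formulas for the Lie
derivative are the equation `B = ℓ_L^* - ℓ_L` multiplied by `K` from both sides, in the variables `u`
with the chain rule `ℓ_L(φ) = ℓ_L(u) ∘ ∂_x`.
-/

namespace JetCalc

/-! ### Differential functions -/

section DiffFun

variable {ι : Type*}

theorem isOpenMap_restrict (S : Finset ι) : IsOpenMap (S.restrict : (ι → ℝ) → S → ℝ) := by
  classical
  have h := (isOpenMap_fst (X := ({x // x ∈ S} → ℝ)) (Y := ({x // ¬ x ∈ S} → ℝ))).comp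
    (Homeomorph.piEquivPiSubtypeProd (fun a => a ∈ S) (fun _ => ℝ)).isOpenMap
  exact h

theorem isOpen_image_restrict {U : Set (ι → ℝ)} (hU : IsOpen U) (S : Finset ι) :
    IsOpen (S.restrict '' U) := isOpenMap_restrict S U hU

theorem continuous_restrict (S : Finset ι) : Continuous (S.restrict : (ι → ℝ) → S → ℝ) := by
  unfold Finset.restrict
  fun_prop

theorem IsDiffFun.mono {U V : Set (ι → ℝ)} {f : (ι → ℝ) → ℝ} (hf : IsDiffFun U f) (h : V ⊆ U) :
    IsDiffFun V f := by
  obtain ⟨S, F, hF, he⟩ := hf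
  exact ⟨S, F, hF.mono (Set.image_mono h), fun p hp => he p (h hp)⟩

theorem IsDiffFun.congr {U : Set (ι → ℝ)} {f g : (ι → ℝ) → ℝ} (hf : IsDiffFun U f)
    (h : ∀ p ∈ U, g p = f p) : IsDiffFun U g := by
  obtain ⟨S, F, hF, he⟩ := hf
  exact ⟨S, F, hF, fun p hp => (h p hp).trans (he p hp)⟩

/-- The finite set of coordinates in the definition of a differential function may be enlarged. -/
theorem IsDiffFun.exists_rep {U : Set (ι → ℝ)} {f : (ι → ℝ) → ℝ} (hf : IsDiffFun U f) :
    ∃ S : Finset ι, ∀ T : Finset ι, S ⊆ T → ∃ F : (T → ℝ) → ℝ,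
      ContDiffOn ℝ ∞ F (T.restrict '' U) ∧ ∀ p ∈ U, f p = F (T.restrict p) := by
  obtain ⟨S, F, hF, he⟩ := hf
  refine ⟨S, fun T hST => ⟨fun y => F (fun a => y ⟨a, hST a.2⟩), ?_, fun p hp => he p hp⟩⟩
  refine hF.comp (t := S.restrict '' U) ?_ ?_
  · apply ContDiff.contDiffOn
    fun_prop
  · rintro _ ⟨p, hp, rfl⟩
    exact ⟨p, hp, rfl⟩

theorem IsDiffFun.comp₂ {U : Set (ι → ℝ)} {f g : (ι → ℝ) → ℝ} (hf : IsDiffFun U f)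
    (hg : IsDiffFun U g) {φ : ℝ × ℝ → ℝ} (hφ : ContDiff ℝ ∞ φ) :
    IsDiffFun U (fun p => φ (f p, g p)) := by
  classical
  obtain ⟨S, hS⟩ := hf.exists_rep
  obtain ⟨T, hT⟩ := hg.exists_rep
  obtain ⟨F, hF, hfe⟩ := hS (S ∪ T) Finset.subset_union_left
  obtain ⟨G, hG, hge⟩ := hT (S ∪ T) Finset.subset_union_right
  refine ⟨S ∪ T, fun y => φ (F y, G y), hφ.comp_contDiffOn (hF.prodMk hG), fun p hp => ?_⟩
  simp only [hfe p hp, hge p hp]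

theorem IsDiffFun.add {U : Set (ι → ℝ)} {f g : (ι → ℝ) → ℝ} (hf : IsDiffFun U f)
    (hg : IsDiffFun U g) : IsDiffFun U (fun p => f p + g p) :=
  hf.comp₂ hg (φ := fun x => x.1 + x.2) (by fun_prop)

theorem IsDiffFun.mul {U : Set (ι → ℝ)} {f g : (ι → ℝ) → ℝ} (hf : IsDiffFun U f)
    (hg : IsDiffFun U g) : IsDiffFun U (fun p => f p * g p) :=
  hf.comp₂ hg (φ := fun x => x.1 * x.2) (by fun_prop)

theorem isDiffFun_const (U : Set (ι → ℝ)) (c : ℝ) : IsDiffFun U (fun _ => c) :=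
  ⟨∅, fun _ => c, contDiffOn_const, fun _ _ => rfl⟩

theorem isDiffFun_coord (U : Set (ι → ℝ)) (a : ι) : IsDiffFun U (fun p => p a) := by
  refine ⟨{a}, fun y => y ⟨a, by simp⟩, ?_, fun _ _ => rfl⟩
  apply ContDiff.contDiffOn
  fun_prop

theorem IsDiffFun.sum {U : Set (ι → ℝ)} {α : Type*} (s : Finset α) {f : α → (ι → ℝ) → ℝ}
    (hf : ∀ a ∈ s, IsDiffFun U (f a)) : IsDiffFun U (fun p => ∑ a ∈ s, f a p) := by
  classical
  induction s using Finset.induction_on with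
  | empty => simpa using isDiffFun_const U 0
  | insert a s ha ih =>
    simp only [Finset.sum_insert ha]
    exact (hf a (by simp)).add (ih fun b hb => hf b (by simp [hb]))

/-- Differential functions pull back along maps of jets that read off coordinates. -/
theorem IsDiffFun.comp_coords {κ : Type*} {U : Set (ι → ℝ)} {V : Set (κ → ℝ)}
    {f : (ι → ℝ) → ℝ} (hf : IsDiffFun U f) (g : ι → κ) (hg : ∀ p ∈ V, p ∘ g ∈ U) :
    IsDiffFun V (fun p => f (p ∘ g)) := by
  classical
  obtain ⟨S, F, hF, he⟩ := hf
  refine ⟨S.image g, fun y => F (fun a => y ⟨g a, Finset.mem_image_of_mem g a.2⟩), ?_,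
    fun p hp => he _ (hg p hp)⟩
  refine hF.comp (t := S.restrict '' U) ?_ ?_
  · apply ContDiff.contDiffOn
    fun_prop
  · rintro _ ⟨p, hp, rfl⟩
    exact ⟨p ∘ g, hg p hp, rfl⟩

theorem contDiffOn_fderiv_apply {S : Finset ι} {F : (S → ℝ) → ℝ} {O : Set (S → ℝ)} (hO : IsOpen O)
    (hF : ContDiffOn ℝ ∞ F O) (v : S → ℝ) : ContDiffOn ℝ ∞ (fun y => fderiv ℝ F y v) O :=
  (hF.fderiv_of_isOpen hO (m := ∞) (by simp)).clm_apply contDiffOn_const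

variable [DecidableEq ι]

theorem pd_congr {U : Set (ι → ℝ)} (hU : IsOpen U) {f g : (ι → ℝ) → ℝ} (h : ∀ p ∈ U, f p = g p)
    (a : ι) {p : ι → ℝ} (hp : p ∈ U) : pd a f p = pd a g p := by
  have hc : Continuous fun s : ℝ => Function.update p a s := by fun_prop
  have hev : ∀ᶠ s in nhds (p a), Function.update p a s ∈ U :=
    hc.continuousAt.eventually_mem (hU.mem_nhds (by simpa using hp))
  exact Filter.EventuallyEq.deriv_eq (hev.mono fun s hs => h _ hs)

theorem totalD_congr {U : Set (ι → ℝ)} (hU : IsOpen U) {f g : (ι → ℝ) → ℝ}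
    (h : ∀ p ∈ U, f p = g p) (s : ι → ι) {p : ι → ℝ} (hp : p ∈ U) :
    totalD s f p = totalD s g p := by
  unfold totalD
  exact finsum_congr fun a => by rw [pd_congr hU h a hp]

theorem restrict_update (S : Finset ι) (p : ι → ℝ) (a : ι) (ha : a ∈ S) (s : ℝ) :
    S.restrict (Function.update p a s) = Function.update (S.restrict p) ⟨a, ha⟩ s := by
  ext b
  by_cases hb : b = ⟨a, ha⟩
  · subst hb; simp
  · have : (b : ι) ≠ a := fun h => hb (Subtype.ext h)
    simp [Function.update_of_ne hb, Function.update_of_ne this]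

theorem restrict_update_of_notMem (S : Finset ι) (p : ι → ℝ) (a : ι) (ha : a ∉ S) (s : ℝ) :
    S.restrict (Function.update p a s) = S.restrict p := by
  ext b
  have : (b : ι) ≠ a := fun h => ha (h ▸ b.2)
  simp [Function.update_of_ne this]

theorem hasDerivAt_update_of_rep {U : Set (ι → ℝ)} (hU : IsOpen U) {f : (ι → ℝ) → ℝ}
    {S : Finset ι} {F : (S → ℝ) → ℝ} (hF : ContDiffOn ℝ ∞ F (S.restrict '' U))
    (he : ∀ p ∈ U, f p = F (S.restrict p)) {p : ι → ℝ} (hp : p ∈ U) {a : ι} (ha : a ∈ S) :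
    HasDerivAt (fun s => f (Function.update p a s))
      (fderiv ℝ F (S.restrict p) (Pi.single ⟨a, ha⟩ 1)) (p a) := by
  have hc : Continuous fun s : ℝ => Function.update p a s := by fun_prop
  have hev : ∀ᶠ s in nhds (p a), Function.update p a s ∈ U :=
    hc.continuousAt.eventually_mem (hU.mem_nhds (by simpa using hp))
  have hd : HasFDerivAt F (fderiv ℝ F (S.restrict p)) (S.restrict p) :=
    ((hF.contDiffAt ((isOpen_image_restrict hU S).mem_nhds ⟨p, hp, rfl⟩)).differentiableAt
      (by simp)).hasFDerivAt
  have h1 : HasDerivAt (fun s => F (Function.update (S.restrict p) ⟨a, ha⟩ s))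
      (fderiv ℝ F (S.restrict p) (Pi.single ⟨a, ha⟩ 1)) (p a) := by
    have h2 := hasDerivAt_update (S.restrict p) ⟨a, ha⟩ (p a)
    refine HasFDerivAt.comp_hasDerivAt (p a) (l := F) ?_ h2
    have : Function.update (S.restrict p) ⟨a, ha⟩ (p a) = S.restrict p := by
      rw [← restrict_update]; simp
    rw [this]; exact hd
  refine h1.congr_of_eventuallyEq (hev.mono fun s hs => ?_)
  simp only
  rw [he _ hs, restrict_update _ _ _ ha]

theorem hasDerivAt_update_of_rep_of_notMem {U : Set (ι → ℝ)} (hU : IsOpen U) {f : (ι → ℝ) → ℝ}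
    {S : Finset ι} {F : (S → ℝ) → ℝ}
    (he : ∀ p ∈ U, f p = F (S.restrict p)) {p : ι → ℝ} (hp : p ∈ U) {a : ι} (ha : a ∉ S) :
    HasDerivAt (fun s => f (Function.update p a s)) 0 (p a) := by
  have hc : Continuous fun s : ℝ => Function.update p a s := by fun_prop
  have hev : ∀ᶠ s in nhds (p a), Function.update p a s ∈ U :=
    hc.continuousAt.eventually_mem (hU.mem_nhds (by simpa using hp))
  refine (hasDerivAt_const (p a) (F (S.restrict p))).congr_of_eventuallyEq (hev.mono fun s hs => ?_)
  simp only
  rw [he _ hs, restrict_update_of_notMem _ _ _ ha]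

theorem pd_eq_fderiv {U : Set (ι → ℝ)} (hU : IsOpen U) {f : (ι → ℝ) → ℝ}
    {S : Finset ι} {F : (S → ℝ) → ℝ} (hF : ContDiffOn ℝ ∞ F (S.restrict '' U))
    (he : ∀ p ∈ U, f p = F (S.restrict p)) {p : ι → ℝ} (hp : p ∈ U) {a : ι} (ha : a ∈ S) :
    pd a f p = fderiv ℝ F (S.restrict p) (Pi.single ⟨a, ha⟩ 1) :=
  (hasDerivAt_update_of_rep hU hF he hp ha).deriv

theorem pd_eq_zero_of_notMem {U : Set (ι → ℝ)} (hU : IsOpen U) {f : (ι → ℝ) → ℝ}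
    {S : Finset ι} {F : (S → ℝ) → ℝ}
    (he : ∀ p ∈ U, f p = F (S.restrict p)) {p : ι → ℝ} (hp : p ∈ U) {a : ι} (ha : a ∉ S) :
    pd a f p = 0 :=
  (hasDerivAt_update_of_rep_of_notMem hU he hp ha).deriv

theorem IsDiffFun.differentiableAt {U : Set (ι → ℝ)} (hU : IsOpen U) {f : (ι → ℝ) → ℝ}
    (hf : IsDiffFun U f) (a : ι) {p : ι → ℝ} (hp : p ∈ U) :
    DifferentiableAt ℝ (fun s => f (Function.update p a s)) (p a) := by
  obtain ⟨S, F, hF, he⟩ := hf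
  by_cases ha : a ∈ S
  · exact (hasDerivAt_update_of_rep hU hF he hp ha).differentiableAt
  · exact (hasDerivAt_update_of_rep_of_notMem hU he hp ha).differentiableAt

theorem IsDiffFun.pd {U : Set (ι → ℝ)} (hU : IsOpen U) {f : (ι → ℝ) → ℝ} (hf : IsDiffFun U f)
    (a : ι) : IsDiffFun U (pd a f) := by
  obtain ⟨S, F, hF, he⟩ := hf
  by_cases ha : a ∈ S
  · exact ⟨S, fun y => fderiv ℝ F y (Pi.single ⟨a, ha⟩ 1),
      contDiffOn_fderiv_apply (isOpen_image_restrict hU S) hF _,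
      fun p hp => pd_eq_fderiv hU hF he hp ha⟩
  · exact (isDiffFun_const U 0).congr fun p hp => pd_eq_zero_of_notMem hU he hp ha

theorem pd_add {U : Set (ι → ℝ)} (hU : IsOpen U) {f g : (ι → ℝ) → ℝ} (hf : IsDiffFun U f)
    (hg : IsDiffFun U g) (a : ι) {p : ι → ℝ} (hp : p ∈ U) :
    pd a (fun p => f p + g p) p = pd a f p + pd a g p :=
  deriv_fun_add (hf.differentiableAt hU a hp) (hg.differentiableAt hU a hp)

theorem pd_mul {U : Set (ι → ℝ)} (hU : IsOpen U) {f g : (ι → ℝ) → ℝ} (hf : IsDiffFun U f)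
    (hg : IsDiffFun U g) (a : ι) {p : ι → ℝ} (hp : p ∈ U) :
    pd a (fun p => f p * g p) p = f p * pd a g p + g p * pd a f p := by
  have := deriv_fun_mul (hf.differentiableAt hU a hp) (hg.differentiableAt hU a hp)
  simp only [pd, this, Function.update_eq_self]
  ring

theorem pd_const (c : ℝ) (a : ι) (p : ι → ℝ) : pd a (fun _ => c) p = 0 := by simp [pd]

theorem pd_coord (a b : ι) (p : ι → ℝ) : pd a (fun q => q b) p = if a = b then 1 else 0 := by
  unfold pd
  by_cases h : a = b
  · subst h; simp
  · have : ∀ s : ℝ, Function.update p a s b = p b := fun s => Function.update_of_ne (Ne.symm h) _ _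
    simp [this, h]

theorem pd_comm {U : Set (ι → ℝ)} (hU : IsOpen U) {f : (ι → ℝ) → ℝ} (hf : IsDiffFun U f)
    (a b : ι) {p : ι → ℝ} (hp : p ∈ U) : pd a (pd b f) p = pd b (pd a f) p := by
  obtain ⟨S, hS⟩ := hf.exists_rep
  obtain ⟨T, hT⟩ : ∃ T, T = S ∪ {a, b} := ⟨_, rfl⟩
  obtain ⟨F, hF, he⟩ := hS T (hT ▸ Finset.subset_union_left)
  have ha : a ∈ T := by simp [hT]
  have hb : b ∈ T := by simp [hT]
  have hO := isOpen_image_restrict hU T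
  have key : ∀ c d (hc : c ∈ T) (hd : d ∈ T), pd c (pd d f) p =
      fderiv ℝ (fderiv ℝ F) (T.restrict p) (Pi.single ⟨c, hc⟩ 1) (Pi.single ⟨d, hd⟩ 1) := by
    intro c d hc hd
    rw [pd_eq_fderiv hU (contDiffOn_fderiv_apply hO hF (Pi.single ⟨d, hd⟩ 1))
      (fun q hq => pd_eq_fderiv hU hF he hq hd) hp hc]
    have hdiff : DifferentiableAt ℝ (fderiv ℝ F) (T.restrict p) :=
      ((hF.fderiv_of_isOpen hO (m := ∞) (by simp)).contDiffAt
        (hO.mem_nhds ⟨p, hp, rfl⟩)).differentiableAt (by simp)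
    rw [fderiv_clm_apply hdiff (differentiableAt_const _)]
    simp
  rw [key a b ha hb, key b a hb ha]
  have hsymm : IsSymmSndFDerivAt ℝ F (T.restrict p) :=
    (hF.contDiffAt (hO.mem_nhds ⟨p, hp, rfl⟩)).isSymmSndFDerivAt
      (by simpa using WithTop.coe_le_coe.2 (le_top : (2 : ℕ∞) ≤ ⊤))
  exact hsymm _ _

theorem totalD_eq_sum {s : ι → ι} {f : (ι → ℝ) → ℝ} {S : Finset ι} {p : ι → ℝ}
    (h : ∀ a ∉ S, pd a f p = 0) : totalD s f p = ∑ a ∈ S, p (s a) * pd a f p := by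
  unfold totalD
  refine finsum_eq_sum_of_support_subset _ fun a ha => ?_
  by_contra hn
  exact ha (by simp [h a hn])

theorem IsDiffFun.exists_pd_eq_zero {U : Set (ι → ℝ)} (hU : IsOpen U) {f : (ι → ℝ) → ℝ}
    (hf : IsDiffFun U f) : ∃ S : Finset ι, ∀ a ∉ S, ∀ p ∈ U, JetCalc.pd a f p = 0 := by
  obtain ⟨S, F, hF, he⟩ := hf
  exact ⟨S, fun a ha p hp => pd_eq_zero_of_notMem hU he hp ha⟩

theorem IsDiffFun.totalD {U : Set (ι → ℝ)} (hU : IsOpen U) {f : (ι → ℝ) → ℝ} (hf : IsDiffFun U f)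
    (s : ι → ι) : IsDiffFun U (totalD s f) := by
  obtain ⟨S, hS⟩ := hf.exists_pd_eq_zero hU
  refine IsDiffFun.congr (IsDiffFun.sum S (f := fun a p => p (s a) * JetCalc.pd a f p)
    fun a _ => (isDiffFun_coord U (s a)).mul (hf.pd hU a)) fun p hp => ?_
  exact totalD_eq_sum fun a ha => hS a ha p hp

end DiffFun

/-! ### The ring of differential functions -/

section Ring

open TopologicalSpace

variable {ι : Type*}

/-- The differential functions on an open set `V` of jets, as a subalgebra of the functions on
`V`. -/
def diffFunSubalgebra (V : Opens (ι → ℝ)) : Subalgebra ℝ (V → ℝ) where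
  carrier := {f | ∃ g, IsDiffFun (V : Set (ι → ℝ)) g ∧ ∀ p : V, f p = g p}
  mul_mem' := by
    rintro f f' ⟨g, hg, h⟩ ⟨g', hg', h'⟩
    exact ⟨_, hg.mul hg', fun p => by simp [h, h']⟩
  add_mem' := by
    rintro f f' ⟨g, hg, h⟩ ⟨g', hg', h'⟩
    exact ⟨_, hg.add hg', fun p => by simp [h, h']⟩
  algebraMap_mem' r := ⟨_, isDiffFun_const _ r, fun p => rfl⟩

/-- The ring of differential functions on an open set `V` of jets. Two functions on all jets that
agree on `V` give the same element. -/
def DF (V : Opens (ι → ℝ)) : Type _ := diffFunSubalgebra V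

noncomputable instance (V : Opens (ι → ℝ)) : CommRing (DF V) :=
  inferInstanceAs (CommRing (diffFunSubalgebra V))

noncomputable instance (V : Opens (ι → ℝ)) : Algebra ℝ (DF V) :=
  inferInstanceAs (Algebra ℝ (diffFunSubalgebra V))

namespace DF

variable {V : Opens (ι → ℝ)}

/-- The element of the ring given by a differential function. -/
def mk (g : (ι → ℝ) → ℝ) (hg : IsDiffFun (V : Set (ι → ℝ)) g) : DF V :=
  ⟨fun p => g p, g, hg, fun _ => rfl⟩

open scoped Classical in
/-- The extension by zero to all jets. -/
noncomputable def ex (f : DF V) : (ι → ℝ) → ℝ :=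
  fun p => if h : p ∈ V then f.1 ⟨p, h⟩ else 0

theorem ex_apply (f : DF V) {p : ι → ℝ} (hp : p ∈ V) : f.ex p = f.1 ⟨p, hp⟩ := by
  simp [ex, hp]

theorem isDiffFun_ex (f : DF V) : IsDiffFun (V : Set (ι → ℝ)) f.ex := by
  obtain ⟨g, hg, h⟩ := f.2
  exact hg.congr fun p hp => by rw [ex_apply f hp, h]

theorem ext_ex {f g : DF V} (h : ∀ p ∈ V, f.ex p = g.ex p) : f = g := by
  refine Subtype.ext (funext fun p => ?_)
  have := h p p.2
  rwa [ex_apply f p.2, ex_apply g p.2] at this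

theorem ex_mk {g : (ι → ℝ) → ℝ} (hg : IsDiffFun (V : Set (ι → ℝ)) g) {p : ι → ℝ} (hp : p ∈ V) :
    (mk g hg).ex p = g p := ex_apply _ hp

theorem ex_add (f g : DF V) {p : ι → ℝ} (hp : p ∈ V) : (f + g).ex p = f.ex p + g.ex p := by
  simp only [ex_apply _ hp]; rfl

theorem ex_sub (f g : DF V) {p : ι → ℝ} (hp : p ∈ V) : (f - g).ex p = f.ex p - g.ex p := by
  simp only [ex_apply _ hp]; rfl

theorem ex_neg (f : DF V) {p : ι → ℝ} (hp : p ∈ V) : (-f).ex p = -f.ex p := by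
  simp only [ex_apply _ hp]; rfl

theorem ex_zero {p : ι → ℝ} (hp : p ∈ V) : (0 : DF V).ex p = 0 := by
  simp only [ex_apply _ hp]; rfl

theorem ex_one {p : ι → ℝ} (hp : p ∈ V) : (1 : DF V).ex p = 1 := by
  simp only [ex_apply _ hp]; rfl

theorem ex_mul (f g : DF V) {p : ι → ℝ} (hp : p ∈ V) : (f * g).ex p = f.ex p * g.ex p := by
  simp only [ex_apply _ hp]; rfl

theorem ex_smul (c : ℝ) (f : DF V) {p : ι → ℝ} (hp : p ∈ V) : (c • f).ex p = c * f.ex p := by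
  simp only [ex_apply _ hp]; rfl

theorem ex_sum {α : Type*} (s : Finset α) (f : α → DF V) {p : ι → ℝ} (hp : p ∈ V) :
    (∑ a ∈ s, f a).ex p = ∑ a ∈ s, (f a).ex p := by
  classical
  induction s using Finset.induction_on with
  | empty => simp [ex_zero hp]
  | insert a s ha ih => rw [Finset.sum_insert ha, Finset.sum_insert ha, ex_add _ _ hp, ih]

theorem ex_algebraMap (c : ℝ) {p : ι → ℝ} (hp : p ∈ V) : (algebraMap ℝ (DF V) c).ex p = c := by
  simp only [ex_apply _ hp]; rfl

/-- A jet coordinate. -/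
def coord (V : Opens (ι → ℝ)) (a : ι) : DF V := mk (fun p => p a) (isDiffFun_coord _ a)

theorem ex_coord (a : ι) {p : ι → ℝ} (hp : p ∈ V) : (coord V a).ex p = p a := ex_mk _ hp

/-- Pull-back along the map of jets that reads off the coordinates listed by `g`. -/
def pull {κ : Type*} {W : Opens (κ → ℝ)} (g : ι → κ) (hg : ∀ p ∈ W, p ∘ g ∈ V) :
    DF V →ₐ[ℝ] DF W where
  toFun f := ⟨fun p => f.1 ⟨p.1 ∘ g, hg p.1 p.2⟩, by
    obtain ⟨f', hf', h⟩ := f.2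
    exact ⟨_, hf'.comp_coords g hg, fun p => h _⟩⟩
  map_one' := rfl
  map_mul' _ _ := rfl
  map_zero' := rfl
  map_add' _ _ := rfl
  commutes' _ := rfl

theorem ex_pull {κ : Type*} {W : Opens (κ → ℝ)} {g : ι → κ} (hg : ∀ p ∈ W, p ∘ g ∈ V) (f : DF V)
    {p : κ → ℝ} (hp : p ∈ W) : (pull g hg f).ex p = f.ex (p ∘ g) := by
  rw [ex_apply _ hp, ex_apply _ (hg p hp)]
  rfl

/-- Restriction to a smaller open set. -/
def res {W V : Opens (ι → ℝ)} (h : W ≤ V) : DF V →ₐ[ℝ] DF W :=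
  pull id fun _ hp => h hp

theorem ex_res {W : Opens (ι → ℝ)} (h : W ≤ V) (f : DF V) {p : ι → ℝ} (hp : p ∈ W) :
    (res h f).ex p = f.ex p := ex_pull _ f hp

theorem pull_coord {κ : Type*} {W : Opens (κ → ℝ)} {g : ι → κ}
    (hg : ∀ p ∈ W, p ∘ g ∈ V) (a : ι) : pull g hg (coord V a) = coord W (g a) := rfl

variable [DecidableEq ι]

/-- The partial derivative as a derivation of the ring of differential functions. -/
noncomputable def pdR (a : ι) : Derivation ℝ (DF V) (DF V) :=
  Derivation.mk'
    { toFun := fun f => mk (pd a f.ex) (f.isDiffFun_ex.pd V.isOpen a)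
      map_add' := fun f g => ext_ex fun p hp => by
        rw [ex_add _ _ hp, ex_mk _ hp, ex_mk _ hp, ex_mk _ hp,
          ← pd_add V.isOpen f.isDiffFun_ex g.isDiffFun_ex a hp]
        exact pd_congr V.isOpen (fun q hq => ex_add f g hq) a hp
      map_smul' := fun c f => ext_ex fun p hp => by
        rw [RingHom.id_apply, ex_smul _ _ hp, ex_mk _ hp, ex_mk _ hp,
          pd_congr V.isOpen (fun q hq => ex_smul c f hq) a hp,
          pd_mul V.isOpen (isDiffFun_const _ c) f.isDiffFun_ex a hp, pd_const, mul_zero, add_zero] }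
    fun f g => ext_ex fun p hp => by
      simp only [LinearMap.coe_mk, AddHom.coe_mk, smul_eq_mul]
      rw [ex_add _ _ hp, ex_mul _ _ hp, ex_mul _ _ hp, ex_mk _ hp, ex_mk _ hp, ex_mk _ hp,
        pd_congr V.isOpen (fun q hq => ex_mul f g hq) a hp,
        pd_mul V.isOpen f.isDiffFun_ex g.isDiffFun_ex a hp]

theorem ex_pdR (a : ι) (f : DF V) {p : ι → ℝ} (hp : p ∈ V) : (pdR a f).ex p = pd a f.ex p :=
  ex_mk (f.isDiffFun_ex.pd V.isOpen a) hp

theorem exists_pdR_eq_zero (f : DF V) : ∃ S : Finset ι, ∀ a ∉ S, pdR a f = 0 := by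
  obtain ⟨S, hS⟩ := f.isDiffFun_ex.exists_pd_eq_zero V.isOpen
  exact ⟨S, fun a ha => ext_ex fun p hp => by rw [ex_pdR _ _ hp, hS a ha p hp, ex_zero hp]⟩

theorem pdR_comm (a b : ι) (f : DF V) : pdR a (pdR b f) = pdR b (pdR a f) := by
  refine ext_ex fun p hp => ?_
  rw [ex_pdR _ _ hp, ex_pdR _ _ hp, pd_congr V.isOpen (fun q hq => ex_pdR b f hq) a hp,
    pd_congr V.isOpen (fun q hq => ex_pdR a f hq) b hp, pd_comm V.isOpen f.isDiffFun_ex a b hp]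

theorem pdR_coord (a b : ι) : pdR a (coord V b) = if a = b then 1 else 0 := by
  refine ext_ex fun p hp => ?_
  rw [ex_pdR _ _ hp, pd_congr V.isOpen (fun q hq => ex_coord b hq) a hp, pd_coord]
  split_ifs
  · rw [ex_one hp]
  · rw [ex_zero hp]

theorem ex_totalD_eq_sum (s : ι → ι) (f : DF V) {S : Finset ι} (hS : ∀ a ∉ S, pdR a f = 0)
    {p : ι → ℝ} (hp : p ∈ V) :
    totalD s f.ex p = (∑ a ∈ S, coord V (s a) * pdR a f).ex p := by
  rw [ex_sum _ _ hp, totalD_eq_sum (S := S)]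
  · exact Finset.sum_congr rfl fun a _ => by rw [ex_mul _ _ hp, ex_pdR _ _ hp, ex_coord _ hp]
  · intro a ha
    rw [← ex_pdR _ _ hp, hS a ha, ex_zero hp]

/-- The total derivative as a derivation of the ring of differential functions. -/
noncomputable def tdR (s : ι → ι) : Derivation ℝ (DF V) (DF V) :=
  Derivation.mk'
    { toFun := fun f => mk (totalD s f.ex) (f.isDiffFun_ex.totalD V.isOpen s)
      map_add' := fun f g => ext_ex fun p hp => by
        obtain ⟨S, hS⟩ := f.exists_pdR_eq_zero
        obtain ⟨T, hT⟩ := g.exists_pdR_eq_zero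
        rw [ex_add _ _ hp, ex_mk _ hp, ex_mk _ hp, ex_mk _ hp,
          ex_totalD_eq_sum s f (S := S ∪ T) (fun a ha => hS a (by simp_all)) hp,
          ex_totalD_eq_sum s g (S := S ∪ T) (fun a ha => hT a (by simp_all)) hp,
          ex_totalD_eq_sum s (f + g) (S := S ∪ T)
            (fun a ha => by rw [map_add, hS a (by simp_all), hT a (by simp_all), add_zero]) hp,
          ← ex_add _ _ hp, ← Finset.sum_add_distrib]
        simp [mul_add]
      map_smul' := fun c f => ext_ex fun p hp => by
        obtain ⟨S, hS⟩ := f.exists_pdR_eq_zero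
        rw [RingHom.id_apply, ex_smul _ _ hp, ex_mk _ hp, ex_mk _ hp,
          ex_totalD_eq_sum s f hS hp,
          ex_totalD_eq_sum s (c • f) (S := S) (fun a ha => by
            rw [Derivation.map_smul, hS a ha, smul_zero]) hp,
          ← ex_smul _ _ hp, Finset.smul_sum]
        simp }
    fun f g => ext_ex fun p hp => by
      obtain ⟨S, hS⟩ := f.exists_pdR_eq_zero
      obtain ⟨T, hT⟩ := g.exists_pdR_eq_zero
      simp only [LinearMap.coe_mk, AddHom.coe_mk, smul_eq_mul]
      rw [ex_add _ _ hp, ex_mul _ _ hp, ex_mul _ _ hp, ex_mk _ hp, ex_mk _ hp, ex_mk _ hp,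
        ex_totalD_eq_sum s f (S := S ∪ T) (fun a ha => hS a (by simp_all)) hp,
        ex_totalD_eq_sum s g (S := S ∪ T) (fun a ha => hT a (by simp_all)) hp,
        ex_totalD_eq_sum s (f * g) (S := S ∪ T)
          (fun a ha => by
            rw [Derivation.leibniz, hS a (by simp_all), hT a (by simp_all)]; simp) hp,
        ← ex_mul _ _ hp, ← ex_mul _ _ hp, ← ex_add _ _ hp, Finset.mul_sum, Finset.mul_sum,
        ← Finset.sum_add_distrib]
      congr 1
      refine Finset.sum_congr rfl fun a _ => ?_
      rw [Derivation.leibniz, smul_eq_mul, smul_eq_mul]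
      ring

theorem ex_tdR (s : ι → ι) (f : DF V) {p : ι → ℝ} (hp : p ∈ V) :
    (tdR s f).ex p = totalD s f.ex p :=
  ex_mk (f.isDiffFun_ex.totalD V.isOpen s) hp

theorem tdR_eq_sum (s : ι → ι) (f : DF V) {S : Finset ι} (hS : ∀ a ∉ S, pdR a f = 0) :
    tdR s f = ∑ a ∈ S, coord V (s a) * pdR a f :=
  ext_ex fun p hp => by rw [ex_tdR _ _ hp, ex_totalD_eq_sum s f hS hp]

theorem tdR_coord (s : ι → ι) (a : ι) : tdR s (coord V a) = coord V (s a) := by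
  rw [tdR_eq_sum s _ (S := {a}) fun b hb => by rw [pdR_coord, if_neg (by simpa using hb)]]
  simp [pdR_coord]

theorem ex_iterate_tdR (s : ι → ι) {f : (ι → ℝ) → ℝ} (f' : DF V) (h : ∀ p ∈ V, f p = f'.ex p)
    (k : ℕ) {p : ι → ℝ} (hp : p ∈ V) : (totalD s)^[k] f p = ((tdR s)^[k] f').ex p := by
  induction k generalizing p with
  | zero => exact h p hp
  | succ k ih =>
    rw [Function.iterate_succ_apply', Function.iterate_succ_apply', ex_tdR _ _ hp]
    exact totalD_congr V.isOpen (fun q hq => ih hq) s hp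

theorem pdR_pull {κ : Type*} [DecidableEq κ] {W : Opens (κ → ℝ)} {g : ι → κ}
    (hg : ∀ p ∈ W, p ∘ g ∈ V) (hi : Function.Injective g) (a : ι) (f : DF V) :
    pdR (g a) (pull g hg f) = pull g hg (pdR a f) := by
  refine ext_ex fun p hp => ?_
  rw [ex_pdR _ _ hp, ex_pull _ _ hp, ex_pdR _ _ (hg p hp),
    pd_congr W.isOpen (fun q hq => ex_pull hg f hq) _ hp]
  simp only [pd, Function.update_comp_eq_of_injective p hi, Function.comp_apply]

theorem pdR_pull_of_notMem {κ : Type*} {W : Opens (κ → ℝ)} {g : κ → ι}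
    (hg : ∀ p ∈ V, p ∘ g ∈ W) {b : ι} (hb : b ∉ Set.range g) (f : DF W) :
    pdR b (pull g hg f) = 0 := by
  refine ext_ex fun p hp => ?_
  rw [ex_pdR _ _ hp, ex_zero hp, pd_congr V.isOpen (fun q hq => ex_pull hg f hq) _ hp]
  have : ∀ s, Function.update p b s ∘ g = p ∘ g := fun s =>
    Function.update_comp_eq_of_forall_ne p s fun i hi => hb ⟨i, hi⟩
  simp [pd, this]

theorem tdR_pull {κ : Type*} [DecidableEq κ] {W : Opens (κ → ℝ)} {g : ι → κ}
    (hg : ∀ p ∈ W, p ∘ g ∈ V) (hi : Function.Injective g) {s : ι → ι} {t : κ → κ}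
    (hst : ∀ a, t (g a) = g (s a)) (f : DF V) :
    tdR t (pull g hg f) = pull g hg (tdR s f) := by
  obtain ⟨S, hS⟩ := f.exists_pdR_eq_zero
  rw [tdR_eq_sum s f hS, tdR_eq_sum t _ (S := S.image g), Finset.sum_image hi.injOn, map_sum]
  · refine Finset.sum_congr rfl fun a _ => ?_
    rw [pdR_pull hg hi, hst, map_mul, pull_coord]
  · intro b hb
    by_cases hr : b ∈ Set.range g
    · obtain ⟨a, rfl⟩ := hr
      rw [pdR_pull hg hi, hS a (fun ha => hb (Finset.mem_image_of_mem g ha)), map_zero]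
    · exact pdR_pull_of_notMem hg hr f

theorem pdR_tdR (s : ι → ι) (a : ι) (f : DF V) {S : Finset ι} (hS : ∀ b ∉ S, pdR b f = 0) :
    pdR a (tdR s f) = tdR s (pdR a f) + ∑ b ∈ S, if a = s b then pdR b f else 0 := by
  have hS' : ∀ b ∉ S, pdR b (pdR a f) = 0 := fun b hb => by rw [pdR_comm, hS b hb, map_zero]
  rw [tdR_eq_sum s f hS, tdR_eq_sum s _ hS', map_sum, ← Finset.sum_add_distrib]
  refine Finset.sum_congr rfl fun b _ => ?_
  rw [Derivation.leibniz, pdR_coord, pdR_comm]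
  split_ifs <;> simp

end DF

/-- The total derivative raises the order of a coordinate by one. -/
def suc {κ : Type*} (a : ℕ × κ) : ℕ × κ := (a.1 + 1, a.2)

namespace DF

variable {κ : Type*} [DecidableEq κ] {V : Opens (ℕ × κ → ℝ)}

theorem pdR_zero_tdR (k : κ) (f : DF V) : pdR (0, k) (tdR suc f) = tdR suc (pdR (0, k) f) := by
  obtain ⟨S, hS⟩ := f.exists_pdR_eq_zero
  rw [pdR_tdR _ _ f hS, Finset.sum_eq_zero, add_zero]
  intro b _
  simp [suc]

theorem pdR_succ_tdR (σ : ℕ) (k : κ) (f : DF V) :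
    pdR (σ + 1, k) (tdR suc f) = tdR suc (pdR (σ + 1, k) f) + pdR (σ, k) f := by
  obtain ⟨S, hS⟩ := f.exists_pdR_eq_zero
  rw [pdR_tdR _ _ f (S := insert (σ, k) S) (fun b hb => hS b (by simp_all))]
  congr 1
  rw [Finset.sum_eq_single (σ, k)]
  · simp [suc]
  · rintro ⟨τ, j⟩ _ h
    rw [if_neg]
    rintro h'
    simp only [suc, Prod.mk.injEq, add_left_inj] at h' h
    exact h (by rw [h'.1, h'.2])
  · simp

theorem exists_order (f : DF V) : ∃ N, ∀ a : ℕ × κ, N ≤ a.1 → pdR a f = 0 := by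
  obtain ⟨S, hS⟩ := f.exists_pdR_eq_zero
  refine ⟨S.sup (fun a => a.1) + 1, fun a ha => hS a fun h => ?_⟩
  have := Finset.le_sup (f := fun a : ℕ × κ => a.1) h
  omega

end DF

end Ring

/-! ### Multilinear differential operators and integration by parts -/

section Tensors

variable {μ M R : Type*}

/-- The indices of order less than `N`. -/
def box (μ : Type*) [Fintype μ] (N : ℕ) : Finset (ℕ × μ) := Finset.range N ×ˢ Finset.univ

theorem mem_box [Fintype μ] {N : ℕ} {a : ℕ × μ} : a ∈ box μ N ↔ a.1 < N := by simp [box]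

section Slot

variable [AddCommGroup M] [Module ℝ M]

/-- The shift of a coefficient family, `T_{σ,i} ↦ T_{σ-1,i}`, with `T_{-1,i} = 0`. -/
def pr : (ℕ × μ → M) →ₗ[ℝ] (ℕ × μ → M) where
  toFun T a := match a with
    | (0, _) => 0
    | (σ + 1, i) => T (σ, i)
  map_add' S T := by ext ⟨_ | σ, i⟩ <;> simp
  map_smul' c T := by ext ⟨_ | σ, i⟩ <;> simp

@[simp] theorem pr_zero (T : ℕ × μ → M) (i : μ) : pr T (0, i) = 0 := rfl

@[simp] theorem pr_succ (T : ℕ × μ → M) (σ : ℕ) (i : μ) : pr T (σ + 1, i) = T (σ, i) := rfl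

/-- The effect of the total derivative on the coefficients of a differential operator with
coefficients in `M`: if `Δ` is the derivative on `M`, then `∂_x (T_a ∂^a X)` is
`(slot Δ T)_a ∂^a X`. Iterating `slot` gives the total derivative of multilinear differential
operators, whose coefficients are written as curried functions of several indices. -/
def slot (Δ : Module.End ℝ M) : Module.End ℝ (ℕ × μ → M) :=
  LinearMap.pi (fun a => Δ ∘ₗ LinearMap.proj a) + pr

theorem slot_apply (Δ : Module.End ℝ M) (T : ℕ × μ → M) (a : ℕ × μ) :
    slot Δ T a = Δ (T a) + pr T a := rfl

/-- `T` has order less than `N`. -/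
def OrderLT (N : ℕ) (T : ℕ × μ → M) : Prop := ∀ a, N ≤ a.1 → T a = 0

/-- A family of predicates `P N`, read as "of order less than `N`", which is compatible with the
linear structure and with an operator `Δ` that raises the order by one. -/
structure IsOrderBound (Δ : Module.End ℝ M) (P : ℕ → M → Prop) : Prop where
  zero : ∀ N, P N 0
  add : ∀ N x y, P N x → P N y → P N (x + y)
  smul : ∀ N (c : ℝ) x, P N x → P N (c • x)
  mono : ∀ N N' x, N ≤ N' → P N x → P N' x
  step : ∀ N x, P N x → P (N + 1) (Δ x)

theorem IsOrderBound.sum {Δ : Module.End ℝ M} {P : ℕ → M → Prop} (h : IsOrderBound Δ P) {α : Type*}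
    (s : Finset α) (f : α → M) (N : ℕ) (hf : ∀ a ∈ s, P N (f a)) : P N (∑ a ∈ s, f a) := by
  classical
  induction s using Finset.induction_on with
  | empty => simpa using h.zero N
  | insert a s ha ih =>
    rw [Finset.sum_insert ha]
    exact h.add _ _ _ (hf a (by simp)) (ih fun b hb => hf b (by simp [hb]))

theorem IsOrderBound.neg_pow {Δ : Module.End ℝ M} {P : ℕ → M → Prop} (h : IsOrderBound Δ P) {N : ℕ}
    {x : M} (hx : P N x) (k : ℕ) : P (N + k) (((-Δ) ^ k) x) := by
  induction k with
  | zero => simpa using hx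
  | succ k ih =>
    rw [pow_succ', Module.End.mul_apply, LinearMap.neg_apply]
    simpa [add_assoc] using h.smul _ (-1) _ (h.step _ _ ih)

/-- The order bound for a multilinear operator with one more argument. -/
def liftBound (P : ℕ → M → Prop) (N : ℕ) (T : ℕ × μ → M) : Prop :=
  OrderLT N T ∧ ∀ a, P N (T a)

theorem IsOrderBound.lift {Δ : Module.End ℝ M} {P : ℕ → M → Prop} (h : IsOrderBound Δ P) :
    IsOrderBound (slot (μ := μ) Δ) (liftBound P) where
  zero N := ⟨fun _ _ => rfl, fun _ => h.zero N⟩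
  add N S T hS hT := ⟨fun a ha => by simp [hS.1 a ha, hT.1 a ha],
    fun a => h.add _ _ _ (hS.2 a) (hT.2 a)⟩
  smul N c S hS := ⟨fun a ha => by simp [hS.1 a ha], fun a => h.smul _ _ _ (hS.2 a)⟩
  mono N N' S hN hS := ⟨fun a ha => hS.1 a (hN.trans ha), fun a => h.mono _ _ _ hN (hS.2 a)⟩
  step N S hS := by
    constructor
    · rintro ⟨_ | σ, i⟩ ha
      · simp at ha
      · have h1 : N ≤ σ := by simpa using ha
        rw [slot_apply, pr_succ, hS.1 (σ + 1, i) (by simp; omega), hS.1 (σ, i) h1]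
        simp
    · rintro ⟨_ | σ, i⟩
      · simpa [slot_apply] using h.step _ _ (hS.2 _)
      · rw [slot_apply, pr_succ]
        exact h.add _ _ _ (h.step _ _ (hS.2 _)) (h.mono _ _ _ (Nat.le_succ N) (hS.2 _))

/-- The total derivative is injective on operators of finite order. -/
theorem eq_zero_of_slot_eq_zero {Δ : Module.End ℝ M} {T : ℕ × μ → M} {N : ℕ} (hT : OrderLT N T)
    (h : slot Δ T = 0) : T = 0 := by
  have key : ∀ k σ i, N ≤ σ + k → T (σ, i) = 0 := by
    intro k
    induction k with
    | zero => exact fun σ i hσ => hT (σ, i) hσ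
    | succ k ih =>
      intro σ i hσ
      have h1 := congrFun h (σ + 1, i)
      rw [slot_apply, pr_succ, ih (σ + 1) i (by omega)] at h1
      simpa using h1
  funext ⟨σ, i⟩
  exact key N σ i (by omega)

/-- Integration by parts, principal term: modulo total derivatives, `T_{σ,i} ∂^σ X^i` equals
`E_i X^i` with `E_i = (-∂)^σ T_{σ,i}`. -/
def redE (Δ : Module.End ℝ M) (N : ℕ) (T : ℕ × μ → M) (i : μ) : M :=
  ∑ k ∈ Finset.range N, ((-Δ) ^ k) (T (k, i))

/-- Integration by parts, the operator under the total derivative. -/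
def redS (Δ : Module.End ℝ M) (N : ℕ) (T : ℕ × μ → M) : ℕ × μ → M :=
  fun a => ∑ k ∈ Finset.range N, ((-Δ) ^ k) (T (a.1 + 1 + k, a.2))

/-- The operator of order zero with coefficients `E_i`. -/
def ofZero (E : μ → M) : ℕ × μ → M := fun a => if a.1 = 0 then E a.2 else 0

theorem redS_step (Δ : Module.End ℝ M) {N : ℕ} {T : ℕ × μ → M} (hT : OrderLT N T) (σ : ℕ) (i : μ) :
    Δ (redS Δ N T (σ, i)) + ∑ k ∈ Finset.range N, ((-Δ) ^ k) (T (σ + k, i)) = T (σ, i) := by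
  have h1 : ∑ k ∈ Finset.range N, ((-Δ) ^ k) (T (σ + k, i)) =
      ∑ k ∈ Finset.range (N + 1), ((-Δ) ^ k) (T (σ + k, i)) := by
    rw [Finset.sum_range_succ, hT (σ + N, i) (by simp), map_zero, add_zero]
  rw [h1, Finset.sum_range_succ', redS, map_sum, ← add_assoc, ← Finset.sum_add_distrib,
    Finset.sum_eq_zero, zero_add]
  · simp
  · intro k _
    rw [pow_succ', Module.End.mul_apply, LinearMap.neg_apply,
      show σ + 1 + k = σ + (k + 1) by ring, add_neg_cancel]

/-- Integration by parts. -/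
theorem eq_ofZero_add_slot (Δ : Module.End ℝ M) {N : ℕ} {T : ℕ × μ → M} (hT : OrderLT N T) :
    T = ofZero (redE Δ N T) + slot Δ (redS Δ N T) := by
  funext ⟨σ, i⟩
  rcases σ with _ | σ
  · have := redS_step Δ hT 0 i
    simp only [zero_add] at this
    simp only [Pi.add_apply, ofZero, slot_apply, pr_zero, add_zero, redE, if_true]
    rw [add_comm, this]
  · have := redS_step Δ hT (σ + 1) i
    simp only [Pi.add_apply, ofZero, slot_apply, pr_succ, Nat.add_eq_zero_iff, one_ne_zero,
      and_false, if_false, zero_add]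
    exact this.symm

theorem IsOrderBound.redS {Δ : Module.End ℝ M} {P : ℕ → M → Prop} (h : IsOrderBound Δ P) {N : ℕ}
    {T : ℕ × μ → M} (hT : liftBound P N T) : liftBound P (2 * N) (redS Δ N T) := by
  constructor
  · intro a ha
    refine Finset.sum_eq_zero fun k _ => ?_
    rw [hT.1 _ (by simp; omega), map_zero]
  · intro a
    refine h.sum _ _ _ fun k hk => ?_
    have := Finset.mem_range.1 hk
    exact h.mono (N + k) _ _ (by omega) (h.neg_pow (hT.2 _) k)

theorem IsOrderBound.redE {Δ : Module.End ℝ M} {P : ℕ → M → Prop} (h : IsOrderBound Δ P) {N : ℕ}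
    {T : ℕ × μ → M} (hT : liftBound P N T) (i : μ) : P (2 * N) (redE Δ N T i) := by
  refine h.sum _ _ _ fun k hk => ?_
  have := Finset.mem_range.1 hk
  exact h.mono (N + k) _ _ (by omega) (h.neg_pow (hT.2 _) k)

theorem redE_mono {Δ : Module.End ℝ M} {N N' : ℕ} {T : ℕ × μ → M} (hT : OrderLT N T) (h : N ≤ N')
    (i : μ) : redE Δ N' T i = redE Δ N T i := by
  unfold redE
  symm
  refine Finset.sum_subset (Finset.range_subset_range.2 h) fun k _ hk => ?_
  rw [hT (k, i) (by simpa using hk), map_zero]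

/-- Total derivatives integrate to zero. -/
theorem redE_slot {Δ : Module.End ℝ M} {N : ℕ} {S : ℕ × μ → M} (hS : OrderLT N S) (i : μ) :
    redE Δ (N + 1) (slot Δ S) i = 0 := by
  unfold redE
  rw [Finset.sum_range_succ']
  simp only [slot_apply, pr_succ, pr_zero, add_zero, pow_zero, Module.End.one_apply, map_add]
  have : ∀ n, ∑ k ∈ Finset.range n, (((-Δ) ^ (k + 1)) (Δ (S (k + 1, i))) +
      ((-Δ) ^ (k + 1)) (S (k, i))) + Δ (S (0, i)) = ((-Δ) ^ n) (Δ (S (n, i))) := by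
    intro n
    induction n with
    | zero => simp
    | succ n ih =>
      rw [Finset.sum_range_succ, add_right_comm, ih, pow_succ (-Δ) n, Module.End.mul_apply,
        Module.End.mul_apply, LinearMap.neg_apply, LinearMap.neg_apply, map_neg, map_neg]
      abel
  rw [this, hS (N, i) le_rfl]
  simp

theorem map_neg_pow {M' : Type*} [AddCommGroup M'] [Module ℝ M'] {Δ : Module.End ℝ M}
    {Δ' : Module.End ℝ M'} {P : ℕ → M → Prop} (h : IsOrderBound Δ P) (φ : M →ₗ[ℝ] M') {L : ℕ}
    (hφ : ∀ n x, n < L → P n x → φ (Δ x) = Δ' (φ x)) {N : ℕ} {x : M} (hx : P N x) (k : ℕ)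
    (hk : N + k ≤ L) : φ (((-Δ) ^ k) x) = ((-Δ') ^ k) (φ x) := by
  induction k with
  | zero => simp
  | succ k ih =>
    rw [pow_succ', pow_succ', Module.End.mul_apply, Module.End.mul_apply, LinearMap.neg_apply,
      LinearMap.neg_apply, map_neg, hφ (N + k) _ (by omega) (h.neg_pow hx k), ih (by omega)]

theorem map_redE {M' : Type*} [AddCommGroup M'] [Module ℝ M'] {Δ : Module.End ℝ M}
    {Δ' : Module.End ℝ M'} {P : ℕ → M → Prop} (h : IsOrderBound Δ P) (φ : M →ₗ[ℝ] M') {L : ℕ}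
    (hφ : ∀ n x, n < L → P n x → φ (Δ x) = Δ' (φ x)) {N : ℕ} {T : ℕ × μ → M}
    (hT : liftBound P N T) (hL : 2 * N ≤ L) (i : μ) :
    φ (redE Δ N T i) = redE Δ' N (fun a => φ (T a)) i := by
  unfold redE
  rw [map_sum]
  refine Finset.sum_congr rfl fun k hk => ?_
  have := Finset.mem_range.1 hk
  exact map_neg_pow h φ hφ (hT.2 _) k (by omega)

theorem map_slot {M' : Type*} [AddCommGroup M'] [Module ℝ M']
    {Δ : Module.End ℝ M} {Δ' : Module.End ℝ M'} (φ : M →ₗ[ℝ] M') {T : ℕ × μ → M}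
    (h : ∀ a, φ (Δ (T a)) = Δ' (φ (T a))) :
    (fun a => φ (slot Δ T a)) = slot Δ' fun a => φ (T a) := by
  funext ⟨σ, i⟩
  rcases σ with _ | σ <;> simp [slot_apply, h]

end Slot

section Bounds

variable [CommRing R] [Algebra ℝ R] (D : Derivation ℝ R R)

/-- No order restriction on the coefficient functions themselves. -/
abbrev bound₀ (R : Type*) : ℕ → R → Prop := fun _ _ => True

/-- Linear differential operators of order less than `N`. -/
abbrev bound₁ (μ R : Type*) [CommRing R] [Algebra ℝ R] : ℕ → (ℕ × μ → R) → Prop :=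
  liftBound (bound₀ R)

/-- Bilinear differential operators of order less than `N`. -/
abbrev bound₂ (μ R : Type*) [CommRing R] [Algebra ℝ R] : ℕ → (ℕ × μ → ℕ × μ → R) → Prop :=
  liftBound (bound₁ μ R)

/-- Trilinear differential operators of order less than `N`. -/
abbrev bound₃ (μ R : Type*) [CommRing R] [Algebra ℝ R] :
    ℕ → (ℕ × μ → ℕ × μ → ℕ × μ → R) → Prop :=
  liftBound (bound₂ μ R)

/-- The total derivative of a linear differential operator. -/
abbrev slot₁ : Module.End ℝ (ℕ × μ → R) := slot D.toLinearMap

/-- The total derivative of a bilinear differential operator. -/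
abbrev slot₂ : Module.End ℝ (ℕ × μ → ℕ × μ → R) := slot (slot₁ D)

/-- The total derivative of a trilinear differential operator. -/
abbrev slot₃ : Module.End ℝ (ℕ × μ → ℕ × μ → ℕ × μ → R) := slot (slot₂ D)

theorem isOrderBound₀ : IsOrderBound D.toLinearMap (bound₀ R) :=
  ⟨fun _ => trivial, fun _ _ _ _ _ => trivial, fun _ _ _ _ => trivial,
    fun _ _ _ _ _ => trivial, fun _ _ _ => trivial⟩

theorem isOrderBound₁ : IsOrderBound (slot₁ (μ := μ) D) (bound₁ μ R) := (isOrderBound₀ D).lift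

theorem isOrderBound₂ : IsOrderBound (slot₂ (μ := μ) D) (bound₂ μ R) := (isOrderBound₁ D).lift

theorem isOrderBound₃ : IsOrderBound (slot₃ (μ := μ) D) (bound₃ μ R) := (isOrderBound₂ D).lift

end Bounds

section Eval

variable [CommRing R] [Algebra ℝ R] [Fintype μ] (D : Derivation ℝ R R)

/-- The value `T_a ∂^{a} X` of a differential operator of order less than `N`. -/
noncomputable def ev (N : ℕ) (X : μ → R) : (ℕ × μ → R) →ₗ[ℝ] R where
  toFun T := ∑ a ∈ box μ N, T a * (D^[a.1]) (X a.2)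
  map_add' S T := by simp [add_mul, Finset.sum_add_distrib]
  map_smul' c T := by simp [Finset.smul_sum]

theorem ev_apply (N : ℕ) (X : μ → R) (T : ℕ × μ → R) :
    ev D N X T = ∑ a ∈ box μ N, T a * (D^[a.1]) (X a.2) := rfl

theorem ev_mono {N N' : ℕ} {T : ℕ × μ → R} (hT : OrderLT N T) (h : N ≤ N') (X : μ → R) :
    ev D N' X T = ev D N X T := by
  rw [ev_apply, ev_apply]
  symm
  refine Finset.sum_subset (fun a ha => ?_) fun a _ ha => ?_
  · rw [mem_box] at ha ⊢; omega
  · rw [mem_box] at ha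
    rw [hT a (by omega), zero_mul]

theorem ev_eq_sum (N : ℕ) (X : μ → R) (T : ℕ × μ → R) :
    ev D N X T = ∑ σ ∈ Finset.range N, ∑ i, T (σ, i) * (D^[σ]) (X i) := by
  rw [ev_apply, box, Finset.sum_product]

theorem ev_slot {n N : ℕ} (h : n < N) {T : ℕ × μ → R} (hT : OrderLT n T) (X : μ → R) :
    ev D N X (slot D.toLinearMap T) = D (ev D N X T) := by
  obtain ⟨N, rfl⟩ : ∃ k, N = k + 1 := ⟨N - 1, by omega⟩
  have h0 : ∀ i, T (N, i) = 0 := fun i => hT (N, i) (by simp; omega)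
  rw [ev_eq_sum, ev_eq_sum, map_sum]
  simp only [slot_apply, add_mul, Finset.sum_add_distrib]
  rw [Finset.sum_range_succ' (fun σ => ∑ i, pr T (σ, i) * (D^[σ]) (X i))]
  have h1 : ∀ σ, D (∑ i, T (σ, i) * (D^[σ]) (X i)) =
      ∑ i, D (T (σ, i)) * (D^[σ]) (X i) + ∑ i, T (σ, i) * (D^[σ + 1]) (X i) := by
    intro σ
    rw [map_sum, ← Finset.sum_add_distrib]
    refine Finset.sum_congr rfl fun i _ => ?_
    rw [Derivation.leibniz, Function.iterate_succ_apply', smul_eq_mul, smul_eq_mul]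
    ring
  simp only [h1, Finset.sum_add_distrib, pr_succ, pr_zero, zero_mul, Finset.sum_const_zero,
    add_zero]
  rw [Finset.sum_range_succ (fun σ => ∑ i, T (σ, i) * (D^[σ + 1]) (X i))]
  simp [h0]

theorem ev_ofZero {N : ℕ} (hN : 0 < N) (E : μ → R) (X : μ → R) :
    ev D N X (ofZero E) = ∑ i, E i * X i := by
  rw [ev_eq_sum, Finset.sum_eq_single_of_mem 0 (by simpa using hN)]
  · simp [ofZero]
  · intro σ _ h
    simp [ofZero, h]

/-- Evaluation of the argument in the outer slot, for operators with values in `M`. -/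
noncomputable def evStep [AddCommGroup M] [Module ℝ M] (N : ℕ) (φ : M →ₗ[ℝ] R) (X : μ → R) :
    (ℕ × μ → M) →ₗ[ℝ] R :=
  ev D N X ∘ₗ LinearMap.pi fun a => φ ∘ₗ LinearMap.proj a

theorem evStep_apply [AddCommGroup M] [Module ℝ M] (N : ℕ) (φ : M →ₗ[ℝ] R) (X : μ → R)
    (T : ℕ × μ → M) : evStep D N φ X T = ev D N X fun a => φ (T a) := rfl

theorem evStep_slot [AddCommGroup M] [Module ℝ M] {Δ : Module.End ℝ M} {P : ℕ → M → Prop} {N : ℕ}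
    {φ : M →ₗ[ℝ] R} (hφ : ∀ n x, n < N → P n x → φ (Δ x) = D (φ x)) (X : μ → R) (n : ℕ)
    (T : ℕ × μ → M) (hn : n < N) (hT : liftBound P n T) :
    evStep D N φ X (slot Δ T) = D (evStep D N φ X T) := by
  rw [evStep_apply, evStep_apply, map_slot (Δ' := D.toLinearMap) φ fun a => hφ n _ hn (hT.2 a)]
  exact ev_slot D hn (fun a ha => by rw [hT.1 a ha, map_zero]) X

/-- The value of a bilinear differential operator; `X` is the argument of the inner slot. -/
noncomputable abbrev ev₂ (N : ℕ) (X Y : μ → R) : (ℕ × μ → ℕ × μ → R) →ₗ[ℝ] R :=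
  evStep D N (ev D N X) Y

/-- The value of a trilinear differential operator. -/
noncomputable abbrev ev₃ (N : ℕ) (X Y Z : μ → R) : (ℕ × μ → ℕ × μ → ℕ × μ → R) →ₗ[ℝ] R :=
  evStep D N (ev₂ D N X Y) Z

theorem ev₁_slot (N : ℕ) (X : μ → R) (n : ℕ) (T : ℕ × μ → R) (hn : n < N) (hT : bound₁ μ R n T) :
    ev D N X (slot₁ D T) = D (ev D N X T) := ev_slot D hn hT.1 X

theorem ev₂_slot (N : ℕ) (X Y : μ → R) (n : ℕ) (T : ℕ × μ → ℕ × μ → R) (hn : n < N)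
    (hT : bound₂ μ R n T) : ev₂ D N X Y (slot₂ D T) = D (ev₂ D N X Y T) :=
  evStep_slot D (P := bound₁ μ R) (fun n T => ev₁_slot D N X n T) Y n T hn hT

theorem ev₃_slot (N : ℕ) (X Y Z : μ → R) (n : ℕ) (T : ℕ × μ → ℕ × μ → ℕ × μ → R) (hn : n < N)
    (hT : bound₃ μ R n T) : ev₃ D N X Y Z (slot₃ D T) = D (ev₃ D N X Y Z T) :=
  evStep_slot D (P := bound₂ μ R) (fun n T => ev₂_slot D N X Y n T) Z n T hn hT

/-- A differential operator that vanishes on all arguments has zero coefficients. -/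
def Faithful (μ : Type*) [Fintype μ] (D : Derivation ℝ R R) : Prop :=
  ∀ N (T : ℕ × μ → R), OrderLT N T → (∀ X, ev D N X T = 0) → T = 0

theorem Faithful.eq_zero {D : Derivation ℝ R R} (hD : Faithful μ D) {n N : ℕ} (h : n ≤ N)
    {T : ℕ × μ → R} (hT : bound₁ μ R n T) (h0 : ∀ X, ev D N X T = 0) : T = 0 :=
  hD N T (fun a ha => hT.1 a (h.trans ha)) h0

theorem Faithful.eq_zero₂ {D : Derivation ℝ R R} (hD : Faithful μ D) {n N : ℕ} (h : n ≤ N)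
    {T : ℕ × μ → ℕ × μ → R} (hT : bound₂ μ R n T) (h0 : ∀ X Y, ev₂ D N X Y T = 0) : T = 0 := by
  have h1 : ∀ X, (fun a => ev D N X (T a)) = 0 := fun X =>
    hD N _ (fun a ha => by rw [hT.1 a (h.trans ha), map_zero]) fun Y => h0 X Y
  funext a
  exact hD.eq_zero h (hT.2 a) fun X => congrFun (h1 X) a

/-- The covector `R(T, X)` with `T(X, Y) = R(T, X)_i Y^i` modulo total derivatives. -/
noncomputable def red₂ (N : ℕ) (T : ℕ × μ → ℕ × μ → R) (X : μ → R) : μ → R :=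
  redE D.toLinearMap N fun a => ev D N X (T a)

theorem red₂_mono {N N' : ℕ} {T : ℕ × μ → ℕ × μ → R} (hT : bound₂ μ R N T) (h : N ≤ N')
    (X : μ → R) : red₂ D N' T X = red₂ D N T X := by
  funext i
  unfold red₂
  have : (fun a => ev D N' X (T a)) = fun a => ev D N X (T a) := by
    funext a; exact ev_mono D (hT.2 a).1 h X
  rw [this]
  exact redE_mono (fun a ha => by rw [hT.1 a ha, map_zero]) h i

/-- A bilinear differential operator that integrates to zero by parts is a total derivative. -/
theorem exists_eq_slot₂ {D : Derivation ℝ R R} (hD : Faithful μ D) {N : ℕ}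
    {T : ℕ × μ → ℕ × μ → R} (hT : bound₂ μ R N T) (h : ∀ X, red₂ D N T X = 0) :
    ∃ n S, bound₂ μ R n S ∧ T = slot₂ D S := by
  have hE : ∀ i, redE (slot₁ D) N T i = 0 := by
    intro i
    refine hD.eq_zero (le_refl (2 * N)) ((isOrderBound₁ D).redE hT i) fun X => ?_
    rw [map_redE (isOrderBound₁ D) (Δ' := D.toLinearMap) (ev D (2 * N) X) (L := 2 * N)
      (fun n x hn hx => ev₁_slot D _ X n x hn hx) hT le_rfl i]
    have : (fun a => ev D (2 * N) X (T a)) = fun a => ev D N X (T a) := by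
      funext a; exact ev_mono D (hT.2 a).1 (by omega) X
    rw [this]
    exact congrFun (h X) i
  refine ⟨2 * N, redS (slot₁ D) N T, (isOrderBound₁ D).redS hT, ?_⟩
  have := eq_ofZero_add_slot (slot₁ D) hT.1
  rw [show redE (slot₁ D) N T = 0 from funext hE] at this
  rw [show ofZero (0 : μ → ℕ × μ → R) = 0 by funext a; simp [ofZero], zero_add] at this
  exact this

theorem red₂_slot₂ {n N : ℕ} {S : ℕ × μ → ℕ × μ → R} (hS : bound₂ μ R n S)
    (hT : bound₂ μ R N (slot₂ D S)) (X : μ → R) : red₂ D N (slot₂ D S) X = 0 := by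
  obtain ⟨L, hL⟩ : ∃ L, L = max n N := ⟨_, rfl⟩
  rw [← red₂_mono D hT (show N ≤ L + 1 by omega)]
  funext i
  unfold red₂
  rw [map_slot (Δ' := D.toLinearMap) (ev D (L + 1) X)
    fun a => ev₁_slot D _ X n _ (by omega) (hS.2 a)]
  exact redE_slot (fun a ha => by rw [hS.1 a (by omega), map_zero]) i

/-- A trilinear differential operator with trivial values is a total derivative. The property `Z`
stands for "is locally a total derivative". -/
theorem exists_eq_slot₃ {D : Derivation ℝ R R} (hD : Faithful μ D) (Z : R → Prop)
    (hZD : ∀ f g, Z f → Z (f + D g))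
    (hZ : ∀ E : μ → R, (∀ Y : μ → R, Z (∑ i, E i * Y i)) → E = 0)
    {N : ℕ} {T : ℕ × μ → ℕ × μ → ℕ × μ → R} (hT : bound₃ μ R N T)
    (h : ∀ X Y W, Z (ev₃ D N X Y W T)) :
    ∃ n S, bound₃ μ R n S ∧ T = slot₃ D S := by
  have hE : ∀ i, redE (slot₂ D) N T i = 0 := by
    have key : ∀ X Y, redE D.toLinearMap N (fun a => ev₂ D N X Y (T a)) = 0 := by
      intro X Y
      set t : ℕ × μ → R := fun a => ev₂ D N X Y (T a) with ht
      have hb : bound₁ μ R N t := ⟨fun a ha => by rw [ht]; simp [hT.1 a ha], fun _ => trivial⟩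
      refine hZ _ fun W => ?_
      have h1 := eq_ofZero_add_slot D.toLinearMap hb.1
      have h2 := congrArg (ev D (2 * N + 1) W) h1
      rw [map_add, ev_ofZero D (by omega),
        ev₁_slot D _ W (2 * N) _ (by omega) ((isOrderBound₀ D).redS hb),
        ev_mono D hb.1 (by omega)] at h2
      have h3 : ev D N W t = ev₃ D N X Y W T := rfl
      have h4 := hZD _ (-ev D (2 * N + 1) W (redS D.toLinearMap N t)) (h X Y W)
      rw [← h3, h2, map_neg, add_neg_cancel_right] at h4
      exact h4
    intro i
    refine hD.eq_zero₂ (le_refl (2 * N)) ((isOrderBound₂ D).redE hT i) fun X Y => ?_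
    rw [map_redE (isOrderBound₂ D) (Δ' := D.toLinearMap) (ev₂ D (2 * N) X Y) (L := 2 * N)
      (fun n x hn hx => ev₂_slot D _ X Y n x hn hx) hT le_rfl i]
    have : (fun a => ev₂ D (2 * N) X Y (T a)) = fun a => ev₂ D N X Y (T a) := by
      funext a
      rw [evStep_apply, evStep_apply]
      have : (fun b => ev D (2 * N) X (T a b)) = fun b => ev D N X (T a b) := by
        funext b; exact ev_mono D ((hT.2 a).2 b).1 (by omega) X
      rw [this]
      exact ev_mono D (fun b hb => by rw [(hT.2 a).1 b hb, map_zero]) (by omega) Y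
    rw [this]
    exact congrFun (key X Y) i
  refine ⟨2 * N, redS (slot₂ D) N T, (isOrderBound₂ D).redS hT, ?_⟩
  have := eq_ofZero_add_slot (slot₂ D) hT.1
  rw [show redE (slot₂ D) N T = 0 from funext hE] at this
  rw [show ofZero (0 : μ → ℕ × μ → ℕ × μ → R) = 0 by funext a; simp [ofZero], zero_add] at this
  exact this

end Eval

end Tensors

/-! ### Exterior derivatives and local exactness of the variational complex -/

section Forms

variable {μ R : Type*} [CommRing R] [Algebra ℝ R]

theorem bound₂_iff {N : ℕ} {T : ℕ × μ → ℕ × μ → R} :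
    bound₂ μ R N T ↔ ∀ a b, (N ≤ a.1 ∨ N ≤ b.1) → T a b = 0 := by
  constructor
  · rintro ⟨h1, h2⟩ a b (h | h)
    · rw [h1 a h]; rfl
    · exact (h2 a).1 b h
  · exact fun h => ⟨fun a ha => funext fun b => h a b (Or.inl ha),
      fun a => ⟨fun b hb => h a b (Or.inr hb), fun _ => trivial⟩⟩

theorem bound₃_iff {N : ℕ} {T : ℕ × μ → ℕ × μ → ℕ × μ → R} :
    bound₃ μ R N T ↔ ∀ a b c, (N ≤ a.1 ∨ N ≤ b.1 ∨ N ≤ c.1) → T a b c = 0 := by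
  constructor
  · rintro ⟨h1, h2⟩ a b c (h | h)
    · rw [h1 a h]; rfl
    · exact bound₂_iff.1 (h2 a) b c h
  · exact fun h => ⟨fun a ha => funext fun b => funext fun c => h a b c (Or.inl ha),
      fun a => bound₂_iff.2 fun b c hbc => h a b c (Or.inr hbc)⟩

/-- The exterior derivative of a one-form `α_a du_a` on jets. -/
def ext₁ (δ : ℕ × μ → Derivation ℝ R R) (α : ℕ × μ → R) : ℕ × μ → ℕ × μ → R :=
  fun a b => δ a (α b) - δ b (α a)

theorem ext₁_add (δ : ℕ × μ → Derivation ℝ R R) (α β : ℕ × μ → R) :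
    ext₁ δ (α + β) = ext₁ δ α + ext₁ δ β := by
  funext a b
  simp only [ext₁, Pi.add_apply, map_add]
  abel

/-- The exterior derivative of a two-form on jets. -/
def ext₂ (δ : ℕ × μ → Derivation ℝ R R) (Ω : ℕ × μ → ℕ × μ → R) : ℕ × μ → ℕ × μ → ℕ × μ → R :=
  fun a b c => δ a (Ω b c) - δ b (Ω a c) + δ c (Ω a b)

/-- The exterior derivative of a three-form on jets. -/
def ext₃ (δ : ℕ × μ → Derivation ℝ R R) (θ : ℕ × μ → ℕ × μ → ℕ × μ → R) :
    ℕ × μ → ℕ × μ → ℕ × μ → ℕ × μ → R :=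
  fun a b c d => δ a (θ b c d) - δ b (θ a c d) + δ c (θ a b d) - δ d (θ a b c)

/-- Commuting derivations `δ_a` that play the role of `∂/∂u_a`: their commutator with the total
derivative is `[δ_{σ,i}, D] = δ_{σ-1,i}`, and every function has finite order. -/
structure IsJetDerivation (D : Derivation ℝ R R) (δ : ℕ × μ → Derivation ℝ R R) : Prop where
  comm : ∀ a b f, δ a (δ b f) = δ b (δ a f)
  bracket : ∀ a f, δ a (D f) = D (δ a f) + pr (fun b => δ b f) a
  finite : ∀ f, ∃ N, ∀ a, N ≤ a.1 → δ a f = 0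

namespace IsJetDerivation

variable {D : Derivation ℝ R R} {δ : ℕ × μ → Derivation ℝ R R}

theorem ext₁_slot (h : IsJetDerivation D δ) (α : ℕ × μ → R) :
    ext₁ δ (slot₁ D α) = slot₂ D (ext₁ δ α) := by
  funext a b
  rcases a with ⟨_ | a, i⟩ <;> rcases b with ⟨_ | b, j⟩ <;>
  · simp only [ext₁, slot_apply, Pi.add_apply,
      Derivation.coeFn_coe, map_add, map_sub, h.bracket, pr_zero, pr_succ, Pi.zero_apply, map_zero]
    abel

theorem ext₂_slot (h : IsJetDerivation D δ) (Ω : ℕ × μ → ℕ × μ → R) :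
    ext₂ δ (slot₂ D Ω) = slot₃ D (ext₂ δ Ω) := by
  funext a b c
  rcases a with ⟨_ | a, i⟩ <;> rcases b with ⟨_ | b, j⟩ <;> rcases c with ⟨_ | c, k⟩ <;>
  · simp only [ext₂, slot_apply, Pi.add_apply,
      Derivation.coeFn_coe, map_add, map_sub, h.bracket, pr_zero, pr_succ, Pi.zero_apply, map_zero]
    abel

theorem ext₃_slot (h : IsJetDerivation D δ) (θ : ℕ × μ → ℕ × μ → ℕ × μ → R) :
    ext₃ δ (slot₃ D θ) = slot (slot₃ D) (ext₃ δ θ) := by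
  funext a b c d
  rcases a with ⟨_ | a, i⟩ <;> rcases b with ⟨_ | b, j⟩ <;> rcases c with ⟨_ | c, k⟩ <;>
  rcases d with ⟨_ | d, l⟩ <;>
  · simp only [ext₃, slot_apply, Pi.add_apply,
      Derivation.coeFn_coe, map_add, map_sub, h.bracket, pr_zero, pr_succ, Pi.zero_apply, map_zero]
    abel

theorem ext₃_ext₂ (h : IsJetDerivation D δ) (Ω : ℕ × μ → ℕ × μ → R) : ext₃ δ (ext₂ δ Ω) = 0 := by
  funext a b c d
  simp only [ext₃, ext₂, map_add, map_sub, Pi.zero_apply]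
  rw [h.comm b a, h.comm c a, h.comm d a, h.comm c b, h.comm d b, h.comm d c]
  abel

theorem exists_order (h : IsJetDerivation D δ) {α : Type*} (s : Finset α) (f : α → R)
    (hf : ∀ b ∉ s, f b = 0) : ∃ N, ∀ b a, N ≤ a.1 → δ a (f b) = 0 := by
  choose N hN using fun b => h.finite (f b)
  refine ⟨s.sup N, fun b a ha => ?_⟩
  by_cases hb : b ∈ s
  · exact hN b a ((Finset.le_sup hb).trans ha)
  · rw [hf b hb, map_zero]

variable [Fintype μ]

theorem exists_order₁ (h : IsJetDerivation D δ) {N : ℕ} {T : ℕ × μ → R} (hT : OrderLT N T) :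
    ∃ L, ∀ b a, L ≤ a.1 → δ a (T b) = 0 :=
  h.exists_order (box μ N) T fun b hb => hT b (by rw [mem_box] at hb; omega)

theorem exists_order₂ (h : IsJetDerivation D δ) {N : ℕ} {T : ℕ × μ → ℕ × μ → R}
    (hT : bound₂ μ R N T) : ∃ L, ∀ b c a, L ≤ a.1 → δ a (T b c) = 0 := by
  obtain ⟨L, hL⟩ := h.exists_order (box μ N ×ˢ box μ N) (fun q => T q.1 q.2) fun b hb => by
    refine bound₂_iff.1 hT _ _ ?_
    simp only [Finset.mem_product, mem_box] at hb
    omega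
  exact ⟨L, fun b c => hL (b, c)⟩

theorem exists_order₃ (h : IsJetDerivation D δ) {N : ℕ} {T : ℕ × μ → ℕ × μ → ℕ × μ → R}
    (hT : bound₃ μ R N T) : ∃ L, ∀ b c d a, L ≤ a.1 → δ a (T b c d) = 0 := by
  obtain ⟨L, hL⟩ := h.exists_order (box μ N ×ˢ box μ N ×ˢ box μ N) (fun q => T q.1 q.2.1 q.2.2)
    fun b hb => by
      refine bound₃_iff.1 hT _ _ _ ?_
      simp only [Finset.mem_product, mem_box] at hb
      omega
  exact ⟨L, fun b c d => hL (b, c, d)⟩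

theorem exists_bound_ext₁ (h : IsJetDerivation D δ) {N : ℕ} {T : ℕ × μ → R} (hT : OrderLT N T) :
    ∃ n, bound₂ μ R n (ext₁ δ T) := by
  obtain ⟨L, hL⟩ := h.exists_order₁ hT
  refine ⟨max N L, bound₂_iff.2 fun a b hab => ?_⟩
  rcases hab with hab | hab
  · rw [ext₁, hL _ a (by omega), hT a (by omega)]; simp
  · rw [ext₁, hL _ b (by omega), hT b (by omega)]; simp

theorem exists_orderLT_ext₃ (h : IsJetDerivation D δ) {N : ℕ}
    {T : ℕ × μ → ℕ × μ → ℕ × μ → R} (hT : bound₃ μ R N T) : ∃ n, OrderLT n (ext₃ δ T) := by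
  obtain ⟨L, hL⟩ := h.exists_order₃ hT
  have h2 := bound₃_iff.1 hT
  refine ⟨max N L, fun a ha => ?_⟩
  funext b c d
  rw [ext₃, hL _ _ _ a (by omega), h2 a _ _ (by omega), h2 a _ _ (by omega), h2 a _ _ (by omega)]
  simp

end IsJetDerivation

theorem slot₂_swap (D : Derivation ℝ R R) (T : ℕ × μ → ℕ × μ → R) (a b : ℕ × μ) :
    slot₂ D (fun a b => T b a) a b = slot₂ D T b a := by
  rcases a with ⟨_ | a, i⟩ <;> rcases b with ⟨_ | b, j⟩ <;>
  · simp only [slot_apply, Pi.add_apply, pr_zero, pr_succ, Pi.zero_apply]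
    try abel

theorem slot₃_swap₁₂ (D : Derivation ℝ R R) (T : ℕ × μ → ℕ × μ → ℕ × μ → R) (a b c : ℕ × μ) :
    slot₃ D (fun a b c => T b a c) a b c = slot₃ D T b a c := by
  rcases a with ⟨_ | a, i⟩ <;> rcases b with ⟨_ | b, j⟩ <;> rcases c with ⟨_ | c, k⟩ <;>
  · simp only [slot_apply, Pi.add_apply, pr_zero, pr_succ, Pi.zero_apply]
    try abel

theorem slot₃_swap₂₃ (D : Derivation ℝ R R) (T : ℕ × μ → ℕ × μ → ℕ × μ → R) (a b c : ℕ × μ) :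
    slot₃ D (fun a b c => T a c b) a b c = slot₃ D T a c b := by
  rcases a with ⟨_ | a, i⟩ <;> rcases b with ⟨_ | b, j⟩ <;> rcases c with ⟨_ | c, k⟩ <;>
  · simp only [slot_apply, Pi.add_apply, pr_zero, pr_succ, Pi.zero_apply]
    try abel

variable [Fintype μ] [DecidableEq μ]

/-- The data of a radial homotopy: `x a` is the coordinate `u_a` relative to the centre, `J m f` is
the average `∫₀¹ λ^m f(λ) dλ` along the ray from the centre, and `c₀ f` is the value at the centre.
The weight of the coordinates of order zero is `w₀`. If it is zero, then the functions do not
depend on these coordinates, and the homotopy leaves their differentials alone. -/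
structure RadialHomotopy (D : Derivation ℝ R R) (δ : ℕ × μ → Derivation ℝ R R) where
  w₀ : ℕ
  x : ℕ × μ → R
  J : ℕ → R →ₗ[ℝ] R
  c₀ : R →ₗ[ℝ] R
  w₀_le : w₀ ≤ 1
  δ_zero : w₀ = 0 → ∀ i f, δ (0, i) f = 0
  δ_x : ∀ a e, δ a (x e) = if a = e then ((if a.1 = 0 then w₀ else 1 : ℕ) : R) else 0
  δ_J : ∀ a m f, δ a (J m f) = J (m + 1) (δ a f)
  δ_c₀ : ∀ a f, δ a (c₀ f) = 0
  D_c₀ : ∀ f, D (c₀ f) = 0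
  eq_sum : ∀ N f, (∀ a, N ≤ a.1 → δ a f = 0) → ∀ m : ℕ,
    f = (if m = 0 then c₀ f else 0) + (m : R) * J (m - 1) f + ∑ e ∈ box μ N, x e * J m (δ e f)

namespace RadialHomotopy

variable {D : Derivation ℝ R R} {δ : ℕ × μ → Derivation ℝ R R} (H : RadialHomotopy D δ)

/-- The weight of a coordinate. -/
def w (a : ℕ × μ) : ℕ := if a.1 = 0 then H.w₀ else 1

theorem w_cases (a : ℕ × μ) : H.w a = 1 ∨ (H.w a = 0 ∧ a.1 = 0 ∧ H.w₀ = 0 ∧ ∀ f, δ a f = 0) := by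
  have := H.w₀_le
  obtain ⟨σ, i⟩ := a
  unfold w
  by_cases h : σ = 0
  · subst h
    rcases Nat.eq_zero_or_pos H.w₀ with h0 | h0
    · exact Or.inr ⟨by simpa using h0, rfl, h0, H.δ_zero h0 i⟩
    · exact Or.inl (by simp; omega)
  · simp [h]

theorem w_eq_zero_iff (a : ℕ × μ) : H.w a = 0 ↔ a.1 = 0 ∧ H.w₀ = 0 := by
  unfold w
  by_cases h : a.1 = 0 <;> simp [h]

/-- Contraction with the radial vector field, followed by averaging. -/
def con (n m : ℕ) (t : ℕ × μ → R) : R := ∑ e ∈ box μ n, H.x e * H.J m (t e)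

theorem δ_con {n : ℕ} (m : ℕ) {t : ℕ × μ → R} (ht : OrderLT n t) (a : ℕ × μ) :
    δ a (H.con n m t) = (H.w a : R) * H.J m (t a) + H.con n (m + H.w a) (fun e => δ a (t e)) := by
  have h1 : δ a (H.con n m t) = (∑ e ∈ box μ n, H.J m (t e) * δ a (H.x e)) +
      ∑ e ∈ box μ n, H.x e * H.J (m + 1) (δ a (t e)) := by
    rw [con, map_sum, ← Finset.sum_add_distrib]
    refine Finset.sum_congr rfl fun e _ => ?_
    rw [Derivation.leibniz, H.δ_J, smul_eq_mul, smul_eq_mul, add_comm]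
  have h2 : (∑ e ∈ box μ n, H.J m (t e) * δ a (H.x e)) = (H.w a : R) * H.J m (t a) := by
    by_cases ha : a ∈ box μ n
    · rw [Finset.sum_eq_single_of_mem a ha]
      · rw [H.δ_x, if_pos rfl, mul_comm]; rfl
      · intro e _ he
        rw [H.δ_x, if_neg (Ne.symm he), mul_zero]
    · have : t a = 0 := ht a (by rw [mem_box] at ha; omega)
      rw [this, map_zero, mul_zero]
      refine Finset.sum_eq_zero fun e he => ?_
      rw [H.δ_x, if_neg (by rintro rfl; exact ha he), mul_zero]
  rw [h1, h2, con]
  rcases H.w_cases a with h | ⟨h, _, _, h0⟩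
  · rw [h]
  · simp [h0]

theorem con_add (n m : ℕ) (s t : ℕ × μ → R) :
    H.con n m (fun e => s e + t e) = H.con n m s + H.con n m t := by
  simp [con, mul_add, Finset.sum_add_distrib]

theorem con_sub (n m : ℕ) (s t : ℕ × μ → R) :
    H.con n m (fun e => s e - t e) = H.con n m s - H.con n m t := by
  simp [con, mul_sub, Finset.sum_sub_distrib]

/-- The homotopy operator on three-forms. -/
def h₃ (n : ℕ) (θ : ℕ × μ → ℕ × μ → ℕ × μ → R) : ℕ × μ → ℕ × μ → R :=
  fun b c => H.con n (H.w b + H.w c) fun e => θ e b c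

/-- The homotopy operator on two-forms. -/
def h₂ (n : ℕ) (Ω : ℕ × μ → ℕ × μ → R) : ℕ × μ → R :=
  fun b => H.con n (H.w b) fun e => Ω e b

/-- The value at the centre of the component of weight zero of a three-form. -/
def c₃ (θ : ℕ × μ → ℕ × μ → ℕ × μ → R) : ℕ × μ → ℕ × μ → ℕ × μ → R :=
  fun a b c => if H.w a + H.w b + H.w c = 0 then H.c₀ (θ a b c) else 0

/-- The value at the centre of the component of weight zero of a two-form. -/
def c₂ (Ω : ℕ × μ → ℕ × μ → R) : ℕ × μ → ℕ × μ → R :=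
  fun a b => if H.w a + H.w b = 0 then H.c₀ (Ω a b) else 0

theorem eq_ext₁_add {n : ℕ} {Ω : ℕ × μ → ℕ × μ → R} (hΩ : bound₂ μ R n Ω)
    (hn : ∀ b c a, n ≤ a.1 → δ a (Ω b c) = 0) (halt : ∀ a b, Ω a b = -Ω b a)
    (hcl : ext₂ δ Ω = 0) : Ω = ext₁ δ (H.h₂ n Ω) + H.c₂ Ω := by
  funext a b
  have hb : ∀ c, OrderLT n fun e => Ω e c := fun c e he => bound₂_iff.1 hΩ e c (Or.inl he)
  have hc : ∀ e, δ e (Ω a b) = δ a (Ω e b) - δ b (Ω e a) := by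
    intro e
    have := congrFun (congrFun (congrFun hcl e) a) b
    simp only [ext₂, Pi.zero_apply] at this
    linear_combination this
  have key := H.eq_sum n (Ω a b) (hn a b) (H.w a + H.w b)
  have h1 : ∑ e ∈ box μ n, H.x e * H.J (H.w a + H.w b) (δ e (Ω a b)) =
      H.con n (H.w b + H.w a) (fun e => δ a (Ω e b)) -
        H.con n (H.w a + H.w b) (fun e => δ b (Ω e a)) := by
    rw [add_comm (H.w b), ← con_sub, con]
    simp only [hc]
  rw [h1] at key
  simp only [Pi.add_apply, ext₁, h₂, c₂]
  rw [H.δ_con _ (hb b), H.δ_con _ (hb a)]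
  have h2 : ((H.w a + H.w b : ℕ) : R) * H.J (H.w a + H.w b - 1) (Ω a b) =
      (H.w a : R) * H.J (H.w b) (Ω a b) - (H.w b : R) * H.J (H.w a) (Ω b a) := by
    rw [halt b a, map_neg]
    rcases H.w_cases a with ha | ⟨ha, -⟩ <;> rcases H.w_cases b with hb | ⟨hb, -⟩ <;>
      simp [ha, hb]
    ring
  linear_combination key + h2

theorem eq_ext₂_add {n : ℕ} {θ : ℕ × μ → ℕ × μ → ℕ × μ → R} (hθ : bound₃ μ R n θ)
    (hn : ∀ b c d a, n ≤ a.1 → δ a (θ b c d) = 0) (halt₁ : ∀ a b c, θ a b c = -θ b a c)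
    (halt₂ : ∀ a b c, θ a b c = -θ a c b)
    (hcl : ext₃ δ θ = 0) : θ = ext₂ δ (H.h₃ n θ) + H.c₃ θ := by
  funext a b c
  have hb : ∀ c d, OrderLT n fun e => θ e c d := fun c d e he =>
    bound₃_iff.1 hθ e c d (Or.inl he)
  have hc : ∀ e, δ e (θ a b c) = δ a (θ e b c) - δ b (θ e a c) + δ c (θ e a b) := by
    intro e
    have := congrFun (congrFun (congrFun (congrFun hcl e) a) b) c
    simp only [ext₃, Pi.zero_apply] at this
    linear_combination this
  have key := H.eq_sum n (θ a b c) (hn a b c) (H.w a + H.w b + H.w c)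
  have h1 : ∑ e ∈ box μ n, H.x e * H.J (H.w a + H.w b + H.w c) (δ e (θ a b c)) =
      H.con n (H.w b + H.w c + H.w a) (fun e => δ a (θ e b c)) -
        H.con n (H.w a + H.w c + H.w b) (fun e => δ b (θ e a c)) +
        H.con n (H.w a + H.w b + H.w c) (fun e => δ c (θ e a b)) := by
    rw [show H.w b + H.w c + H.w a = H.w a + H.w b + H.w c by ring,
      show H.w a + H.w c + H.w b = H.w a + H.w b + H.w c by ring, ← con_sub, ← con_add, con]
    simp only [hc]
  rw [h1] at key
  simp only [Pi.add_apply, ext₂, h₃, c₃]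
  rw [H.δ_con _ (hb b c), H.δ_con _ (hb a c), H.δ_con _ (hb a b)]
  have h2 : ((H.w a + H.w b + H.w c : ℕ) : R) * H.J (H.w a + H.w b + H.w c - 1) (θ a b c) =
      (H.w a : R) * H.J (H.w b + H.w c) (θ a b c) - (H.w b : R) * H.J (H.w a + H.w c) (θ b a c) +
        (H.w c : R) * H.J (H.w a + H.w b) (θ c a b) := by
    rw [halt₁ b a c, halt₁ c a b, halt₂ a c b, neg_neg, map_neg]
    rcases H.w_cases a with ha | ⟨ha, -⟩ <;> rcases H.w_cases b with hb | ⟨hb, -⟩ <;>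
      rcases H.w_cases c with hc | ⟨hc, -⟩ <;> simp [ha, hb, hc] <;> ring
  linear_combination key + h2

theorem h₃_alt {n : ℕ} {θ : ℕ × μ → ℕ × μ → ℕ × μ → R} (halt₂ : ∀ a b c, θ a b c = -θ a c b)
    (a b : ℕ × μ) : H.h₃ n θ a b = -H.h₃ n θ b a := by
  unfold h₃ con
  rw [add_comm, ← Finset.sum_neg_distrib]
  refine Finset.sum_congr rfl fun e _ => ?_
  simp only [halt₂ e a b, map_neg, mul_neg]

theorem bound_h₃ {n : ℕ} {θ : ℕ × μ → ℕ × μ → ℕ × μ → R} (hθ : bound₃ μ R n θ) :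
    bound₂ μ R n (H.h₃ n θ) := by
  refine bound₂_iff.2 fun a b hab => ?_
  refine Finset.sum_eq_zero fun e _ => ?_
  simp only [bound₃_iff.1 hθ e a b (Or.inr hab), map_zero, mul_zero]

theorem bound_h₂ {n : ℕ} {Ω : ℕ × μ → ℕ × μ → R} (hΩ : bound₂ μ R n Ω) :
    OrderLT n (H.h₂ n Ω) := by
  intro a ha
  refine Finset.sum_eq_zero fun e _ => ?_
  simp only [bound₂_iff.1 hΩ e a (Or.inr ha), map_zero, mul_zero]

/-- A two-form whose exterior derivative is the constant three-form `c_{ijk} dφ^i dφ^j dφ^k` up to a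
total derivative: `c_{ijk} u^i dφ^j dφ^k`, with `u^i` the coordinate of order one. -/
def ζ (θ : ℕ × μ → ℕ × μ → ℕ × μ → R) : ℕ × μ → ℕ × μ → R :=
  fun b c => ∑ k, H.x (1, k) * H.c₃ θ (0, k) b c

theorem δ_c₃ (θ : ℕ × μ → ℕ × μ → ℕ × μ → R) (e a b c : ℕ × μ) : δ e (H.c₃ θ a b c) = 0 := by
  unfold c₃; split_ifs <;> simp [H.δ_c₀]

theorem D_c₃ (θ : ℕ × μ → ℕ × μ → ℕ × μ → R) (a b c : ℕ × μ) : D (H.c₃ θ a b c) = 0 := by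
  unfold c₃; split_ifs <;> simp [H.D_c₀]

theorem c₃_alt₁ {θ : ℕ × μ → ℕ × μ → ℕ × μ → R} (halt₁ : ∀ a b c, θ a b c = -θ b a c)
    (a b c : ℕ × μ) : H.c₃ θ a b c = -H.c₃ θ b a c := by
  unfold c₃
  rw [add_comm (H.w a), halt₁ a b c]
  split_ifs <;> simp

theorem c₃_alt₂ {θ : ℕ × μ → ℕ × μ → ℕ × μ → R} (halt₂ : ∀ a b c, θ a b c = -θ a c b)
    (a b c : ℕ × μ) : H.c₃ θ a b c = -H.c₃ θ a c b := by
  unfold c₃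
  rw [add_right_comm (H.w a), halt₂ a b c]
  split_ifs <;> simp

theorem c₃_eq_zero (θ : ℕ × μ → ℕ × μ → ℕ × μ → R) {a b c : ℕ × μ}
    (h : ¬ (a.1 = 0 ∧ b.1 = 0 ∧ c.1 = 0 ∧ H.w₀ = 0)) : H.c₃ θ a b c = 0 := by
  unfold c₃
  rw [if_neg]
  intro h0
  have ha := (H.w_eq_zero_iff a).1 (by omega)
  have hb := (H.w_eq_zero_iff b).1 (by omega)
  have hc := (H.w_eq_zero_iff c).1 (by omega)
  exact h ⟨ha.1, hb.1, hc.1, ha.2⟩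

theorem δ_ζ (θ : ℕ × μ → ℕ × μ → ℕ × μ → R) (a b c : ℕ × μ) :
    δ a (H.ζ θ b c) = pr (H.c₃ θ) a b c := by
  have h1 : δ a (H.ζ θ b c) = ∑ k, if a = (1, k) then H.c₃ θ (0, k) b c else 0 := by
    rw [ζ, map_sum]
    refine Finset.sum_congr rfl fun k _ => ?_
    rw [Derivation.leibniz, H.δ_c₃, H.δ_x]
    by_cases h : a = (1, k)
    · subst h; simp
    · simp [h]
  rw [h1]
  obtain ⟨_ | _ | σ, i⟩ := a
  · simp
  · simp
  · rw [pr_succ, H.c₃_eq_zero θ (by simp)]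
    simp

theorem ext₂_ζ {θ : ℕ × μ → ℕ × μ → ℕ × μ → R} (halt₁ : ∀ a b c, θ a b c = -θ b a c)
    (halt₂ : ∀ a b c, θ a b c = -θ a c b) : ext₂ δ (H.ζ θ) = slot₃ D (H.c₃ θ) := by
  funext a b c
  have h1 : ∀ a b c, pr (H.c₃ θ a) b c = -pr (H.c₃ θ) b a c := by
    intro a b c
    rcases b with ⟨_ | b, j⟩
    · simp
    · simp only [pr_succ]; exact H.c₃_alt₁ halt₁ _ _ _
  have h2 : ∀ a b c, pr (H.c₃ θ a b) c = pr (H.c₃ θ) c a b := by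
    intro a b c
    rcases c with ⟨_ | c, j⟩
    · simp
    · simp only [pr_succ]
      rw [H.c₃_alt₂ halt₂ a b, H.c₃_alt₁ halt₁ a, neg_neg]
  simp only [ext₂, H.δ_ζ, slot_apply, Pi.add_apply,
    Derivation.coeFn_coe, H.D_c₃, h1, h2]
  abel

theorem ζ_alt {θ : ℕ × μ → ℕ × μ → ℕ × μ → R} (halt₂ : ∀ a b c, θ a b c = -θ a c b)
    (a b : ℕ × μ) : H.ζ θ a b = -H.ζ θ b a := by
  unfold ζ
  rw [← Finset.sum_neg_distrib]
  refine Finset.sum_congr rfl fun k _ => ?_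
  rw [H.c₃_alt₂ halt₂, mul_neg]

theorem ζ_eq_zero (θ : ℕ × μ → ℕ × μ → ℕ × μ → R) {b c : ℕ × μ}
    (h : ¬ (b.1 = 0 ∧ c.1 = 0 ∧ H.w₀ = 0)) : H.ζ θ b c = 0 := by
  refine Finset.sum_eq_zero fun k _ => ?_
  rw [H.c₃_eq_zero θ (fun h' => h h'.2), mul_zero]

end RadialHomotopy

/-- The bilinear operator of order zero in both arguments with coefficients `z i j`. -/
def ofZero₂ (z : μ → μ → R) : ℕ × μ → ℕ × μ → R :=
  fun a b => if a.1 = 0 ∧ b.1 = 0 then z a.2 b.2 else 0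

/-- Local exactness of the variational complex in the autonomous setting. If `dΩ` is a total
derivative, `dΩ = Dθ`, then `dθ = 0` because `D` is injective, so `θ = dη` and `Ω - Dη` is closed;
hence `Ω = dα + Dη`, and integrating `α` by parts gives the covector `ψ`. If the coordinates of order
zero have weight zero, there remain terms `z_{ij} dφ^i dφ^j` with `z_{ij}` affine in the coordinates of
order one. -/
theorem exists_potential {D : Derivation ℝ R R} {δ : ℕ × μ → Derivation ℝ R R}
    (h : IsJetDerivation D δ) (H : RadialHomotopy D δ) {N N' : ℕ} {Ω : ℕ × μ → ℕ × μ → R}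
    (hΩ : bound₂ μ R N Ω) (halt : ∀ a b, Ω a b = -Ω b a)
    {θ : ℕ × μ → ℕ × μ → ℕ × μ → R} (hθ : bound₃ μ R N' θ) (hd : ext₂ δ Ω = slot₃ D θ) :
    ∃ (ψ : μ → R) (n : ℕ) (S : ℕ × μ → ℕ × μ → R) (z : μ → μ → R), bound₂ μ R n S ∧
      (∀ a i j, 2 ≤ a.1 → δ a (z i j) = 0) ∧ (H.w₀ ≠ 0 → z = 0) ∧
      Ω = ext₁ δ (ofZero ψ) + slot₂ D S + ofZero₂ z := by
  have hb₃ := isOrderBound₃ (μ := μ) D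
  have halt₁ : ∀ a b c, θ a b c = -θ b a c := by
    have h0 : θ + (fun a b c => θ b a c) = 0 := by
      refine eq_zero_of_slot_eq_zero (N := N') (Δ := slot₂ D) ?_ ?_
      · intro a ha
        funext b c
        simp only [Pi.add_apply, bound₃_iff.1 hθ a b c (by omega), bound₃_iff.1 hθ b a c (by omega)]
        simp
      · rw [map_add]
        funext a b c
        rw [Pi.add_apply, Pi.add_apply, Pi.add_apply, slot₃_swap₁₂ D θ, ← hd, ext₂, ext₂, halt b a,
          map_neg]
        simp only [Pi.zero_apply]
        abel
    intro a b c
    have := congrFun (congrFun (congrFun h0 a) b) c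
    exact eq_neg_of_add_eq_zero_left this
  have halt₂ : ∀ a b c, θ a b c = -θ a c b := by
    have h0 : θ + (fun a b c => θ a c b) = 0 := by
      refine eq_zero_of_slot_eq_zero (N := N') (Δ := slot₂ D) ?_ ?_
      · intro a ha
        funext b c
        simp only [Pi.add_apply, bound₃_iff.1 hθ a b c (by omega), bound₃_iff.1 hθ a c b (by omega)]
        simp
      · rw [map_add]
        funext a b c
        rw [Pi.add_apply, Pi.add_apply, Pi.add_apply, slot₃_swap₂₃ D θ, ← hd, ext₂, ext₂, halt c b,
          map_neg]
        simp only [Pi.zero_apply]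
        abel
    intro a b c
    have := congrFun (congrFun (congrFun h0 a) b) c
    exact eq_neg_of_add_eq_zero_left this
  have hdθ : ext₃ δ θ = 0 := by
    obtain ⟨n, hn⟩ := h.exists_orderLT_ext₃ hθ
    refine eq_zero_of_slot_eq_zero (Δ := slot₃ D) hn ?_
    rw [← h.ext₃_slot, ← hd, h.ext₃_ext₂]
  obtain ⟨L, hL⟩ := h.exists_order₃ hθ
  obtain ⟨n, hn⟩ : ∃ n, n = max N' L := ⟨_, rfl⟩
  have hθn : bound₃ μ R n θ := hb₃.mono N' n θ (by omega) hθ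
  have hθ' := H.eq_ext₂_add hθn (fun b c d a ha => hL b c d a (by omega)) halt₁ halt₂ hdθ
  set η := H.h₃ n θ with hη
  have hηb : bound₂ μ R n η := H.bound_h₃ hθn
  have hηalt : ∀ a b, η a b = -η b a := H.h₃_alt halt₂
  set Ω₁ := Ω - slot₂ D η - H.ζ θ with hΩ₁
  obtain ⟨n₁, hn₁⟩ : ∃ n₁, bound₂ μ R n₁ Ω₁ := by
    refine ⟨max N (n + 2), bound₂_iff.2 fun a b hab => ?_⟩
    have h1 : slot₂ D η a b = 0 :=
      bound₂_iff.1 ((isOrderBound₂ D).step _ _ hηb) a b (by omega)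
    have h2 : H.ζ θ a b = 0 := H.ζ_eq_zero θ (by omega)
    rw [hΩ₁, Pi.sub_apply, Pi.sub_apply, Pi.sub_apply, Pi.sub_apply, h1, h2,
      bound₂_iff.1 hΩ a b (by omega)]
    simp
  have halt' : ∀ a b, Ω₁ a b = -Ω₁ b a := by
    intro a b
    have h1 : slot₂ D η a b = -slot₂ D η b a := by
      rw [← slot₂_swap, show (fun a b => η b a) = -η by funext a b; exact hηalt b a, map_neg]
      simp
    simp only [hΩ₁, Pi.sub_apply, h1, halt a b, H.ζ_alt halt₂ a b]
    abel
  have hcl : ext₂ δ Ω₁ = 0 := by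
    have h1 : ext₂ δ Ω₁ = ext₂ δ Ω - ext₂ δ (slot₂ D η) - ext₂ δ (H.ζ θ) := by
      funext a b c
      simp only [hΩ₁, ext₂, Pi.sub_apply, map_sub]
      abel
    rw [h1, hd, h.ext₂_slot, H.ext₂_ζ halt₁ halt₂, ← map_sub, ← map_sub]
    have : θ - ext₂ δ η - H.c₃ θ = 0 := by
      rw [sub_sub, ← hθ', sub_self]
    rw [this, map_zero]
  obtain ⟨L₁, hL₁⟩ := h.exists_order₂ hn₁
  obtain ⟨n₂, hn₂⟩ : ∃ n₂, n₂ = max n₁ L₁ := ⟨_, rfl⟩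
  have hb₁ : bound₂ μ R n₂ Ω₁ := (isOrderBound₂ D).mono n₁ n₂ Ω₁ (by omega) hn₁
  have hΩ₁' := H.eq_ext₁_add hb₁ (fun b c a ha => hL₁ b c a (by omega)) halt' hcl
  set α := H.h₂ n₂ Ω₁ with hα
  have hαb : OrderLT n₂ α := H.bound_h₂ hb₁
  have hα' := eq_ofZero_add_slot D.toLinearMap hαb
  set β := redS D.toLinearMap n₂ α with hβ
  have hβb : bound₁ μ R (2 * n₂) β := (isOrderBound₀ D).redS ⟨hαb, fun _ => trivial⟩
  obtain ⟨n₃, hn₃⟩ := h.exists_bound_ext₁ hβb.1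
  refine ⟨redE D.toLinearMap n₂ α, max n n₃, η + ext₁ δ β,
    fun i j => H.ζ θ (0, i) (0, j) + H.c₂ Ω₁ (0, i) (0, j), ?_, ?_, ?_, ?_⟩
  · exact (isOrderBound₂ D).add _ _ _ ((isOrderBound₂ D).mono _ _ _ (le_max_left _ _) hηb)
      ((isOrderBound₂ D).mono _ _ _ (le_max_right _ _) hn₃)
  · rintro ⟨a, l⟩ i j ha
    obtain ⟨a, rfl⟩ : ∃ b, a = b + 2 := ⟨a - 2, by simp at ha; omega⟩
    rw [map_add, H.δ_ζ, pr_succ, H.c₃_eq_zero θ (by simp)]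
    unfold RadialHomotopy.c₂
    split_ifs <;> simp [H.δ_c₀]
  · intro hw
    funext i j
    rw [H.ζ_eq_zero θ (fun h => hw h.2.2), RadialHomotopy.c₂, if_neg]
    · simp
    · intro h0
      exact hw ((H.w_eq_zero_iff (0, i)).1 (by omega)).2
  · have h1 : ext₁ δ α = ext₁ δ (ofZero (redE D.toLinearMap n₂ α)) + slot₂ D (ext₁ δ β) := by
      rw [← h.ext₁_slot, ← ext₁_add, ← hα']
    have h2 : ofZero₂ (fun i j => H.ζ θ (0, i) (0, j) + H.c₂ Ω₁ (0, i) (0, j)) =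
        H.ζ θ + H.c₂ Ω₁ := by
      funext a b
      obtain ⟨σ, i⟩ := a
      obtain ⟨τ, j⟩ := b
      unfold ofZero₂
      by_cases hab : σ = 0 ∧ τ = 0
      · obtain ⟨rfl, rfl⟩ := hab
        simp
      · rw [if_neg hab, Pi.add_apply, Pi.add_apply,
          H.ζ_eq_zero θ (fun h => hab ⟨h.1, h.2.1⟩), RadialHomotopy.c₂, if_neg, add_zero]
        intro h0
        exact hab ⟨((H.w_eq_zero_iff (σ, i)).1 (by omega)).1,
          ((H.w_eq_zero_iff (τ, j)).1 (by omega)).1⟩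
    have h3 : Ω = Ω₁ + slot₂ D η + H.ζ θ := by rw [hΩ₁]; abel
    rw [map_add, h2]
    nth_rewrite 1 [h3]
    nth_rewrite 1 [hΩ₁']
    rw [h1]
    abel

end Forms

/-! ### Averages along rays -/

section Ray

open MeasureTheory Set

/-- Differentiation under the integral along the rays from a point. -/
theorem hasFDerivAt_ray {E : Type*} [NormedAddCommGroup E] [NormedSpace ℝ E] [ProperSpace E]
    {O : Set E} (hO : IsOpen O) {y₀ : E} (hs : StarConvex ℝ y₀ O) {f : E → ℝ}
    (hf : ContDiffOn ℝ ∞ f O) (m : ℕ) {y : E} (hy : y ∈ O) :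
    HasFDerivAt (fun y => ∫ t in (0 : ℝ)..1, t ^ m * f (y₀ + t • (y - y₀)))
      (∫ t in (0 : ℝ)..1, t ^ (m + 1) • fderiv ℝ f (y₀ + t • (y - y₀))) y := by
  have hray : ∀ t ∈ Icc (0 : ℝ) 1, ∀ z ∈ O, y₀ + t • (z - y₀) ∈ O :=
    fun t ht z hz => hs.add_smul_sub_mem hz ht.1 ht.2
  have hf' : ContinuousOn (fderiv ℝ f) O :=
    hf.continuousOn_fderiv_of_isOpen hO (by simp)
  obtain ⟨ε, hε, hball⟩ := Metric.nhds_basis_closedBall.mem_iff.1 (hO.mem_nhds hy)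
  have hcont : Continuous fun q : ℝ × E => y₀ + q.1 • (q.2 - y₀) := by fun_prop
  have hK : IsCompact ((fun q : ℝ × E => y₀ + q.1 • (q.2 - y₀)) ''
      (Icc (0 : ℝ) 1 ×ˢ Metric.closedBall y ε)) :=
    (isCompact_Icc.prod (isCompact_closedBall y ε)).image hcont
  have hKO : (fun q : ℝ × E => y₀ + q.1 • (q.2 - y₀)) ''
      (Icc (0 : ℝ) 1 ×ˢ Metric.closedBall y ε) ⊆ O := by
    rintro _ ⟨⟨t, z⟩, ⟨ht, hz⟩, rfl⟩
    exact hray t ht z (hball hz)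
  obtain ⟨C, hC⟩ := hK.exists_bound_of_continuousOn (hf'.mono hKO)
  have hI : uIoc (0 : ℝ) 1 ⊆ Icc 0 1 := by
    rw [uIoc_of_le zero_le_one]; exact Ioc_subset_Icc_self
  have hI' : uIcc (0 : ℝ) 1 = Icc 0 1 := uIcc_of_le zero_le_one
  have hfc : ∀ z ∈ O, ContinuousOn (fun t : ℝ => t ^ m * f (y₀ + t • (z - y₀))) (Icc 0 1) := by
    intro z hz
    refine ContinuousOn.mul (by fun_prop) ?_
    exact hf.continuousOn.comp (f := fun t : ℝ => y₀ + t • (z - y₀)) (by fun_prop)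
      fun t ht => hray t ht z hz
  have hfc' : ContinuousOn (fun t : ℝ => t ^ (m + 1) • fderiv ℝ f (y₀ + t • (y - y₀)))
      (Icc 0 1) := by
    refine (continuous_pow (m + 1)).continuousOn.smul ?_
    exact hf'.comp (f := fun t : ℝ => y₀ + t • (y - y₀)) (by fun_prop) fun t ht => hray t ht y hy
  refine (intervalIntegral.hasFDerivAt_integral_of_dominated_of_fderiv_le
    (F := fun y t => t ^ m * f (y₀ + t • (y - y₀)))
    (F' := fun y t => t ^ (m + 1) • fderiv ℝ f (y₀ + t • (y - y₀)))
    (bound := fun _ => C) (Metric.ball_mem_nhds y hε) ?_ ?_ ?_ ?_ ?_ ?_)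
  · filter_upwards [Metric.ball_mem_nhds y hε] with z hz
    exact ((hfc z (hball (Metric.ball_subset_closedBall hz))).mono hI).aestronglyMeasurable
      measurableSet_uIoc
  · exact ContinuousOn.intervalIntegrable (by rw [hI']; exact hfc y hy)
  · exact (hfc'.mono hI).aestronglyMeasurable measurableSet_uIoc
  · refine Filter.Eventually.of_forall fun t ht z hz => ?_
    have ht' := hI ht
    rw [norm_smul, norm_pow, Real.norm_of_nonneg ht'.1]
    have h1 := hC _ ⟨(t, z), ⟨ht', Metric.ball_subset_closedBall hz⟩, rfl⟩
    calc t ^ (m + 1) * ‖fderiv ℝ f (y₀ + t • (z - y₀))‖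
        ≤ 1 * ‖fderiv ℝ f (y₀ + t • (z - y₀))‖ := by
          gcongr
          exact pow_le_one₀ ht'.1 ht'.2
      _ ≤ C := by rw [one_mul]; exact h1
  · exact intervalIntegrable_const
  · refine Filter.Eventually.of_forall fun t ht z hz => ?_
    have hz' : z ∈ O := hball (Metric.ball_subset_closedBall hz)
    have h1 : HasFDerivAt f (fderiv ℝ f (y₀ + t • (z - y₀))) (y₀ + t • (z - y₀)) :=
      ((hf.contDiffAt (hO.mem_nhds (hray t (hI ht) z hz'))).differentiableAt
        (by simp)).hasFDerivAt
    have h2 : HasFDerivAt (fun z : E => y₀ + t • (z - y₀)) (t • ContinuousLinearMap.id ℝ E) z :=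
      (((hasFDerivAt_id z).sub_const y₀).const_smul t).const_add y₀
    refine ((h1.comp z h2).const_mul (t ^ m)).congr_fderiv ?_
    ext v
    simp [pow_succ, mul_assoc]

theorem contDiffOn_ray {α : Type*} [Fintype α] [DecidableEq α] {O : Set (α → ℝ)} (hO : IsOpen O)
    {y₀ : α → ℝ} (hs : StarConvex ℝ y₀ O) {f : (α → ℝ) → ℝ} (hf : ContDiffOn ℝ ∞ f O) (m : ℕ) :
    ContDiffOn ℝ ∞ (fun y => ∫ t in (0 : ℝ)..1, t ^ m * f (y₀ + t • (y - y₀))) O := by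
  rw [contDiffOn_infty]
  intro n
  induction n generalizing f m with
  | zero =>
    exact contDiffOn_zero.2 fun y hy =>
      (hasFDerivAt_ray hO hs hf m hy).continuousAt.continuousWithinAt
  | succ n ih =>
    rw [show ((n + 1 : ℕ) : WithTop ℕ∞) = (n : WithTop ℕ∞) + 1 by simp,
      contDiffOn_succ_iff_fderiv_of_isOpen hO]
    refine ⟨fun y hy => (hasFDerivAt_ray hO hs hf m hy).differentiableAt.differentiableWithinAt,
      by simp, ?_⟩
    have hpart : ∀ v : α → ℝ, ContDiffOn ℝ ∞ (fun y => fderiv ℝ f y v) O := fun v =>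
      (hf.fderiv_of_isOpen hO (m := ∞) (by simp)).clm_apply contDiffOn_const
    rw [contDiffOn_clm_apply]
    intro v
    refine (ih (hpart v) (m + 1)).congr fun y hy => ?_
    rw [(hasFDerivAt_ray hO hs hf m hy).fderiv, ContinuousLinearMap.intervalIntegral_apply]
    · rfl
    · refine ContinuousOn.intervalIntegrable ?_
      rw [uIcc_of_le zero_le_one]
      refine (continuous_pow (m + 1)).continuousOn.smul ?_
      exact (hf.continuousOn_fderiv_of_isOpen hO (by simp)).comp
        (f := fun t : ℝ => y₀ + t • (y - y₀)) (by fun_prop) fun t ht => hs.add_smul_sub_mem hy ht.1 ht.2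

end Ray

section Star

open TopologicalSpace MeasureTheory

variable {ι : Type*}

theorem starConvex_image_restrict {V : Set (ι → ℝ)} {p₀ : ι → ℝ} (hs : StarConvex ℝ p₀ V)
    (S : Finset ι) : StarConvex ℝ (S.restrict p₀) (S.restrict '' V) := by
  rintro _ ⟨p, hp, rfl⟩ a b ha hb hab
  exact ⟨_, hs hp ha hb hab, rfl⟩

/-- Every neighbourhood of a jet contains an open neighbourhood that is star-shaped about it. -/
theorem exists_starConvex (V : Opens (ι → ℝ)) {p₀ : ι → ℝ} (hp : p₀ ∈ V) :
    ∃ W : Opens (ι → ℝ), W ≤ V ∧ p₀ ∈ W ∧ StarConvex ℝ p₀ (W : Set (ι → ℝ)) := by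
  obtain ⟨I, u, hu, hI⟩ := isOpen_pi_iff.1 V.isOpen p₀ hp
  choose ε hε hb using fun a : I => Metric.isOpen_iff.1 (hu a a.2).1 (p₀ a) (hu a a.2).2
  refine ⟨⟨⋂ a : I, {p | p a ∈ Metric.ball (p₀ a) (ε a)}, ?_⟩, ?_, ?_, ?_⟩
  · exact isOpen_iInter_of_finite fun a => Metric.isOpen_ball.preimage (continuous_apply (a : ι))
  · intro p hp'
    refine hI fun a ha => hb ⟨a, ha⟩ ?_
    have h1 : p ∈ ⋂ a : I, {p : ι → ℝ | p a ∈ Metric.ball (p₀ a) (ε a)} := hp'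
    exact Set.mem_iInter.1 h1 ⟨a, ha⟩
  · exact Set.mem_iInter.2 fun a => Metric.mem_ball_self (hε a)
  · refine starConvex_iInter fun a => ?_
    have h1 : StarConvex ℝ (p₀ a) (Metric.ball (p₀ a) (ε a)) :=
      (convex_ball _ _).starConvex (Metric.mem_ball_self (hε a))
    intro p hp' s t hs ht hst
    exact h1 hp' hs ht hst

namespace DF

variable {V : Opens (ι → ℝ)}

/-- The average along the ray from `p₀`. -/
noncomputable def rayInt (p₀ : ι → ℝ) (m : ℕ) (f : DF V) (p : ι → ℝ) : ℝ :=
  ∫ t in (0 : ℝ)..1, t ^ m * f.ex (p₀ + t • (p - p₀))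

theorem rayInt_eq {p₀ : ι → ℝ} (hs : StarConvex ℝ p₀ (V : Set (ι → ℝ))) (m : ℕ) {f : DF V}
    {S : Finset ι} {F : (S → ℝ) → ℝ} (he : ∀ p ∈ V, f.ex p = F (S.restrict p)) {p : ι → ℝ}
    (hp : p ∈ V) : rayInt p₀ m f p = ∫ t in (0 : ℝ)..1,
      t ^ m * F (S.restrict p₀ + t • (S.restrict p - S.restrict p₀)) := by
  refine intervalIntegral.integral_congr fun t ht => ?_
  rw [Set.uIcc_of_le zero_le_one] at ht
  rw [he _ (hs.add_smul_sub_mem hp ht.1 ht.2)]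
  rfl

theorem isDiffFun_rayInt {p₀ : ι → ℝ} (hs : StarConvex ℝ p₀ (V : Set (ι → ℝ))) (m : ℕ)
    (f : DF V) : IsDiffFun (V : Set (ι → ℝ)) (rayInt p₀ m f) := by
  classical
  obtain ⟨S, F, hF, he⟩ := f.isDiffFun_ex
  exact ⟨S, _, contDiffOn_ray (isOpen_image_restrict V.isOpen S) (starConvex_image_restrict hs S)
    hF m, fun p hp => rayInt_eq hs m he hp⟩

theorem intervalIntegrable_ray {p₀ : ι → ℝ} (hs : StarConvex ℝ p₀ (V : Set (ι → ℝ))) (m : ℕ)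
    (f : DF V) {p : ι → ℝ} (hp : p ∈ V) :
    IntervalIntegrable (fun t => t ^ m * f.ex (p₀ + t • (p - p₀))) volume 0 1 := by
  obtain ⟨S, F, hF, he⟩ := f.isDiffFun_ex
  refine ContinuousOn.intervalIntegrable ?_
  rw [Set.uIcc_of_le zero_le_one]
  refine ContinuousOn.mul (by fun_prop) ?_
  have h1 : ContinuousOn (fun t : ℝ => F (S.restrict (p₀ + t • (p - p₀)))) (Set.Icc 0 1) := by
    refine hF.continuousOn.comp ((continuous_restrict S).comp (by fun_prop)).continuousOn
      fun t ht => ⟨_, hs.add_smul_sub_mem hp ht.1 ht.2, rfl⟩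
  exact h1.congr fun t ht => he _ (hs.add_smul_sub_mem hp ht.1 ht.2)

/-- The average along the rays from the centre of a star-shaped set, `∫₀¹ t^m f dt`. -/
noncomputable def ray {p₀ : ι → ℝ} (hs : StarConvex ℝ p₀ (V : Set (ι → ℝ))) (m : ℕ) :
    DF V →ₗ[ℝ] DF V where
  toFun f := mk (rayInt p₀ m f) (isDiffFun_rayInt hs m f)
  map_add' f g := ext_ex fun p hp => by
    rw [ex_add _ _ hp, ex_mk _ hp, ex_mk _ hp, ex_mk _ hp]
    unfold rayInt
    rw [← intervalIntegral.integral_add (intervalIntegrable_ray hs m f hp)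
      (intervalIntegrable_ray hs m g hp)]
    refine intervalIntegral.integral_congr fun t ht => ?_
    rw [Set.uIcc_of_le zero_le_one] at ht
    rw [ex_add _ _ (hs.add_smul_sub_mem hp ht.1 ht.2), mul_add]
  map_smul' c f := ext_ex fun p hp => by
    rw [RingHom.id_apply, ex_smul _ _ hp, ex_mk _ hp, ex_mk _ hp]
    unfold rayInt
    rw [← intervalIntegral.integral_const_mul]
    refine intervalIntegral.integral_congr fun t ht => ?_
    rw [Set.uIcc_of_le zero_le_one] at ht
    rw [ex_smul _ _ (hs.add_smul_sub_mem hp ht.1 ht.2)]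
    ring

theorem ex_ray {p₀ : ι → ℝ} (hs : StarConvex ℝ p₀ (V : Set (ι → ℝ))) (m : ℕ) (f : DF V)
    {p : ι → ℝ} (hp : p ∈ V) : (ray hs m f).ex p = rayInt p₀ m f p :=
  ex_mk (isDiffFun_rayInt hs m f) hp

variable [DecidableEq ι]

theorem pdR_ray {p₀ : ι → ℝ} (hs : StarConvex ℝ p₀ (V : Set (ι → ℝ))) (m : ℕ) (f : DF V) (a : ι) :
    pdR a (ray hs m f) = ray hs (m + 1) (pdR a f) := by
  obtain ⟨S, F, hF, he⟩ := f.isDiffFun_ex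
  have hO := isOpen_image_restrict V.isOpen S
  have hsO := starConvex_image_restrict hs S
  refine ext_ex fun p hp => ?_
  rw [ex_pdR _ _ hp, ex_ray _ _ _ hp]
  have he' : ∀ q ∈ V, (ray hs m f).ex q = ∫ t in (0 : ℝ)..1,
      t ^ m * F (S.restrict p₀ + t • (S.restrict q - S.restrict p₀)) := fun q hq => by
    rw [ex_ray _ _ _ hq, rayInt_eq hs m he hq]
  by_cases ha : a ∈ S
  · rw [pd_eq_fderiv V.isOpen (contDiffOn_ray hO hsO hF m) he' hp ha,
      (hasFDerivAt_ray hO hsO hF m ⟨p, hp, rfl⟩).fderiv,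
      ContinuousLinearMap.intervalIntegral_apply]
    · refine intervalIntegral.integral_congr fun t ht => ?_
      rw [Set.uIcc_of_le zero_le_one] at ht
      have hq := hs.add_smul_sub_mem hp ht.1 ht.2
      rw [ex_pdR _ _ hq, pd_eq_fderiv V.isOpen hF he hq ha]
      rfl
    · refine ContinuousOn.intervalIntegrable ?_
      rw [Set.uIcc_of_le zero_le_one]
      refine (continuous_pow (m + 1)).continuousOn.smul ?_
      exact (hF.continuousOn_fderiv_of_isOpen hO (by simp)).comp
        (f := fun t : ℝ => S.restrict p₀ + t • (S.restrict p - S.restrict p₀)) (by fun_prop)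
        fun t ht => hsO.add_smul_sub_mem ⟨p, hp, rfl⟩ ht.1 ht.2
  · rw [pd_eq_zero_of_notMem V.isOpen (F := fun y => ∫ t in (0 : ℝ)..1,
      t ^ m * F (S.restrict p₀ + t • (y - S.restrict p₀))) he' hp ha, rayInt]
    refine (intervalIntegral.integral_zero (a := (0 : ℝ)) (b := 1) (μ := volume)
      (E := ℝ)).symm.trans ?_
    refine intervalIntegral.integral_congr fun t ht => ?_
    rw [Set.uIcc_of_le zero_le_one] at ht
    have hq := hs.add_smul_sub_mem hp ht.1 ht.2
    rw [ex_pdR _ _ hq, pd_eq_zero_of_notMem V.isOpen he hq ha, mul_zero]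

theorem hasDerivAt_ray {p₀ : ι → ℝ} (hs : StarConvex ℝ p₀ (V : Set (ι → ℝ))) (f : DF V)
    {S : Finset ι} (hS : ∀ a ∉ S, pdR a f = 0) {p : ι → ℝ} (hp : p ∈ V) {t : ℝ}
    (ht : t ∈ Set.Icc (0 : ℝ) 1) :
    HasDerivAt (fun t : ℝ => f.ex (p₀ + t • (p - p₀)))
      (∑ e ∈ S, (p e - p₀ e) * (pdR e f).ex (p₀ + t • (p - p₀))) t := by
  obtain ⟨T, F, hF, he⟩ := f.isDiffFun_ex
  have hq := hs.add_smul_sub_mem hp ht.1 ht.2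
  have hO := isOpen_image_restrict V.isOpen T
  have hline : Continuous fun t : ℝ => p₀ + t • (p - p₀) := by fun_prop
  have hev : ∀ᶠ s in nhds t, p₀ + s • (p - p₀) ∈ V :=
    hline.continuousAt.eventually_mem (V.isOpen.mem_nhds hq)
  have h1 : HasFDerivAt F (fderiv ℝ F (T.restrict (p₀ + t • (p - p₀))))
      (T.restrict (p₀ + t • (p - p₀))) :=
    ((hF.contDiffAt (hO.mem_nhds ⟨_, hq, rfl⟩)).differentiableAt (by simp)).hasFDerivAt
  have h2 : HasDerivAt (fun s : ℝ => T.restrict (p₀ + s • (p - p₀)))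
      (T.restrict p - T.restrict p₀) t := by
    have := ((hasDerivAt_id t).smul_const (T.restrict p - T.restrict p₀)).const_add (T.restrict p₀)
    rw [one_smul] at this
    exact this
  have h3 := h1.comp_hasDerivAt t h2
  refine (h3.congr_of_eventuallyEq (hev.mono fun s hs' => he _ hs')).congr_deriv ?_
  have h4 : T.restrict p - T.restrict p₀ = ∑ e : T, (p e - p₀ e) • (Pi.single e 1 : T → ℝ) := by
    ext b
    simp [Finset.sum_apply, Pi.single_apply]
  rw [h4, map_sum]
  have h5 : ∀ e : T, fderiv ℝ F (T.restrict (p₀ + t • (p - p₀)))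
      ((p e - p₀ e) • (Pi.single e 1 : T → ℝ)) =
      (p e - p₀ e) * (pdR (e : ι) f).ex (p₀ + t • (p - p₀)) := by
    intro e
    rw [map_smul, smul_eq_mul, ex_pdR _ _ hq, pd_eq_fderiv V.isOpen hF he hq e.2]
  rw [Finset.sum_congr rfl fun e _ => h5 e, Finset.sum_coe_sort T
    (fun e => (p e - p₀ e) * (pdR e f).ex (p₀ + t • (p - p₀)))]
  have hz : ∀ e, (e ∉ S ∨ e ∉ T) → (p e - p₀ e) * (pdR e f).ex (p₀ + t • (p - p₀)) = 0 := by
    rintro e (h | h)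
    · rw [hS e h, ex_zero hq, mul_zero]
    · rw [ex_pdR _ _ hq, pd_eq_zero_of_notMem V.isOpen he hq h, mul_zero]
  rw [Finset.sum_subset (Finset.subset_union_left (s₁ := T) (s₂ := S))
      fun e _ h => hz e (Or.inr h),
    Finset.sum_subset (Finset.subset_union_right (s₁ := T) (s₂ := S)) fun e _ h => hz e (Or.inl h)]

/-- The fundamental theorem of calculus along the rays from the centre. -/
theorem eq_ray_sum {p₀ : ι → ℝ} (hs : StarConvex ℝ p₀ (V : Set (ι → ℝ))) (f : DF V)
    {S : Finset ι} (hS : ∀ a ∉ S, pdR a f = 0) (m : ℕ) :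
    f = (if m = 0 then algebraMap ℝ (DF V) (f.ex p₀) else 0) + (m : DF V) * ray hs (m - 1) f +
      ∑ e ∈ S, (coord V e - algebraMap ℝ (DF V) (p₀ e)) * ray hs m (pdR e f) := by
  refine ext_ex fun p hp => ?_
  have hint : ∀ k (g : DF V), IntervalIntegrable (fun t => t ^ k * g.ex (p₀ + t • (p - p₀)))
      volume 0 1 := fun k g => intervalIntegrable_ray hs k g hp
  have hsum : IntervalIntegrable (fun t => ∑ e ∈ S, (p e - p₀ e) *
      (t ^ m * (pdR e f).ex (p₀ + t • (p - p₀)))) volume 0 1 := by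
    have := IntervalIntegrable.sum S fun e _ => (hint m (pdR e f)).const_mul (p e - p₀ e)
    rwa [Finset.sum_fn] at this
  have hftc := intervalIntegral.integral_eq_sub_of_hasDerivAt (a := (0 : ℝ)) (b := 1)
    (f := fun t => t ^ m * f.ex (p₀ + t • (p - p₀)))
    (f' := fun t => (m : ℝ) * (t ^ (m - 1) * f.ex (p₀ + t • (p - p₀))) +
      ∑ e ∈ S, (p e - p₀ e) * (t ^ m * (pdR e f).ex (p₀ + t • (p - p₀))))
    (fun t ht => by
      rw [Set.uIcc_of_le zero_le_one] at ht
      refine ((hasDerivAt_pow m t).mul (hasDerivAt_ray hs f hS hp ht)).congr_deriv ?_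
      rw [Finset.mul_sum, mul_assoc]
      congr 1
      exact Finset.sum_congr rfl fun e _ => by ring)
    (((hint _ f).const_mul _).add hsum)
  rw [intervalIntegral.integral_add ((hint _ f).const_mul _)
    hsum,
    intervalIntegral.integral_const_mul,
    intervalIntegral.integral_finsetSum fun e _ => (hint m (pdR e f)).const_mul _] at hftc
  simp only [intervalIntegral.integral_const_mul] at hftc
  have hm : ((m : DF V)).ex p = m := by
    rw [← map_natCast (algebraMap ℝ (DF V)), ex_algebraMap _ hp]
  rw [ex_add _ _ hp, ex_add _ _ hp, ex_mul _ _ hp, ex_ray _ _ _ hp, hm, ex_sum _ _ hp]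
  have h1 : ∀ e ∈ S, ((coord V e - algebraMap ℝ (DF V) (p₀ e)) * ray hs m (pdR e f)).ex p =
      (p e - p₀ e) * rayInt p₀ m (pdR e f) p := fun e _ => by
    rw [ex_mul _ _ hp, ex_sub _ _ hp, ex_coord _ hp, ex_algebraMap _ hp, ex_ray _ _ _ hp]
  rw [Finset.sum_congr rfl h1]
  have h2 : (if m = 0 then algebraMap ℝ (DF V) (f.ex p₀) else 0).ex p =
      (0 : ℝ) ^ m * f.ex p₀ := by
    by_cases h : m = 0
    · subst h; simp [ex_algebraMap _ hp]
    · simp [h, ex_zero hp]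
  rw [h2]
  simp only [one_pow, one_mul, one_smul, add_sub_cancel, zero_smul, add_zero] at hftc
  unfold rayInt
  linarith

end DF

end Star

/-! ### Partial and total derivatives of differential functions -/

section Instances

open TopologicalSpace

variable {κ : Type*} [DecidableEq κ] {V : Opens (ℕ × κ → ℝ)}

namespace DF

/-- The total derivative with respect to `x`. -/
noncomputable abbrev D (V : Opens (ℕ × κ → ℝ)) : Derivation ℝ (DF V) (DF V) := tdR suc

theorem isJetDerivation_pdR : IsJetDerivation (D V) pdR where
  comm := pdR_comm
  bracket := by
    rintro ⟨_ | σ, k⟩ f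
    · rw [pr_zero, add_zero, pdR_zero_tdR]
    · rw [pr_succ, pdR_succ_tdR]
  finite := exists_order

/-- Functions of `u = φ_x` as functions on the jets of `φ`: the derivatives with respect to `φ`
vanish, and the derivative with respect to `φ_{σ+1}` is the one with respect to `u_σ`. -/
theorem isJetDerivation_pr_pdR : IsJetDerivation (D V) (pr pdR) where
  comm := by
    rintro ⟨_ | σ, k⟩ ⟨_ | τ, l⟩ f <;> simp [pdR_comm]
  bracket := by
    rintro ⟨_ | _ | σ, k⟩ f
    · simp
    · simp [pdR_zero_tdR]
    · simp [pdR_succ_tdR]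
  finite f := by
    obtain ⟨N, hN⟩ := exists_order f
    refine ⟨N + 1, ?_⟩
    rintro ⟨_ | σ, k⟩ h
    · simp at h
    · rw [pr_succ, hN (σ, k) (by simpa using h)]

theorem iterate_coord (a : ℕ × κ) (k : ℕ) : (D V)^[k] (coord V a) = coord V (a.1 + k, a.2) := by
  induction k with
  | zero => rfl
  | succ k ih => rw [Function.iterate_succ_apply', ih, tdR_coord]; rfl

/-- The coefficients of a differential operator are determined by its values on coordinates of high
order. -/
theorem faithful {μ : Type*} [Fintype μ] (k : μ → κ) : Faithful μ (D V) := by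
  classical
  intro N T hT h
  obtain ⟨L, hL⟩ := (isJetDerivation_pdR (V := V)).exists_order (box μ N) T
    fun b hb => hT b (by rw [mem_box] at hb; omega)
  funext ⟨τ, i⟩
  by_cases hτ : N ≤ τ
  · exact hT _ hτ
  have h1 := congrArg (pdR (L + τ, k i)) (h (Pi.single i (coord V (L, k i))))
  rw [map_zero, ev_eq_sum, map_sum, Finset.sum_eq_single_of_mem τ (by simpa using hτ)] at h1
  · rw [Finset.sum_eq_single_of_mem i (Finset.mem_univ _), Pi.single_eq_same, iterate_coord,
      Derivation.leibniz, pdR_coord, if_pos rfl, hL _ _ (by simp)] at h1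
    · simpa using h1
    · intro j _ hj
      rw [Pi.single_eq_of_ne hj, iterate_map_zero, mul_zero]
  · intro σ _ hσ
    rw [map_sum]
    refine Finset.sum_eq_zero fun j _ => ?_
    by_cases hj : j = i
    · subst hj
      rw [Pi.single_eq_same, iterate_coord, Derivation.leibniz, pdR_coord, if_neg (by
        simp only [Prod.mk.injEq, not_and]; omega), hL _ _ (by simp)]
      simp
    · rw [Pi.single_eq_of_ne hj, iterate_map_zero, mul_zero, map_zero]

theorem D_res {W : Opens (ℕ × κ → ℝ)} (h : W ≤ V) (f : DF V) : D W (res h f) = res h (D V f) :=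
  tdR_pull (s := suc) (t := suc) _ Function.injective_id (fun _ => rfl) f

theorem pdR_res {W : Opens (ℕ × κ → ℝ)} (h : W ≤ V) (a : ℕ × κ) (f : DF V) :
    pdR a (res h f) = res h (pdR a f) :=
  pdR_pull _ Function.injective_id a f

/-- `f` is locally a total derivative. -/
def IsTrivial (f : DF V) : Prop :=
  ∀ p ∈ V, ∃ (W : Opens (ℕ × κ → ℝ)) (h : W ≤ V), p ∈ W ∧ ∃ g, res h f = D W g

theorem IsTrivial.add {f g : DF V} (hf : IsTrivial f) : IsTrivial (f + D V g) := by
  intro p hp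
  obtain ⟨W, h, hpW, g', hg'⟩ := hf p hp
  exact ⟨W, h, hpW, g' + res h g, by rw [map_add, map_add, hg', D_res]⟩

end DF

/-- If the total derivative `Dg` has order at most `N`, then `g` has order less than `N`. -/
theorem IsJetDerivation.order_of_D {μ R : Type*} [CommRing R] [Algebra ℝ R] {D : Derivation ℝ R R}
    {δ : ℕ × μ → Derivation ℝ R R} (h : IsJetDerivation D δ) {g : R} {N : ℕ}
    (hg : ∀ a, N + 1 ≤ a.1 → δ a (D g) = 0) : ∀ a, N ≤ a.1 → δ a g = 0 := by
  obtain ⟨M, hM⟩ := h.finite g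
  have key : ∀ k σ i, N ≤ σ → M ≤ σ + k → δ (σ, i) g = 0 := by
    intro k
    induction k with
    | zero => exact fun σ i _ hσ => hM (σ, i) hσ
    | succ k ih =>
      intro σ i h1 h2
      have h3 := h.bracket (σ + 1, i) g
      rw [hg (σ + 1, i) (by simpa using h1), ih (σ + 1) i (by omega) (by omega), map_zero, pr_succ,
        zero_add] at h3
      exact h3.symm
  exact fun a ha => key M a.1 a.2 ha (by omega)

namespace DF

/-- A covector whose pairing with every vector function is locally a total derivative is zero: the
square of a coordinate of high order serves as test function, since a total derivative is affine in
the coordinates of highest order. -/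
theorem eq_zero_of_isTrivial {μ : Type*} [Fintype μ] (k : μ → κ) (E : μ → DF V)
    (h : ∀ Y : μ → DF V, IsTrivial (∑ i, E i * Y i)) : E = 0 := by
  classical
  funext i
  obtain ⟨N, hN⟩ := exists_order (E i)
  refine ext_ex fun p hp => ?_
  obtain ⟨W, hW, hpW, g, hg⟩ := h (Pi.single i (coord V (N + 1, k i) * coord V (N + 1, k i))) p hp
  rw [Finset.sum_eq_single_of_mem i (Finset.mem_univ _) fun j _ hj => by
    rw [Pi.single_eq_of_ne hj, mul_zero], Pi.single_eq_same] at hg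
  set e : DF W := res hW (E i) with he
  set c : DF W := coord W (N + 1, k i) with hc
  have hg' : e * (c * c) = D W g := by
    rw [← hg, map_mul, map_mul]; rfl
  have hδ := isJetDerivation_pdR (V := W)
  have he0 : ∀ a : ℕ × κ, N ≤ a.1 → pdR a e = 0 := fun a ha => by
    rw [he, pdR_res, hN a ha, map_zero]
  have hc0 : ∀ a : ℕ × κ, N + 2 ≤ a.1 → pdR a c = 0 := fun a ha => by
    rw [hc, pdR_coord, if_neg]
    rintro rfl
    simp at ha
  have hord := hδ.order_of_D (g := g) (N := N + 1) fun a ha => by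
    rw [← hg', Derivation.leibniz, Derivation.leibniz, hc0 a (by omega), he0 a (by omega)]
    simp
  have h1 : pdR (N + 1, k i) (D W g) = pdR (N, k i) g := by
    rw [hδ.bracket, hord (N + 1, k i) (by simp), map_zero, pr_succ, zero_add]
  have h2 : pdR (N + 1, k i) (pdR (N + 1, k i) (D W g)) = 0 := by
    rw [h1, pdR_comm, hord (N + 1, k i) (by simp), map_zero]
  have hc1 : pdR (N + 1, k i) c = 1 := by rw [hc, pdR_coord, if_pos rfl]
  have h3 : pdR (N + 1, k i) (pdR (N + 1, k i) (e * (c * c))) = 2 * e := by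
    simp only [Derivation.leibniz, map_add, he0 (N + 1, k i) (by simp), hc1, smul_eq_mul, mul_zero,
      mul_one, add_zero]
    ring
  rw [hg', h2] at h3
  have h4 := congrArg (fun f => f.ex p) h3
  simp only [ex_zero hpW, two_mul, ex_add _ _ hpW, he, ex_res hW _ hpW] at h4
  rw [Pi.zero_apply, ex_zero hp]
  linarith

variable {p₀ : ℕ × κ → ℝ}

/-- The radial homotopy of a star-shaped set of jets. -/
noncomputable def radial (hp₀ : p₀ ∈ V) (hs : StarConvex ℝ p₀ (V : Set (ℕ × κ → ℝ)))
    [Fintype κ] :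
    RadialHomotopy (D V) (pdR (V := V)) where
  w₀ := 1
  x a := coord V a - algebraMap ℝ (DF V) (p₀ a)
  J := ray hs
  c₀ :=
    { toFun := fun f => algebraMap ℝ (DF V) (f.ex p₀)
      map_add' := fun f g => by rw [ex_add _ _ hp₀, map_add]
      map_smul' := fun c f => by
        rw [ex_smul _ _ hp₀, map_mul, RingHom.id_apply, Algebra.smul_def] }
  w₀_le := le_rfl
  δ_zero h := by simp at h
  δ_x a e := by
    rw [map_sub, pdR_coord, Derivation.map_algebraMap, sub_zero]
    simp
  δ_J a m f := pdR_ray hs m f a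
  δ_c₀ a f := Derivation.map_algebraMap _ _
  D_c₀ f := Derivation.map_algebraMap _ _
  eq_sum N f hf m :=
    eq_ray_sum hs f (S := box κ N) (fun a ha => hf a (by rw [mem_box] at ha; omega)) m

/-- The radial homotopy for functions of `u = φ_x`, with forms that may contain `dφ`. -/
noncomputable def radialShift (hp₀ : p₀ ∈ V) (hs : StarConvex ℝ p₀ (V : Set (ℕ × κ → ℝ)))
    [Fintype κ] :
    RadialHomotopy (D V) (pr (pdR (V := V))) where
  w₀ := 0
  x := pr (radial hp₀ hs).x
  J := ray hs
  c₀ := (radial hp₀ hs).c₀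
  w₀_le := zero_le_one
  δ_zero _ i f := by simp
  δ_x := by
    rintro ⟨_ | σ, k⟩ ⟨_ | τ, l⟩
    · simp
    · simp
    · simp
    · simp only [pr_succ, (radial hp₀ hs).δ_x, Prod.mk.injEq, add_left_inj]
      simp [radial]
  δ_J := by
    rintro ⟨_ | σ, k⟩ m f
    · simp
    · exact pdR_ray hs m f (σ, k)
  δ_c₀ := by
    rintro ⟨_ | σ, k⟩ f
    · simp
    · exact (radial hp₀ hs).δ_c₀ (σ, k) f
  D_c₀ := (radial hp₀ hs).D_c₀
  eq_sum N f hf m := by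
    have h1 := (radial hp₀ hs).eq_sum (N - 1) f (fun a ha => by
      have := hf (a.1 + 1, a.2) (by simp; omega)
      rwa [pr_succ] at this) m
    rcases N with _ | N
    · exact h1.trans (by simp [box]; rfl)
    · have h2 : ∑ e ∈ box κ (N + 1), pr (radial hp₀ hs).x e * ray hs m (pr pdR e f) =
          ∑ e ∈ box κ N, (radial hp₀ hs).x e * ray hs m (pdR e f) := by
        rw [box, box, Finset.sum_product, Finset.sum_product, Finset.sum_range_succ']
        simp
      rw [h2]
      exact h1

end DF

end Instances

/-! ### Matrix differential operators -/

section Operators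

variable {μ R : Type*} [CommRing R] [Algebra ℝ R] (D : Derivation ℝ R R)

theorem neg_pow_toLinearMap (k : ℕ) (f : R) :
    ((-D.toLinearMap) ^ k) f = (-1) ^ k * (D^[k]) f := by
  induction k with
  | zero => simp
  | succ k ih =>
    rw [pow_succ', Module.End.mul_apply, ih, LinearMap.neg_apply, Derivation.coeFn_coe,
      Function.iterate_succ_apply', Derivation.leibniz]
    have : D ((-1 : R) ^ k) = 0 := by
      rw [show (-1 : R) ^ k = algebraMap ℝ R ((-1) ^ k) by simp, Derivation.map_algebraMap]
    rw [this, smul_eq_mul, smul_zero, add_zero, pow_succ]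
    ring

theorem redE_toLinearMap (N : ℕ) (T : ℕ × μ → R) (i : μ) :
    redE D.toLinearMap N T i = ∑ k ∈ Finset.range N, (-1) ^ k * (D^[k]) (T (k, i)) :=
  Finset.sum_congr rfl fun k _ => neg_pow_toLinearMap D k _

/-- The matrix differential operator with coefficients `b σ i j`, as the bilinear operator
`⟨B X, Y⟩`; the outer slot belongs to `Y`. -/
def opT (b : ℕ → μ → μ → R) : ℕ × μ → ℕ × μ → R :=
  fun c a => if c.1 = 0 then b a.1 c.2 a.2 else 0

theorem bound_opT {N : ℕ} {b : ℕ → μ → μ → R} (hb : ∀ σ, N ≤ σ → b σ = 0) :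
    bound₂ μ R N (opT b) := by
  refine bound₂_iff.2 fun c a h => ?_
  unfold opT
  split_ifs with hc
  · rw [hb a.1 (by omega)]; rfl
  · rfl

theorem bound₂_swap {N : ℕ} {T : ℕ × μ → ℕ × μ → R} (hT : bound₂ μ R N T) :
    bound₂ μ R N fun a b => T b a :=
  bound₂_iff.2 fun a b h => bound₂_iff.1 hT b a h.symm

variable {D} in
/-- Transport of total derivatives along a ring homomorphism that commutes with them. -/
theorem map_slot₂ {R' : Type*} [CommRing R'] [Algebra ℝ R'] {D' : Derivation ℝ R' R'}
    (π : R →ₐ[ℝ] R') (hπ : ∀ f, D' (π f) = π (D f)) (S : ℕ × μ → ℕ × μ → R) :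
    (fun c a => π (slot₂ D S c a)) = slot₂ D' fun c a => π (S c a) := by
  funext c a
  rcases c with ⟨_ | c, i⟩ <;> rcases a with ⟨_ | a, j⟩ <;>
  · simp only [slot_apply, Pi.add_apply, Derivation.coeFn_coe, map_add, hπ, pr_zero, pr_succ,
      Pi.zero_apply, map_zero]

variable {D} in
theorem map_slot₃ {R' : Type*} [CommRing R'] [Algebra ℝ R'] {D' : Derivation ℝ R' R'}
    (π : R →ₐ[ℝ] R') (hπ : ∀ f, D' (π f) = π (D f)) (S : ℕ × μ → ℕ × μ → ℕ × μ → R) :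
    (fun c b a => π (slot₃ D S c b a)) = slot₃ D' fun c b a => π (S c b a) := by
  funext c b a
  rcases c with ⟨_ | c, i⟩ <;> rcases b with ⟨_ | b, k⟩ <;> rcases a with ⟨_ | a, j⟩ <;>
  · simp only [slot_apply, Pi.add_apply, Derivation.coeFn_coe, map_add, hπ, pr_zero, pr_succ,
      Pi.zero_apply, map_zero]

/-- The cyclic sum `⟨ℓ_{B,X}(Y), Z⟩ + ⟨ℓ_{B,Y}(Z), X⟩ + ⟨ℓ_{B,Z}(X), Y⟩` as a trilinear operator. The
slots belong to `Z`, `Y`, `X` in this order. -/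
def cyc (δ : ℕ × μ → Derivation ℝ R R) (β : ℕ × μ → ℕ × μ → R) : ℕ × μ → ℕ × μ → ℕ × μ → R :=
  fun c b a => δ b (β c a) + δ c (β a b) + δ a (β b c)

variable {D} in
theorem cyc_slot {δ : ℕ × μ → Derivation ℝ R R} (h : IsJetDerivation D δ)
    (S : ℕ × μ → ℕ × μ → R) : cyc δ (slot₂ D S) = slot₃ D (cyc δ S) := by
  funext c b a
  rcases c with ⟨_ | c, i⟩ <;> rcases b with ⟨_ | b, k⟩ <;> rcases a with ⟨_ | a, j⟩ <;>
  · simp only [cyc, slot_apply, Pi.add_apply, Derivation.coeFn_coe, map_add, h.bracket, pr_zero,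
      pr_succ, Pi.zero_apply, map_zero]
    abel

variable [Fintype μ]

/-- The value `B X` of a matrix differential operator. -/
def actR (N : ℕ) (b : ℕ → μ → μ → R) (X : μ → R) (i : μ) : R :=
  ∑ σ ∈ Finset.range N, ∑ j, b σ i j * (D^[σ]) (X j)

/-- The value of the formal adjoint of a matrix differential operator. -/
def adjR (N : ℕ) (b : ℕ → μ → μ → R) (X : μ → R) (i : μ) : R :=
  ∑ σ ∈ Finset.range N, (-1) ^ σ * (D^[σ]) (∑ j, b σ j i * X j)

/-- The value `ℓ_L(X)` of the linearization. -/
noncomputable def linR (δ : ℕ × μ → Derivation ℝ R R) (N : ℕ) (L X : μ → R) (i : μ) : R :=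
  ev D N X fun a => δ a (L i)

/-- The value `ℓ_L^*(X)` of the adjoint of the linearization. -/
def linAdjR (δ : ℕ × μ → Derivation ℝ R R) (N : ℕ) (L X : μ → R) (i : μ) : R :=
  ∑ σ ∈ Finset.range N, (-1) ^ σ * (D^[σ]) (∑ k, δ (σ, i) (L k) * X k)

/-- The coefficients of `-M A M`, with `M = K⁻¹`, for the operator `A` with coefficients `a`. -/
noncomputable def sympR [DecidableEq μ] (K : Matrix μ μ ℝ) (a : ℕ → μ → μ → R) (σ : ℕ) (i j : μ) :
    R :=
  -∑ r, ∑ s, (K⁻¹ i r * K⁻¹ s j) • a σ r s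

/-- A constant matrix acting on a vector function. -/
def mulR (K : Matrix μ μ ℝ) (X : μ → R) (i : μ) : R := ∑ j, K i j • X j

theorem mulR_mulR (K L : Matrix μ μ ℝ) (X : μ → R) : mulR K (mulR L X) = mulR (K * L) X := by
  funext i
  simp only [mulR, Finset.smul_sum, Matrix.mul_apply, Finset.sum_smul, smul_smul]
  exact Finset.sum_comm

theorem mulR_one [DecidableEq μ] (X : μ → R) : mulR (1 : Matrix μ μ ℝ) X = X := by
  funext i
  simp [mulR, Matrix.one_apply]

theorem iterate_sum {α : Type*} (k : ℕ) (s : Finset α) (f : α → R) :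
    (D^[k]) (∑ i ∈ s, f i) = ∑ i ∈ s, (D^[k]) (f i) := by
  induction k with
  | zero => rfl
  | succ k ih => simp only [Function.iterate_succ_apply', ih, map_sum]

theorem iterate_smul (k : ℕ) (c : ℝ) (f : R) : (D^[k]) (c • f) = c • (D^[k]) f := by
  induction k with
  | zero => rfl
  | succ k ih => simp only [Function.iterate_succ_apply', ih, Derivation.map_smul]

theorem actR_sympR [DecidableEq μ] (N : ℕ) (K : Matrix μ μ ℝ) (a : ℕ → μ → μ → R) (X : μ → R) :
    actR D N (sympR K a) X = -mulR K⁻¹ (actR D N a (mulR K⁻¹ X)) := by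
  funext i
  simp only [actR, sympR, mulR, Pi.neg_apply, Finset.smul_sum, Finset.mul_sum, neg_mul,
    Finset.sum_neg_distrib, Finset.sum_mul, iterate_sum, iterate_smul]
  congr 1
  rw [Finset.sum_comm (s := Finset.univ) (t := Finset.range N)]
  refine Finset.sum_congr rfl fun σ _ => ?_
  rw [Finset.sum_comm]
  refine Finset.sum_congr rfl fun r _ => ?_
  rw [Finset.sum_comm]
  refine Finset.sum_congr rfl fun s _ => Finset.sum_congr rfl fun j _ => ?_
  simp only [Algebra.smul_def, map_mul]
  ring

theorem inv_apply_comm [DecidableEq μ] {K : Matrix μ μ ℝ} (hK : K.IsSymm) (i j : μ) :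
    K⁻¹ i j = K⁻¹ j i := by
  have : K⁻¹.transpose = K⁻¹ := by rw [Matrix.transpose_nonsing_inv, hK.eq]
  exact (congrFun (congrFun this i) j).symm

theorem adjR_sympR [DecidableEq μ] (N : ℕ) {K : Matrix μ μ ℝ} (hK : K.IsSymm)
    (a : ℕ → μ → μ → R) (X : μ → R) :
    adjR D N (sympR K a) X = -mulR K⁻¹ (adjR D N a (mulR K⁻¹ X)) := by
  funext i
  simp only [adjR, sympR, mulR, Pi.neg_apply, Finset.smul_sum, Finset.mul_sum, neg_mul,
    Finset.sum_neg_distrib, Finset.sum_mul, iterate_sum, iterate_map_neg, mul_neg]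
  congr 1
  rw [Finset.sum_comm (s := Finset.univ) (t := Finset.range N)]
  refine Finset.sum_congr rfl fun σ _ => ?_
  rw [Finset.sum_congr rfl fun j _ => Finset.sum_comm, Finset.sum_comm]
  refine Finset.sum_congr rfl fun s _ => ?_
  rw [Finset.sum_comm]
  refine Finset.sum_congr rfl fun r _ => Finset.sum_congr rfl fun j _ => ?_
  rw [inv_apply_comm hK i s, inv_apply_comm hK r j, ← mul_smul_comm, ← iterate_smul]
  congr 2
  simp only [Algebra.smul_def, map_mul]
  ring

theorem red₂_add (N : ℕ) (S T : ℕ × μ → ℕ × μ → R) (X : μ → R) :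
    red₂ D N (S + T) X = red₂ D N S X + red₂ D N T X := by
  funext i
  simp only [red₂, redE, Pi.add_apply, map_add, Finset.sum_add_distrib]

theorem red₂_sub (N : ℕ) (S T : ℕ × μ → ℕ × μ → R) (X : μ → R) :
    red₂ D N (S - T) X = red₂ D N S X - red₂ D N T X := by
  funext i
  simp only [red₂, redE, Pi.sub_apply, map_sub, Finset.sum_sub_distrib]

theorem red₂_opT {N : ℕ} (hN : 0 < N) (b : ℕ → μ → μ → R) (X : μ → R) :
    red₂ D N (opT b) X = actR D N b X := by
  funext i
  rw [red₂, redE_toLinearMap, Finset.sum_eq_single_of_mem 0 (by simpa using hN)]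
  · rw [ev_eq_sum]
    simp [opT, actR]
  · intro k _ hk
    have : opT b (k, i) = 0 := by funext a; simp [opT, hk]
    rw [this, map_zero, iterate_map_zero, mul_zero]

theorem red₂_opT_swap {N : ℕ} (hN : 0 < N) (b : ℕ → μ → μ → R) (X : μ → R) :
    red₂ D N (fun c a => opT b a c) X = adjR D N b X := by
  funext i
  rw [red₂, redE_toLinearMap, adjR]
  refine Finset.sum_congr rfl fun k _ => ?_
  rw [ev_eq_sum, Finset.sum_eq_single_of_mem 0 (by simpa using hN)]
  · simp [opT]
  · intro σ _ hσ
    simp [opT, hσ]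

theorem red₂_ext₁ {N : ℕ} (hN : 0 < N) (δ : ℕ × μ → Derivation ℝ R R) (L X : μ → R) :
    red₂ D N (ext₁ δ (ofZero L)) X = linAdjR D δ N L X - linR D δ N L X := by
  have h1 : ext₁ δ (ofZero L) = (fun c a => δ c (ofZero L a)) - fun c a => δ a (ofZero L c) := rfl
  rw [h1, red₂_sub]
  congr 1
  · funext i
    rw [red₂, redE_toLinearMap, linAdjR]
    refine Finset.sum_congr rfl fun k _ => ?_
    rw [ev_eq_sum, Finset.sum_eq_single_of_mem 0 (by simpa using hN)]
    · simp [ofZero]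
    · intro σ _ hσ
      simp [ofZero, hσ]
  · funext i
    rw [red₂, redE_toLinearMap, Finset.sum_eq_single_of_mem 0 (by simpa using hN)]
    · simp [ofZero, linR]
    · intro k _ hk
      have : (fun a => δ a (ofZero L (k, i))) = 0 := by funext a; simp [ofZero, hk]
      rw [this, map_zero, iterate_map_zero, mul_zero]

theorem red₂_ofZero₂ {N : ℕ} (hN : 0 < N) (z : μ → μ → R) (X : μ → R) (i : μ) :
    red₂ D N (ofZero₂ z) X i = ∑ j, z i j * X j := by
  rw [red₂, redE_toLinearMap, Finset.sum_eq_single_of_mem 0 (by simpa using hN)]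
  · rw [ev_eq_sum, Finset.sum_eq_single_of_mem 0 (by simpa using hN)]
    · simp [ofZero₂]
    · intro σ _ hσ
      simp [ofZero₂, hσ]
  · intro k _ hk
    have : ofZero₂ z (k, i) = 0 := by funext a; simp [ofZero₂, hk]
    rw [this, map_zero, iterate_map_zero, mul_zero]

variable {D} in
theorem exists_bound_cyc {δ : ℕ × μ → Derivation ℝ R R} (h : IsJetDerivation D δ) {N : ℕ}
    {β : ℕ × μ → ℕ × μ → R} (hβ : bound₂ μ R N β) : ∃ n, bound₃ μ R n (cyc δ β) := by
  obtain ⟨L, hL⟩ := h.exists_order₂ hβ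
  have h2 := bound₂_iff.1 hβ
  refine ⟨max N L, bound₃_iff.2 fun c b a habc => ?_⟩
  rcases habc with hab | hab | hab
  · rw [cyc, hL _ _ c (by omega), h2 c _ (by omega), h2 _ c (by omega)]; simp
  · rw [cyc, hL _ _ b (by omega), h2 b _ (by omega), h2 _ b (by omega)]; simp
  · rw [cyc, hL _ _ a (by omega), h2 a _ (by omega), h2 _ a (by omega)]; simp

variable {D} in
/-- The potential of a skew-adjoint operator that is closed as a variational two-form. -/
theorem exists_potential_of_cyc [DecidableEq μ] {δ : ℕ × μ → Derivation ℝ R R}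
    (h : IsJetDerivation D δ) (H : RadialHomotopy D δ) {N n₁ n₂ : ℕ} {β S₁ : ℕ × μ → ℕ × μ → R}
    (hβ : bound₂ μ R N β) (hS₁ : bound₂ μ R n₁ S₁)
    (hskew : β + (fun a b => β b a) = slot₂ D S₁) {S₂ : ℕ × μ → ℕ × μ → ℕ × μ → R}
    (hS₂ : bound₃ μ R n₂ S₂) (hcyc : cyc δ β = slot₃ D S₂) :
    ∃ (L : μ → R) (n : ℕ) (S : ℕ × μ → ℕ × μ → R) (z : μ → μ → R), bound₂ μ R n S ∧
      (∀ a i j, 2 ≤ a.1 → δ a (z i j) = 0) ∧ (H.w₀ ≠ 0 → z = 0) ∧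
      β = ext₁ δ (ofZero L) + slot₂ D S + ofZero₂ z := by
  set Ω : ℕ × μ → ℕ × μ → R := β - (1 / 2 : ℝ) • slot₂ D S₁ with hΩ
  have hΩ' : Ω = (1 / 2 : ℝ) • (β - fun a b => β b a) := by
    rw [hΩ, ← hskew]
    module
  have hb₂ := isOrderBound₂ (μ := μ) D
  have hb₃ := isOrderBound₃ (μ := μ) D
  have halt : ∀ a b, Ω a b = -Ω b a := by
    intro a b
    rw [hΩ']
    simp only [Pi.smul_apply, Pi.sub_apply]
    module
  have hΩb : bound₂ μ R N Ω := by
    rw [hΩ', sub_eq_add_neg, ← neg_one_smul ℝ]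
    exact hb₂.smul _ _ _ (hb₂.add _ _ _ hβ (hb₂.smul _ _ _ (bound₂_swap hβ)))
  obtain ⟨n₃, hn₃⟩ := exists_bound_cyc h hS₁
  have hd : ext₂ δ Ω = slot₃ D ((1 / 2 : ℝ) • cyc δ S₁ - S₂) := by
    rw [map_sub, map_smul, ← cyc_slot h, ← hcyc]
    have h1 : ext₂ δ Ω = -cyc δ Ω := by
      funext a b c
      simp only [ext₂, cyc, Pi.neg_apply]
      rw [halt c b, halt b a, map_neg, map_neg]
      abel
    rw [h1]
    funext a b c
    simp only [hΩ, cyc, Pi.neg_apply, Pi.sub_apply, Pi.smul_apply, map_sub, Derivation.map_smul]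
    module
  have hθb : bound₃ μ R (max n₃ n₂) ((1 / 2 : ℝ) • cyc δ S₁ - S₂) := by
    rw [sub_eq_add_neg, ← neg_one_smul ℝ]
    exact hb₃.add _ _ _ (hb₃.smul _ _ _ (hb₃.mono _ _ _ (le_max_left _ _) hn₃))
      (hb₃.smul _ _ _ (hb₃.mono _ _ _ (le_max_right _ _) hS₂))
  obtain ⟨L, n, S, z, hS, hz, hz', hpot⟩ := exists_potential h H hΩb halt hθb hd
  refine ⟨L, max n n₁, S + (1 / 2 : ℝ) • S₁, z, ?_, hz, hz', ?_⟩
  · exact hb₂.add _ _ _ (hb₂.mono _ _ _ (le_max_left _ _) hS)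
      (hb₂.smul _ _ _ (hb₂.mono _ _ _ (le_max_right _ _) hS₁))
  · have : β = Ω + (1 / 2 : ℝ) • slot₂ D S₁ := by rw [hΩ]; abel
    rw [this, hpot, map_add, map_smul]
    abel

/-- The values of a trilinear operator as a sum over all indices. -/
theorem ev₃_apply (N : ℕ) (X Y Z : μ → R) (T : ℕ × μ → ℕ × μ → ℕ × μ → R) :
    ev₃ D N X Y Z T = ∑ c ∈ box μ N, ∑ b ∈ box μ N, ∑ a ∈ box μ N,
      T c b a * ((D^[a.1]) (X a.2) * (D^[b.1]) (Y b.2) * (D^[c.1]) (Z c.2)) := by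
  rw [evStep_apply, ev_apply]
  refine Finset.sum_congr rfl fun c _ => ?_
  rw [evStep_apply, ev_apply, Finset.sum_mul]
  refine Finset.sum_congr rfl fun b _ => ?_
  rw [ev_apply, Finset.sum_mul, Finset.sum_mul]
  exact Finset.sum_congr rfl fun a _ => by ring

/-- The value of `⟨ℓ_{B,X}(Y), Z⟩`. -/
def linOpR (δ : ℕ × μ → Derivation ℝ R R) (N : ℕ) (b : ℕ → μ → μ → R) (X Y Z : μ → R) : R :=
  ∑ i, (∑ σ ∈ Finset.range N, ∑ j, ∑ e ∈ box μ N,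
    δ e (b σ i j) * (D^[σ]) (X j) * (D^[e.1]) (Y e.2)) * Z i

theorem ev₃_opT {N : ℕ} (hN : 0 < N) (δ : ℕ × μ → Derivation ℝ R R) (b : ℕ → μ → μ → R)
    (X Y Z : μ → R) : ∑ c ∈ box μ N, ∑ e ∈ box μ N, ∑ a ∈ box μ N,
      δ e (opT b c a) * ((D^[a.1]) (X a.2) * (D^[e.1]) (Y e.2) * (D^[c.1]) (Z c.2)) =
    linOpR D δ N b X Y Z := by
  rw [box, Finset.sum_product, Finset.sum_eq_single_of_mem 0 (by simpa using hN)]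
  · refine Finset.sum_congr rfl fun i _ => ?_
    rw [Finset.sum_comm, ← box, Finset.sum_mul]
    nth_rewrite 1 [box]
    rw [Finset.sum_product]
    refine Finset.sum_congr rfl fun σ _ => ?_
    rw [Finset.sum_mul]
    refine Finset.sum_congr rfl fun j _ => ?_
    rw [Finset.sum_mul]
    refine Finset.sum_congr rfl fun e _ => ?_
    simp only [opT, if_true, Function.iterate_zero_apply]
    ring
  · intro σ _ hσ
    simp [opT, hσ]

theorem ev₃_cyc {N : ℕ} (hN : 0 < N) (δ : ℕ × μ → Derivation ℝ R R) (b : ℕ → μ → μ → R)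
    (X Y Z : μ → R) : ev₃ D N X Y Z (cyc δ (opT b)) =
      linOpR D δ N b X Y Z + linOpR D δ N b Y Z X + linOpR D δ N b Z X Y := by
  rw [ev₃_apply, ← ev₃_opT D hN, ← ev₃_opT D hN, ← ev₃_opT D hN]
  simp only [cyc, add_mul, Finset.sum_add_distrib]
  congr 1
  · congr 1
    -- the slots are permuted cyclically
    rw [Finset.sum_congr rfl fun c _ => Finset.sum_comm, Finset.sum_comm]
    refine Finset.sum_congr rfl fun a _ => Finset.sum_congr rfl fun c _ =>
      Finset.sum_congr rfl fun b _ => by ring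
  · rw [Finset.sum_comm]
    refine Finset.sum_congr rfl fun b _ => ?_
    rw [Finset.sum_comm]
    refine Finset.sum_congr rfl fun a _ => Finset.sum_congr rfl fun c _ => by ring

theorem linOpR_sympR [DecidableEq μ] (N : ℕ) {K : Matrix μ μ ℝ} (hK : K.IsSymm)
    (δ : ℕ × μ → Derivation ℝ R R) (a : ℕ → μ → μ → R) (X Y Z : μ → R) :
    linOpR D δ N (sympR K a) X Y Z = -linOpR D δ N a (mulR K⁻¹ X) Y (mulR K⁻¹ Z) := by
  simp only [linOpR, sympR, mulR, Finset.mul_sum, neg_mul, map_neg, map_sum,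
    Derivation.map_smul, Finset.sum_neg_distrib, Finset.sum_mul, iterate_sum, iterate_smul]
  congr 1
  rw [Finset.sum_comm (s := Finset.univ) (t := Finset.range N)]
  simp only [Finset.sum_comm (s := Finset.univ) (t := Finset.range N)]
  refine Finset.sum_congr rfl fun σ _ => ?_
  conv_rhs => rw [Finset.sum_comm]
  refine Finset.sum_congr rfl fun i _ => ?_
  conv_rhs => rw [Finset.sum_congr rfl fun r _ => Finset.sum_comm, Finset.sum_comm]
  rw [Finset.sum_comm]
  refine Finset.sum_congr rfl fun e _ => ?_
  rw [Finset.sum_comm]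
  refine Finset.sum_congr rfl fun r _ => ?_
  rw [Finset.sum_comm]
  refine Finset.sum_congr rfl fun s _ => Finset.sum_congr rfl fun j _ => ?_
  rw [inv_apply_comm hK i r]
  simp only [Algebra.smul_def, map_mul]
  ring

/-- The linearization with respect to `φ`, where `u = φ_x`. -/
theorem linOpR_pr {N : ℕ} (δ : ℕ × μ → Derivation ℝ R R) {b : ℕ → μ → μ → R}
    (hb : ∀ σ i j, OrderLT N fun e => δ e (b σ i j)) (X Y Z : μ → R) :
    linOpR D (pr δ) (N + 1) b X Y Z = linOpR D δ (N + 1) b X (fun i => D (Y i)) Z := by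
  unfold linOpR
  refine Finset.sum_congr rfl fun i _ => ?_
  congr 1
  refine Finset.sum_congr rfl fun σ _ => Finset.sum_congr rfl fun j _ => ?_
  rw [box, Finset.sum_product, Finset.sum_product, Finset.sum_range_succ', Finset.sum_range_succ]
  have h0 : ∑ k, pr δ (0, k) (b σ i j) * (D^[σ]) (X j) * (D^[0]) (Y k) = 0 := by simp
  have h1 : ∑ k, δ (N, k) (b σ i j) * (D^[σ]) (X j) * (D^[N]) (D (Y k)) = 0 := by
    refine Finset.sum_eq_zero fun k _ => ?_
    rw [show δ (N, k) (b σ i j) = 0 from hb σ i j (N, k) le_rfl, zero_mul, zero_mul]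
  rw [h0, h1]
  simp only [pr_succ, Function.iterate_succ_apply]

end Operators

/-! ### Functions on jets and the ring elements they represent -/

section Representation

open TopologicalSpace DF

variable {κ : Type*} {V : Opens (ℕ × κ → ℝ)}

/-- The function `f` on jets represents the element `f'` of the ring of differential functions. -/
def Rep (f : (ℕ × κ → ℝ) → ℝ) (f' : DF V) : Prop := ∀ p ∈ V, f p = f'.ex p

namespace Rep

variable {f g : (ℕ × κ → ℝ) → ℝ} {f' g' : DF V}

theorem ex (f' : DF V) : Rep f'.ex f' := fun _ _ => rfl

theorem mk (hf : IsDiffFun (V : Set (ℕ × κ → ℝ)) f) : Rep f (DF.mk f hf) :=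
  fun _ hp => (ex_mk hf hp).symm

theorem eq (hf : Rep f f') (hg : Rep f g') : f' = g' :=
  ext_ex fun p hp => by rw [← hf p hp, hg p hp]

theorem add (hf : Rep f f') (hg : Rep g g') : Rep (fun p => f p + g p) (f' + g') :=
  fun p hp => by beta_reduce; rw [ex_add _ _ hp, hf p hp, hg p hp]

theorem sub (hf : Rep f f') (hg : Rep g g') : Rep (fun p => f p - g p) (f' - g') :=
  fun p hp => by beta_reduce; rw [ex_sub _ _ hp, hf p hp, hg p hp]

theorem neg (hf : Rep f f') : Rep (fun p => -f p) (-f') :=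
  fun p hp => by beta_reduce; rw [ex_neg _ hp, hf p hp]

theorem mul (hf : Rep f f') (hg : Rep g g') : Rep (fun p => f p * g p) (f' * g') :=
  fun p hp => by beta_reduce; rw [ex_mul _ _ hp, hf p hp, hg p hp]

theorem const_mul (c : ℝ) (hf : Rep f f') : Rep (fun p => c * f p) (c • f') :=
  fun p hp => by beta_reduce; rw [ex_smul _ _ hp, hf p hp]

theorem zero : Rep (fun _ => 0) (0 : DF V) := fun _ hp => (ex_zero hp).symm

theorem sum {α : Type*} (s : Finset α) {F : α → (ℕ × κ → ℝ) → ℝ} {F' : α → DF V}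
    (h : ∀ a ∈ s, Rep (F a) (F' a)) : Rep (fun p => ∑ a ∈ s, F a p) (∑ a ∈ s, F' a) :=
  fun p hp => by
    rw [ex_sum _ _ hp]
    exact Finset.sum_congr rfl fun a ha => h a ha p hp

theorem neg_one_pow_mul (k : ℕ) (hf : Rep f f') :
    Rep (fun p => (-1) ^ k * f p) ((-1) ^ k * f') := by
  have : (-1 : DF V) ^ k * f' = ((-1 : ℝ) ^ k) • f' := by
    rw [Algebra.smul_def]; simp
  rw [this]
  exact hf.const_mul _

theorem pull {ι' : Type*} {W : Opens (ℕ × ι' → ℝ)} {e : ℕ × κ → ℕ × ι'}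
    (he : ∀ p ∈ W, p ∘ e ∈ V) (hf : Rep f f') : Rep (fun p => f (p ∘ e)) (DF.pull e he f') :=
  fun p hp => by beta_reduce; rw [ex_pull he _ hp, hf _ (he p hp)]

theorem finsum {α : Type*} {F : α → (ℕ × κ → ℝ) → ℝ} {F' : α → DF V} (h : ∀ a, Rep (F a) (F' a))
    {s : Finset α} (h0 : ∀ a ∉ s, F' a = 0) : Rep (fun p => ∑ᶠ a, F a p) (∑ a ∈ s, F' a) := by
  intro p hp
  beta_reduce
  rw [ex_sum _ _ hp, finsum_eq_sum_of_support_subset (s := s)]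
  · exact Finset.sum_congr rfl fun a _ => h a p hp
  · intro a ha
    by_contra hn
    refine ha ?_
    beta_reduce
    rw [h a p hp, h0 a (by simpa using hn), ex_zero hp]

theorem finsum_range {F : ℕ → (ℕ × κ → ℝ) → ℝ} {F' : ℕ → DF V} (h : ∀ σ, Rep (F σ) (F' σ)) {N : ℕ}
    (h0 : ∀ σ, N ≤ σ → F' σ = 0) : Rep (fun p => ∑ᶠ σ, F σ p) (∑ σ ∈ Finset.range N, F' σ) :=
  finsum h fun σ hσ => h0 σ (by simpa using hσ)

theorem finsum_box {μ : Type*} [Fintype μ] {F : ℕ × μ → (ℕ × κ → ℝ) → ℝ} {F' : ℕ × μ → DF V}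
    (h : ∀ a, Rep (F a) (F' a)) {N : ℕ} (h0 : OrderLT N F') :
    Rep (fun p => ∑ᶠ a, F a p) (∑ a ∈ box μ N, F' a) :=
  finsum h fun a ha => h0 a (by simpa [mem_box] using ha)

variable [DecidableEq κ]

theorem pd (hf : Rep f f') (a : ℕ × κ) : Rep (pd a f) (pdR a f') :=
  fun p hp => by rw [ex_pdR _ _ hp, pd_congr V.isOpen hf a hp]

theorem iter (hf : Rep f f') (k : ℕ) : Rep ((totalD suc)^[k] f) ((D V)^[k] f') :=
  fun _ hp => ex_iterate_tdR suc f' hf k hp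

end Rep

variable {n : ℕ}

/-- The family `b` gives the coefficients of the operator `A`, whose order is less than `N`. -/
structure RepOp (A : MatDiffOp (ℕ × κ) n) (N : ℕ) (b : ℕ → Fin n → Fin n → DF V) : Prop where
  order : A.order < N
  coeff : ∀ σ ≤ A.order, ∀ i j, Rep (A.coeff σ i j) (b σ i j)
  zero : ∀ σ, A.order < σ → b σ = 0

theorem RepOp.mono {A : MatDiffOp (ℕ × κ) n} {N N' : ℕ} {b : ℕ → Fin n → Fin n → DF V}
    (hA : RepOp A N b) (h : N ≤ N') : RepOp A N' b :=
  ⟨hA.order.trans_le h, hA.coeff, hA.zero⟩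

theorem RepOp.sum {A : MatDiffOp (ℕ × κ) n} {N : ℕ} {b : ℕ → Fin n → Fin n → DF V}
    (hA : RepOp A N b) {F : ℕ → (ℕ × κ → ℝ) → ℝ} {F' : ℕ → DF V}
    (h : ∀ σ ≤ A.order, Rep (F σ) (F' σ)) (h0 : ∀ σ, A.order < σ → F' σ = 0) :
    Rep (fun p => ∑ σ ∈ Finset.range (A.order + 1), F σ p) (∑ σ ∈ Finset.range N, F' σ) := by
  have : ∑ σ ∈ Finset.range N, F' σ = ∑ σ ∈ Finset.range (A.order + 1), F' σ := by
    symm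
    refine Finset.sum_subset (Finset.range_subset_range.2 hA.order) fun σ _ hσ => h0 σ ?_
    simp only [Finset.mem_range] at hσ; omega
  rw [this]
  exact Rep.sum _ fun σ hσ => h σ (by simp only [Finset.mem_range] at hσ; omega)

variable [DecidableEq κ]

theorem RepOp.act {A : MatDiffOp (ℕ × κ) n} {N : ℕ} {b : ℕ → Fin n → Fin n → DF V}
    (hA : RepOp A N b) {X : Fin n → (ℕ × κ → ℝ) → ℝ} {X' : Fin n → DF V}
    (hX : ∀ i, Rep (X i) (X' i)) (i : Fin n) :
    Rep (A.act (totalD suc) X i) (actR (D V) N b X' i) :=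
  hA.sum (fun σ hσ => Rep.sum _ fun j _ => (hA.coeff σ hσ i j).mul ((hX j).iter σ))
    fun σ hσ => by simp [hA.zero σ hσ]

section OneVariable

variable {V : Opens (Jet n)}

theorem RepOp.adjAct {A : MatDiffOp (ℕ × Fin n) n} {N : ℕ} {b : ℕ → Fin n → Fin n → DF V}
    (hA : RepOp A N b) {X : Fin n → Jet n → ℝ} {X' : Fin n → DF V}
    (hX : ∀ i, Rep (X i) (X' i)) (i : Fin n) :
    Rep (adjAct A X i) (adjR (D V) N b X' i) :=
  hA.sum (fun σ hσ => ((Rep.sum _ fun j _ => (hA.coeff σ hσ j i).mul (hX j)).iter σ).neg_one_pow_mul σ)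
    fun σ hσ => by simp [hA.zero σ hσ, iterate_map_zero]

theorem Rep.lin {F X : Fin n → Jet n → ℝ} {F' X' : Fin n → DF V} (hF : ∀ i, Rep (F i) (F' i))
    (hX : ∀ i, Rep (X i) (X' i)) {N : ℕ} (hN : ∀ i, OrderLT N fun a => pdR a (F' i)) (k : Fin n) :
    Rep (lin F X k) (linR (D V) pdR N F' X' k) :=
  Rep.finsum_box (fun a => ((hF k).pd a).mul ((hX a.2).iter a.1)) fun a ha => by
    beta_reduce
    rw [show pdR a (F' k) = 0 from hN k a ha, zero_mul]

theorem Rep.linAdj {F X : Fin n → Jet n → ℝ} {F' X' : Fin n → DF V} (hF : ∀ i, Rep (F i) (F' i))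
    (hX : ∀ i, Rep (X i) (X' i)) {N : ℕ} (hN : ∀ i, OrderLT N fun a => pdR a (F' i)) (i : Fin n) :
    Rep (linAdj F X i) (linAdjR (D V) pdR N F' X' i) :=
  Rep.finsum_range (fun σ => ((Rep.sum _ fun k _ =>
    ((hF k).pd (σ, i)).mul (hX k)).iter σ).neg_one_pow_mul σ) fun σ hσ => by
    rw [Finset.sum_eq_zero fun k _ => by rw [show pdR (σ, i) (F' k) = 0 from hN k (σ, i) hσ, zero_mul], iterate_map_zero, mul_zero]

theorem RepOp.linOp {A : MatDiffOp (ℕ × Fin n) n} {N : ℕ} {b : ℕ → Fin n → Fin n → DF V}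
    (hA : RepOp A N b) (hN : ∀ σ i j, OrderLT N fun a => pdR a (b σ i j))
    {X Y Z : Fin n → Jet n → ℝ} {X' Y' Z' : Fin n → DF V}
    (hX : ∀ i, Rep (X i) (X' i)) (hY : ∀ i, Rep (Y i) (Y' i)) (hZ : ∀ i, Rep (Z i) (Z' i)) :
    Rep (pair (linOp A X Y) Z) (linOpR (D V) pdR N b X' Y' Z') :=
  Rep.sum _ fun i _ => Rep.mul (hA.sum (fun σ hσ => Rep.sum _ fun j _ => Rep.finsum_box
      (fun a => (((hA.coeff σ hσ i j).pd a).mul ((hX j).iter σ)).mul ((hY a.2).iter a.1))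
      fun a ha => by
        beta_reduce
        rw [show pdR a (b σ i j) = 0 from hN σ i j a ha, zero_mul, zero_mul])
    fun σ hσ => by simp [hA.zero σ hσ]) (hZ i)

theorem isTrivialDensity_iff {f : Jet n → ℝ} {f' : DF V} (hf : Rep f f') :
    IsTrivialDensity (V : Set (Jet n)) f ↔ IsTrivial f' := by
  constructor
  · intro h p hp
    obtain ⟨W, hW, hpW, hWV, g, hg, hfg⟩ := h p hp
    have hWV' : (⟨W, hW⟩ : Opens (Jet n)) ≤ V := hWV
    refine ⟨⟨W, hW⟩, hWV', hpW, DF.mk g hg, ext_ex fun q hq => ?_⟩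
    rw [ex_res hWV' _ hq, ← hf q (hWV hq), hfg q hq]
    exact Rep.iter (Rep.mk hg) 1 q hq
  · intro h p hp
    obtain ⟨W, hWV, hpW, g, hg⟩ := h p hp
    refine ⟨W, W.isOpen, hpW, hWV, g.ex, g.isDiffFun_ex, fun q hq => ?_⟩
    rw [hf q (hWV hq), ← ex_res hWV _ hq, hg]
    exact ((Rep.ex g).iter 1 q hq).symm

/-- The coefficients of an operator as elements of the ring of differential functions. -/
noncomputable def coefR {A : MatDiffOp (ℕ × Fin n) n} (hA : A.IsSmoothOn (V : Set (Jet n)))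
    (σ : ℕ) (i j : Fin n) : DF V :=
  if h : σ ≤ A.order then DF.mk (A.coeff σ i j) (hA σ h i j) else 0

theorem repOp_coefR {A : MatDiffOp (ℕ × Fin n) n} (hA : A.IsSmoothOn (V : Set (Jet n))) :
    RepOp A (A.order + 1) (coefR hA) where
  order := Nat.lt_succ_self _
  coeff σ hσ i j := by
    unfold coefR
    rw [dif_pos hσ]
    exact Rep.mk _
  zero σ hσ := by
    funext i j
    unfold coefR
    rw [dif_neg (by omega)]
    rfl

/-- The potential substitution on the rings of differential functions. -/
def shiftHom {U W : Opens (Jet n)} (h : ∀ p ∈ W, shift p ∈ U) : DF U →ₐ[ℝ] DF W :=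
  DF.pull suc h

theorem suc_injective : Function.Injective (suc : ℕ × Fin n → ℕ × Fin n) := by
  rintro ⟨σ, i⟩ ⟨τ, j⟩ h
  simpa [suc] using h

theorem D_shiftHom {U W : Opens (Jet n)} (h : ∀ p ∈ W, shift p ∈ U) (f : DF U) :
    D W (shiftHom h f) = shiftHom h (D U f) :=
  tdR_pull (s := suc) (t := suc) h suc_injective (fun _ => rfl) f

theorem pdR_shiftHom {U W : Opens (Jet n)} (h : ∀ p ∈ W, shift p ∈ U) (a : ℕ × Fin n) (f : DF U) :
    pdR a (shiftHom h f) = shiftHom h (pr pdR a f) := by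
  rcases a with ⟨_ | σ, i⟩
  · rw [pr_zero, Derivation.zero_apply, map_zero]
    refine pdR_pull_of_notMem h ?_ f
    rintro ⟨b, hb⟩
    simp at hb
  · exact pdR_pull h suc_injective (σ, i) f

theorem Rep.shift {U W : Opens (Jet n)} (h : ∀ p ∈ W, shift p ∈ U) {f : Jet n → ℝ} {f' : DF U}
    (hf : Rep f f') : Rep (f ∘ shift) (shiftHom h f') := Rep.pull h hf

theorem map_sympR {R R' : Type*} [CommRing R] [Algebra ℝ R] [CommRing R'] [Algebra ℝ R']
    (π : R →ₐ[ℝ] R') (K : Matrix (Fin n) (Fin n) ℝ) (a : ℕ → Fin n → Fin n → R) (σ : ℕ)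
    (i j : Fin n) : π (sympR K a σ i j) = sympR K (fun σ i j => π (a σ i j)) σ i j := by
  simp only [sympR, map_neg, map_sum, map_smul]

theorem RepOp.shift {U W : Opens (Jet n)} (h : ∀ p ∈ W, JetCalc.shift p ∈ U)
    {A : MatDiffOp (ℕ × Fin n) n} {N : ℕ} {a : ℕ → Fin n → Fin n → DF U} (hA : RepOp A N a) :
    RepOp (A.pullback JetCalc.shift) N fun σ i j => shiftHom h (a σ i j) where
  order := hA.order
  coeff σ hσ i j := (hA.coeff σ hσ i j).shift h
  zero σ hσ := by
    funext i j
    simp [hA.zero σ hσ]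

theorem RepOp.sympOp {W : Opens (Jet n)} (K : Matrix (Fin n) (Fin n) ℝ)
    {A : MatDiffOp (ℕ × Fin n) n} {N : ℕ} {a : ℕ → Fin n → Fin n → DF W}
    (hA : RepOp (A.pullback JetCalc.shift) N a) : RepOp (sympOp K A) N (sympR K a) where
  order := hA.order
  coeff σ hσ i j := by
    have h1 : Rep (fun p => -∑ r, ∑ s, (K⁻¹ i r * K⁻¹ s j) * A.coeff σ r s (JetCalc.shift p))
        (sympR K a σ i j) :=
      (Rep.sum _ fun r _ => Rep.sum _ fun s _ => (hA.coeff σ hσ r s).const_mul _).neg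
    refine fun p hp => Eq.trans ?_ (h1 p hp)
    simp only [JetCalc.sympOp]
    congr 1
    exact Finset.sum_congr rfl fun r _ => Finset.sum_congr rfl fun s _ => by ring
  zero σ hσ := by
    funext i j
    simp [sympR, hA.zero σ hσ]

theorem Rep.matAct {X : Fin n → Jet n → ℝ} {X' : Fin n → DF V} (K : Matrix (Fin n) (Fin n) ℝ)
    (hX : ∀ i, Rep (X i) (X' i)) (i : Fin n) : Rep (matAct K X i) (mulR K X' i) :=
  Rep.sum _ fun j _ => (hX j).const_mul _

theorem Rep.constOp_act {X : Fin n → Jet n → ℝ} {X' : Fin n → DF V}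
    (K : Matrix (Fin n) (Fin n) ℝ) (hX : ∀ i, Rep (X i) (X' i)) (i : Fin n) :
    Rep ((constOp K).act Dx X i) (mulR K (fun j => D V (X' j)) i) := by
  refine fun p hp => Eq.trans ?_ (Rep.matAct K (fun j => (hX j).iter 1) i p hp)
  simp [MatDiffOp.act, constOp, JetCalc.matAct, Dx]
  rfl

theorem linOp_constOp (K : Matrix (Fin n) (Fin n) ℝ) (X Y : Fin n → Jet n → ℝ) (i : Fin n)
    (p : Jet n) : linOp (constOp K) X Y i p = 0 := by
  simp [linOp, constOp, pd]

end OneVariable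

end Representation

/-! ### Skew-adjointness and closedness of `-M A M` -/

section SymplecticOperator

open TopologicalSpace DF

variable {n : ℕ} {U V : Opens (Jet n)}

theorem exists_rep {X : Fin n → Jet n → ℝ} (hX : IsDiffVec (V : Set (Jet n)) X) :
    ∃ X' : Fin n → DF V, ∀ i, Rep (X i) (X' i) :=
  ⟨fun i => DF.mk (X i) (hX i), fun i => Rep.mk (hX i)⟩

theorem isDiffVec_ex (X : Fin n → DF V) : IsDiffVec (V : Set (Jet n)) fun i => (X i).ex :=
  fun i => (X i).isDiffFun_ex

theorem isSkewAdjoint_iff {A : MatDiffOp (ℕ × Fin n) n} {N : ℕ} {b : ℕ → Fin n → Fin n → DF V}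
    (hA : RepOp A N b) : IsSkewAdjoint (V : Set (Jet n)) A ↔
      ∀ X, actR (D V) N b X + adjR (D V) N b X = 0 := by
  constructor
  · intro h X
    have hX := fun i => Rep.ex (X i)
    funext i
    refine ((hA.act hX i).add (hA.adjAct hX i)).eq fun p hp => ?_
    beta_reduce
    rw [h _ (isDiffVec_ex X) p hp i, Pi.zero_apply, ex_zero hp]
    exact add_neg_cancel _
  · intro h X hX p hp i
    obtain ⟨X', hX'⟩ := exists_rep hX
    have h1 := ((hA.act hX' i).add (hA.adjAct hX' i)) p hp
    have h2 : actR (D V) N b X' i + adjR (D V) N b X' i = 0 := congrFun (h X') i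
    rw [h2, ex_zero hp] at h1
    exact eq_neg_of_add_eq_zero_right h1

theorem isPotential_iff {B : MatDiffOp (ℕ × Fin n) n} {N : ℕ} {b : ℕ → Fin n → Fin n → DF V}
    (hB : RepOp B N b) {L : Fin n → Jet n → ℝ} {L' : Fin n → DF V} (hL : ∀ i, Rep (L i) (L' i))
    (hN : ∀ i, OrderLT N fun a => pdR a (L' i)) : IsPotential (V : Set (Jet n)) (-L) B ↔
      ∀ X, actR (D V) N b X = linAdjR (D V) pdR N L' X - linR (D V) pdR N L' X := by
  have hL' : ∀ i, Rep ((-L) i) ((-L') i) := fun i => (hL i).neg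
  have hN' : ∀ i, OrderLT N fun a => pdR a ((-L') i) := fun i a ha => by
    show pdR a (-L' i) = 0
    rw [map_neg, show pdR a (L' i) = 0 from hN i a ha, neg_zero]
  have h1 : ∀ X i, linR (D V) pdR N (-L') X i - linAdjR (D V) pdR N (-L') X i =
      linAdjR (D V) pdR N L' X i - linR (D V) pdR N L' X i := by
    intro X i
    simp only [linR, linAdjR, ev_apply, Pi.neg_apply, map_neg, neg_mul, Finset.sum_neg_distrib,
      iterate_map_neg, mul_neg]
    ring
  constructor
  · intro h X
    have hX := fun i => Rep.ex (X i)
    funext i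
    rw [Pi.sub_apply, ← h1]
    exact (hB.act hX i).eq fun p hp => (h _ (isDiffVec_ex X) p hp i).trans
      (((Rep.lin hL' hX hN' i).sub (Rep.linAdj hL' hX hN' i)) p hp)
  · intro h X hX p hp i
    obtain ⟨X', hX'⟩ := exists_rep hX
    refine (hB.act hX' i p hp).trans ?_
    rw [h, Pi.sub_apply, ← h1]
    exact (((Rep.lin hL' hX' hN' i).sub (Rep.linAdj hL' hX' hN' i)) p hp).symm

theorem RepOp.bound_opT {A : MatDiffOp (ℕ × Fin n) n} {N : ℕ} {b : ℕ → Fin n → Fin n → DF V}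
    (hA : RepOp A N b) : bound₂ (Fin n) (DF V) N (opT b) :=
  JetCalc.bound_opT fun σ hσ => hA.zero σ (hA.order.trans_le hσ)

theorem exists_orderLT {N : ℕ} {b : ℕ → Fin n → Fin n → DF V}
    (hb : bound₂ (Fin n) (DF V) N (opT b)) : ∃ N', ∀ σ i j, OrderLT N' fun a => pdR a (b σ i j) := by
  obtain ⟨L, hL⟩ := isJetDerivation_pdR.exists_order₂ hb
  exact ⟨L, fun σ i j a ha => by simpa [opT] using hL (0, i) (σ, j) a ha⟩

/-- Skew-adjointness of `A` makes the symmetric part of `⟨M A M X, Y⟩` a total derivative. -/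
theorem exists_slot₂_of_isSkewAdjoint {K : Matrix (Fin n) (Fin n) ℝ} (hK : K.IsSymm)
    {A : MatDiffOp (ℕ × Fin n) n} {N : ℕ} {a : ℕ → Fin n → Fin n → DF U} (hA : RepOp A N a)
    (h : IsSkewAdjoint (U : Set (Jet n)) A) : ∃ m S, bound₂ (Fin n) (DF U) m S ∧
      opT (sympR K a) + (fun c e => opT (sympR K a) e c) = slot₂ (D U) S := by
  have hb : bound₂ (Fin n) (DF U) N (opT (sympR K a)) := JetCalc.bound_opT fun σ hσ => by
    funext i j
    simp [sympR, hA.zero σ (hA.order.trans_le hσ)]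
  have hN : 0 < N := (Nat.zero_le _).trans_lt hA.order
  refine exists_eq_slot₂ (faithful (fun i : Fin n => i))
    ((isOrderBound₂ (D U)).add _ _ _ hb (bound₂_swap hb)) fun X => ?_
  rw [red₂_add, red₂_opT _ hN, red₂_opT_swap _ hN, actR_sympR, adjR_sympR _ _ hK, ← neg_add]
  have h1 := (isSkewAdjoint_iff hA).1 h (mulR K⁻¹ X)
  funext i
  simp only [Pi.neg_apply, Pi.add_apply, mulR, ← Finset.sum_add_distrib, ← smul_add]
  rw [Finset.sum_eq_zero fun j _ => ?_]
  · simp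
  · rw [show actR (D U) N a (mulR K⁻¹ X) j + adjR (D U) N a (mulR K⁻¹ X) j = 0 from congrFun h1 j,
      smul_zero]

theorem DF.IsTrivial.neg {f : DF V} (hf : IsTrivial f) : IsTrivial (-f) := by
  intro p hp
  obtain ⟨W, h, hpW, g, hg⟩ := hf p hp
  exact ⟨W, h, hpW, -g, by rw [map_neg, map_neg, hg]⟩

theorem mulR_inv_mulR {R : Type*} [CommRing R] [Algebra ℝ R] {K : Matrix (Fin n) (Fin n) ℝ}
    (hK : IsUnit K.det) (X : Fin n → R) : mulR K⁻¹ (mulR K X) = X := by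
  rw [mulR_mulR, Matrix.nonsing_inv_mul K hK, mulR_one]

theorem mulR_mulR_inv {R : Type*} [CommRing R] [Algebra ℝ R] {K : Matrix (Fin n) (Fin n) ℝ}
    (hK : IsUnit K.det) (X : Fin n → R) : mulR K (mulR K⁻¹ X) = X := by
  rw [mulR_mulR, Matrix.mul_nonsing_inv K hK, mulR_one]

/-- Compatibility of `A` with `K ∂_x` says that `-M A M` is closed: `K ∂_x M X = ∂_x X`, so that the
linearization of `A` along `K ∂_x M X` is the linearization along the field `X` in the potentials. -/
theorem exists_slot₃_of_schoutenVanishes {K : Matrix (Fin n) (Fin n) ℝ} (hK : K.IsSymm)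
    (hdet : IsUnit K.det) {A : MatDiffOp (ℕ × Fin n) n} {N : ℕ} {a : ℕ → Fin n → Fin n → DF U}
    (hA : RepOp A N a) (h : SchoutenVanishes (U : Set (Jet n)) (constOp K) A) :
    ∃ m S, bound₃ (Fin n) (DF U) m S ∧
      cyc (pr pdR) (opT (sympR K a)) = slot₃ (D U) S := by
  have hb : bound₂ (Fin n) (DF U) N (opT (sympR K a)) := JetCalc.bound_opT fun σ hσ => by
    funext i j
    simp [sympR, hA.zero σ (hA.order.trans_le hσ)]
  obtain ⟨m₁, hm₁⟩ := exists_bound_cyc isJetDerivation_pr_pdR hb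
  obtain ⟨m₂, hm₂⟩ := exists_orderLT hb
  obtain ⟨m₃, hm₃⟩ := exists_orderLT hA.bound_opT
  obtain ⟨m, hm⟩ : ∃ m, m = max (max N m₁) (max m₂ m₃) := ⟨_, rfl⟩
  have hA' : RepOp A (m + 1) a := hA.mono (by omega)
  refine exists_eq_slot₃ (faithful (fun i : Fin n => i)) IsTrivial (fun f g hf => hf.add)
    (eq_zero_of_isTrivial fun i : Fin n => i) (N := m + 1)
    ((isOrderBound₃ (D U)).mono _ _ _ (by omega) hm₁) fun X Y Z => ?_
  have key : ∀ X Y Z : Fin n → DF U, Rep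
      (pair (linOp A (fun i => (mulR K⁻¹ X i).ex)
        ((constOp K).act Dx fun i => (mulR K⁻¹ Y i).ex)) fun i => (mulR K⁻¹ Z i).ex)
      (-linOpR (D U) (pr pdR) (m + 1) (sympR K a) X Y Z) := by
    intro X Y Z
    rw [linOpR_pr _ _ fun σ i j e he => hm₂ σ i j e (by omega), linOpR_sympR _ _ hK, neg_neg]
    refine hA'.linOp (fun σ i j e he => hm₃ σ i j e (by omega)) (fun i => Rep.ex _) (fun i => ?_)
      fun i => Rep.ex _
    have h1 := Rep.constOp_act K (fun i => Rep.ex (mulR K⁻¹ Y i)) i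
    have h2 : (fun j => D U (mulR K⁻¹ Y j)) = mulR K⁻¹ fun j => D U (Y j) := by
      funext j
      simp only [mulR, map_sum, Derivation.map_smul]
    rwa [h2, mulR_mulR_inv hdet] at h1
  have h0 : ∀ X Y Z : Fin n → Jet n → ℝ, pair (linOp (constOp K) X Y) Z = 0 := by
    intro X Y Z
    funext p
    simp [pair, linOp_constOp]
  have h1 := h _ _ _ (isDiffVec_ex (mulR K⁻¹ X)) (isDiffVec_ex (mulR K⁻¹ Y))
    (isDiffVec_ex (mulR K⁻¹ Z))
  simp only [cyclicBracket, h0, zero_add] at h1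
  have h2 := (isTrivialDensity_iff (((key X Y Z).add (key Y Z X)).add (key Z X Y))).1 h1
  rw [ev₃_cyc _ (by omega)]
  convert h2.neg using 1
  ring

end SymplecticOperator

/-! ### Closed operators and their potentials -/

section ClosedForms

variable {μ R R' : Type*} [CommRing R] [Algebra ℝ R] [CommRing R'] [Algebra ℝ R']

/-- The bilinear operator `β` is skew-adjoint and closed as a variational two-form. -/
def IsClosedSkew (D : Derivation ℝ R R) (δ : ℕ × μ → Derivation ℝ R R)
    (β : ℕ × μ → ℕ × μ → R) : Prop :=
  (∃ m S, bound₂ μ R m S ∧ β + (fun a b => β b a) = slot₂ D S) ∧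
    ∃ m S, bound₃ μ R m S ∧ cyc δ β = slot₃ D S

theorem IsClosedSkew.map {D : Derivation ℝ R R} {D' : Derivation ℝ R' R'}
    {δ : ℕ × μ → Derivation ℝ R R} {δ' : ℕ × μ → Derivation ℝ R' R'} (π : R →ₐ[ℝ] R')
    (hπ : ∀ f, D' (π f) = π (D f)) (hδ : ∀ a f, δ' a (π f) = π (δ a f)) {β : ℕ × μ → ℕ × μ → R}
    (h : IsClosedSkew D δ β) : IsClosedSkew D' δ' fun a b => π (β a b) := by
  obtain ⟨⟨m₁, S₁, hS₁, h₁⟩, m₂, S₂, hS₂, h₂⟩ := h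
  refine ⟨⟨m₁, fun a b => π (S₁ a b), bound₂_iff.2 fun a b hab => ?_, ?_⟩,
    m₂, fun a b c => π (S₂ a b c), bound₃_iff.2 fun a b c habc => ?_, ?_⟩
  · rw [bound₂_iff.1 hS₁ a b hab, map_zero]
  · rw [← map_slot₂ π hπ, ← h₁]
    funext a b
    exact (map_add π _ _).symm
  · rw [bound₃_iff.1 hS₂ a b c habc, map_zero]
  · rw [← map_slot₃ π hπ, ← h₂]
    funext a b c
    simp only [cyc, hδ, map_add]

theorem map_opT (π : R →ₐ[ℝ] R') (b : ℕ → μ → μ → R) :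
    (fun c a => π (opT b c a)) = opT fun σ i j => π (b σ i j) := by
  funext c a
  simp only [opT]
  split_ifs
  · rfl
  · exact map_zero π

theorem map_ext₁_ofZero (π : R →ₐ[ℝ] R') {δ : ℕ × μ → Derivation ℝ R R}
    {δ' : ℕ × μ → Derivation ℝ R' R'} (hδ : ∀ a f, δ' a (π f) = π (δ a f)) (L : μ → R) :
    (fun c a => π (ext₁ δ (ofZero L) c a)) = ext₁ δ' (ofZero fun i => π (L i)) := by
  have h : ∀ c, ofZero (fun i => π (L i)) c = π (ofZero L c) := by
    intro c
    unfold ofZero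
    split_ifs
    · rfl
    · exact (map_zero π).symm
  funext c a
  simp only [ext₁, h, hδ, map_sub]

variable [Fintype μ] (D : Derivation ℝ R R)

theorem linR_pr {δ : ℕ × μ → Derivation ℝ R R} {N : ℕ} {L : μ → R}
    (hL : ∀ i, OrderLT N fun a => δ a (L i)) (X : μ → R) :
    linR D (pr δ) (N + 1) L X = linR D δ (N + 1) L fun i => D (X i) := by
  funext i
  simp only [linR, ev_apply]
  rw [box, Finset.sum_product, Finset.sum_product, Finset.sum_range_succ', Finset.sum_range_succ]
  have h0 : ∑ k, pr δ (0, k) (L i) * (D^[0]) (X k) = 0 := by simp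
  have h1 : ∑ k, δ (N, k) (L i) * (D^[N]) (D (X k)) = 0 := by
    refine Finset.sum_eq_zero fun k _ => ?_
    rw [show δ (N, k) (L i) = 0 from hL i (N, k) le_rfl, zero_mul]
  rw [h0, h1]
  simp only [pr_succ, Function.iterate_succ_apply]

theorem linAdjR_pr {δ : ℕ × μ → Derivation ℝ R R} {N : ℕ} {L : μ → R}
    (hL : ∀ i, OrderLT N fun a => δ a (L i)) (X : μ → R) (i : μ) :
    linAdjR D (pr δ) (N + 1) L X i = -D (linAdjR D δ (N + 1) L X i) := by
  simp only [linAdjR]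
  rw [Finset.sum_range_succ', Finset.sum_range_succ]
  have h0 : ∑ k, pr δ (0, i) (L k) * X k = 0 := by simp
  have h1 : ∑ k, δ (N, i) (L k) * X k = 0 := by
    refine Finset.sum_eq_zero fun k _ => ?_
    rw [show δ (N, i) (L k) = 0 from hL k (N, i) le_rfl, zero_mul]
  rw [h0, h1, iterate_map_zero, iterate_map_zero, mul_zero, mul_zero, add_zero, add_zero, map_sum,
    ← Finset.sum_neg_distrib]
  refine Finset.sum_congr rfl fun σ _ => ?_
  rw [Derivation.leibniz, ← Function.iterate_succ_apply' D]
  have h2 : D ((-1 : R) ^ σ) = 0 := by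
    rw [show (-1 : R) ^ σ = algebraMap ℝ R ((-1) ^ σ) by simp, Derivation.map_algebraMap]
  rw [h2, smul_zero, add_zero, smul_eq_mul, pow_succ]
  simp only [pr_succ]
  ring

theorem linR_mulR (δ : ℕ × μ → Derivation ℝ R R) (N : ℕ) (K : Matrix μ μ ℝ) (L X : μ → R) :
    linR D δ N (mulR K L) X = mulR K (linR D δ N L X) := by
  funext i
  simp only [linR, mulR, ev_apply, map_sum, Derivation.map_smul, Finset.smul_sum, Finset.sum_mul,
    smul_mul_assoc]
  exact Finset.sum_comm

theorem linAdjR_mulR (δ : ℕ × μ → Derivation ℝ R R) (N : ℕ) {K : Matrix μ μ ℝ} (hK : K.IsSymm)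
    (L X : μ → R) : linAdjR D δ N (mulR K L) X = linAdjR D δ N L (mulR K X) := by
  funext i
  simp only [linAdjR, mulR, map_sum, Derivation.map_smul, Finset.mul_sum, Finset.sum_mul]
  refine Finset.sum_congr rfl fun σ _ => ?_
  rw [Finset.sum_comm]
  congr 2
  refine Finset.sum_congr rfl fun k _ => Finset.sum_congr rfl fun j _ => ?_
  rw [hK.apply, smul_mul_assoc, mul_smul_comm]

theorem linR_neg (δ : ℕ × μ → Derivation ℝ R R) (N : ℕ) (L X : μ → R) :
    linR D δ N (-L) X = -linR D δ N L X := by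
  funext i
  simp only [linR, ev_apply, Pi.neg_apply, map_neg, neg_mul, Finset.sum_neg_distrib]

theorem linAdjR_neg (δ : ℕ × μ → Derivation ℝ R R) (N : ℕ) (L X : μ → R) :
    linAdjR D δ N (-L) X = -linAdjR D δ N L X := by
  funext i
  simp only [linAdjR, Pi.neg_apply, map_neg, neg_mul, Finset.sum_neg_distrib, iterate_map_neg,
    mul_neg]

theorem mulR_neg (K : Matrix μ μ ℝ) (X : μ → R) : mulR K (-X) = -mulR K X := by
  funext i
  simp [mulR]

theorem mulR_sub (K : Matrix μ μ ℝ) (X Y : μ → R) : mulR K (X - Y) = mulR K X - mulR K Y := by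
  funext i
  simp [mulR, smul_sub]

theorem D_mulR (K : Matrix μ μ ℝ) (X : μ → R) (i : μ) :
    D (mulR K X i) = mulR K (fun j => D (X j)) i := by
  simp only [mulR, map_sum, Derivation.map_smul]

end ClosedForms

section Potentials

open TopologicalSpace DF

variable {n : ℕ} {U V W : Opens (Jet n)}

theorem isClosedSkew_sympR {K : Matrix (Fin n) (Fin n) ℝ} (hK : K.IsSymm) (hdet : IsUnit K.det)
    {A : MatDiffOp (ℕ × Fin n) n} {N : ℕ} {a : ℕ → Fin n → Fin n → DF U} (hA : RepOp A N a)
    (hskew : IsSkewAdjoint (U : Set (Jet n)) A)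
    (h : SchoutenVanishes (U : Set (Jet n)) (constOp K) A) :
    IsClosedSkew (D U) (pr pdR) (opT (sympR K a)) :=
  ⟨exists_slot₂_of_isSkewAdjoint hK hA hskew, exists_slot₃_of_schoutenVanishes hK hdet hA h⟩

theorem IsClosedSkew.shift {K : Matrix (Fin n) (Fin n) ℝ} {a : ℕ → Fin n → Fin n → DF U}
    (h : IsClosedSkew (D U) (pr pdR) (opT (sympR K a))) (hW : ∀ p ∈ W, JetCalc.shift p ∈ U) :
    IsClosedSkew (D W) pdR (opT (sympR K fun σ i j => shiftHom hW (a σ i j))) := by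
  have h1 := h.map (shiftHom hW) (D_shiftHom hW) (pdR_shiftHom hW)
  rw [map_opT] at h1
  simpa only [map_sympR] using h1

theorem isSymplectic_of_isClosedSkew {B : MatDiffOp (ℕ × Fin n) n} {N : ℕ}
    {b : ℕ → Fin n → Fin n → DF V} (hB : RepOp B N b) (h : IsClosedSkew (D V) pdR (opT b)) :
    IsSymplectic (V : Set (Jet n)) B := by
  obtain ⟨⟨m₁, S₁, hS₁, h₁⟩, m₂, S₂, hS₂, h₂⟩ := h
  have hN : 0 < N := (Nat.zero_le _).trans_lt hB.order
  refine ⟨(isSkewAdjoint_iff hB).2 fun X => ?_, fun X₁ X₂ X₃ hX₁ hX₂ hX₃ => ?_⟩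
  · have hb := (isOrderBound₂ (D V)).add _ _ _ hB.bound_opT (bound₂_swap hB.bound_opT)
    rw [← red₂_opT _ hN, ← red₂_opT_swap _ hN, ← red₂_add, h₁]
    exact red₂_slot₂ _ hS₁ (h₁ ▸ hb) X
  · obtain ⟨Y₁, hY₁⟩ := exists_rep hX₁
    obtain ⟨Y₂, hY₂⟩ := exists_rep hX₂
    obtain ⟨Y₃, hY₃⟩ := exists_rep hX₃
    obtain ⟨m₃, hm₃⟩ := exists_orderLT hB.bound_opT
    obtain ⟨m, hm⟩ : ∃ m, m = max (max N m₂) m₃ + 1 := ⟨_, rfl⟩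
    have hB' := hB.mono (show N ≤ m by omega)
    have hm' : ∀ σ i j, OrderLT m fun a => pdR a (b σ i j) :=
      fun σ i j a ha => hm₃ σ i j a (by omega)
    refine (isTrivialDensity_iff (((hB'.linOp hm' hY₁ hY₂ hY₃).add (hB'.linOp hm' hY₂ hY₃ hY₁)).add
      (hB'.linOp hm' hY₃ hY₁ hY₂))).2 ?_
    rw [← ev₃_cyc _ (by omega), h₂, ev₃_slot (D V) m Y₁ Y₂ Y₃ m₂ S₂ (by omega) hS₂]
    exact fun p hp => ⟨V, le_rfl, hp, _, (D_res le_rfl _).symm⟩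

theorem exists_orderLT_pdR (L : Fin n → DF V) : ∃ N, ∀ i, OrderLT N fun a => pdR a (L i) := by
  choose N hN using fun i => exists_order (L i)
  exact ⟨Finset.univ.sup N, fun i a ha => hN i a ((Finset.le_sup (Finset.mem_univ i)).trans ha)⟩

theorem orderLT_ofZero {M : Type*} [AddCommGroup M] (L : Fin n → M) : OrderLT 1 (ofZero L) :=
  fun a ha => if_neg (by omega)

/-- A representation `B = dL + Dη` of the variational two-form of `B` says that `-L` is a potential:
total derivatives do not contribute after integration by parts. -/
theorem isPotential_of_eq {B : MatDiffOp (ℕ × Fin n) n} {N : ℕ} {b : ℕ → Fin n → Fin n → DF V}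
    (hB : RepOp B N b) {L : Fin n → Jet n → ℝ} {L' : Fin n → DF V} (hL : ∀ i, Rep (L i) (L' i))
    {m : ℕ} {S : ℕ × Fin n → ℕ × Fin n → DF V} (hS : bound₂ (Fin n) (DF V) m S)
    (h : opT b = ext₁ pdR (ofZero L') + slot₂ (D V) S) :
    IsPotential (V : Set (Jet n)) (-L) B := by
  obtain ⟨m₁, hm₁⟩ := exists_orderLT_pdR L'
  obtain ⟨M, hM⟩ : ∃ M, M = max (max N m₁) (m + 1) := ⟨_, rfl⟩
  have hM0 : 0 < M := by omega
  refine (isPotential_iff (hB.mono (show N ≤ M by omega)) hL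
    fun i a ha => hm₁ i a (by omega)).2 fun X => ?_
  rw [← red₂_opT _ hM0, h, red₂_add, red₂_ext₁ _ hM0, red₂_slot₂ (D V) hS
    ((isOrderBound₂ (D V)).mono _ _ _ (by omega) ((isOrderBound₂ (D V)).step _ _ hS)), add_zero]

theorem exists_eq_of_isPotential {B : MatDiffOp (ℕ × Fin n) n} {N : ℕ}
    {b : ℕ → Fin n → Fin n → DF V} (hB : RepOp B N b) {L : Fin n → Jet n → ℝ}
    {L' : Fin n → DF V} (hL : ∀ i, Rep (L i) (L' i)) (h : IsPotential (V : Set (Jet n)) (-L) B) :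
    ∃ m S, bound₂ (Fin n) (DF V) m S ∧ opT b = ext₁ pdR (ofZero L') + slot₂ (D V) S := by
  obtain ⟨m₁, hm₁⟩ := exists_orderLT_pdR L'
  obtain ⟨m₂, hm₂⟩ := isJetDerivation_pdR.exists_bound_ext₁ (orderLT_ofZero L')
  obtain ⟨M, hM⟩ : ∃ M, M = max (max N m₁) m₂ := ⟨_, rfl⟩
  have hB' := hB.mono (show N ≤ M by omega)
  have hM0 : 0 < M := (Nat.zero_le _).trans_lt hB'.order
  have hb₂ := isOrderBound₂ (μ := Fin n) (D V)
  have hb : bound₂ (Fin n) (DF V) M (opT b - ext₁ pdR (ofZero L')) := by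
    rw [sub_eq_add_neg, ← neg_one_smul ℝ]
    exact hb₂.add _ _ _ hB'.bound_opT (hb₂.smul _ _ _ (hb₂.mono _ _ _ (by omega) hm₂))
  obtain ⟨m, S, hS, hS'⟩ := exists_eq_slot₂ (faithful (fun i : Fin n => i)) hb fun X => by
    rw [red₂_sub, red₂_opT _ hM0, red₂_ext₁ _ hM0,
      (isPotential_iff hB' hL fun i a ha => hm₁ i a (by omega)).1 h X, sub_self]
  exact ⟨m, S, hS, by rw [← hS']; abel⟩

theorem isOpen_preimage_shift {U : Set (Jet n)} (hU : IsOpen U) : IsOpen (shift ⁻¹' U) :=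
  hU.preimage (continuous_pi fun a => continuous_apply (a.1 + 1, a.2))

/-- Existence of potentials for a closed operator. -/
theorem exists_isPotential {B : MatDiffOp (ℕ × Fin n) n} {p : Jet n}
    (hp : p ∈ V) (hV : StarConvex ℝ p (V : Set (Jet n))) {N : ℕ} {b : ℕ → Fin n → Fin n → DF V}
    (hB : RepOp B N b) (h : IsClosedSkew (D V) pdR (opT b)) :
    ∃ L, IsDiffVec (V : Set (Jet n)) L ∧ IsPotential (V : Set (Jet n)) (-L) B := by
  obtain ⟨⟨m₁, S₁, hS₁, h₁⟩, m₂, S₂, hS₂, h₂⟩ := h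
  obtain ⟨L, m, S, z, hS, -, hz, hpot⟩ := exists_potential_of_cyc isJetDerivation_pdR (radial hp hV)
    hB.bound_opT hS₁ h₁ hS₂ h₂
  have hz0 : ofZero₂ z = 0 := by
    rw [hz one_ne_zero]
    funext a c
    simp [ofZero₂]
  rw [hz0, add_zero] at hpot
  exact ⟨fun i => (L i).ex, isDiffVec_ex L, isPotential_of_eq hB (fun i => Rep.ex _) hS hpot⟩

/-- `A = L_τ(K ∂_x)` with `τ = -K L`, for a potential `-L` of `B = -M A M` that depends on `φ`. -/
theorem act_eq_lieDerivPot {K : Matrix (Fin n) (Fin n) ℝ} (hK : K.IsSymm) (hdet : IsUnit K.det)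
    {A : MatDiffOp (ℕ × Fin n) n} {N : ℕ} {a : ℕ → Fin n → Fin n → DF V}
    (hA : RepOp (A.pullback shift) N a) {L : Fin n → Jet n → ℝ}
    (hL : IsDiffVec (V : Set (Jet n)) L) (h : IsPotential (V : Set (Jet n)) (-L) (sympOp K A))
    {ξ : Fin n → Jet n → ℝ} (hξ : IsDiffVec (V : Set (Jet n)) ξ) {p : Jet n} (hp : p ∈ V)
    (i : Fin n) : (A.pullback shift).act Dx ξ i p = lieDerivPot (-matAct K L) K ξ i p := by
  obtain ⟨L', hL'⟩ := exists_rep hL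
  obtain ⟨ξ', hξ'⟩ := exists_rep hξ
  obtain ⟨m₁, hm₁⟩ := exists_orderLT_pdR L'
  have hτ : ∀ i, Rep ((-matAct K L) i) ((-mulR K L') i) := fun i => (Rep.matAct K hL' i).neg
  obtain ⟨m₂, hm₂⟩ := exists_orderLT_pdR (-mulR K L')
  obtain ⟨M, hM⟩ : ∃ M, M = max N (max m₁ m₂) := ⟨_, rfl⟩
  have hA' := hA.mono (show N ≤ M by omega)
  have hm₂' : ∀ i, OrderLT M fun a => pdR a ((-mulR K L') i) := fun i a ha => hm₂ i a (by omega)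
  have h1 := (isPotential_iff (RepOp.sympOp K hA') hL' fun i a ha => hm₁ i a (by omega)).1 h
    (mulR K ξ')
  have h2 : actR (D V) M a ξ' =
      -linR (D V) pdR M (-mulR K L') (mulR K ξ') + mulR K (linAdjR (D V) pdR M (-mulR K L') ξ') := by
    rw [linR_neg, linAdjR_neg, linR_mulR, linAdjR_mulR _ _ _ hK, mulR_neg, neg_neg, ← sub_eq_add_neg,
      ← mulR_sub, ← neg_sub (linAdjR _ _ _ _ _), ← h1, actR_sympR, neg_neg, mulR_mulR_inv hdet,
      mulR_inv_mulR hdet]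
  have h3 := ((Rep.lin hτ (Rep.matAct K hξ') hm₂' i).neg).add
    (Rep.matAct K (Rep.linAdj hτ hξ' hm₂') i) p hp
  rw [show lieDerivPot (-matAct K L) K ξ i p = _ from h3]
  refine (hA'.act hξ' i p hp).trans ?_
  rw [h2]
  rfl

/-- A flow `K γ` of the hierarchy satisfies the equation with the operator `B = -M A M`. -/
theorem sympOp_act_matAct {K : Matrix (Fin n) (Fin n) ℝ} (hdet : IsUnit K.det)
    {A : MatDiffOp (ℕ × Fin n) n} {N : ℕ} {a : ℕ → Fin n → Fin n → DF V}
    (hA : RepOp (A.pullback shift) N a) {h : ℕ → Jet n → ℝ} {γ : ℕ → Fin n → Jet n → ℝ}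
    (hγ : IsHierarchy (V : Set (Jet n)) K A h γ) (k : ℕ) {p : Jet n} (hp : p ∈ V) (i : Fin n) :
    (sympOp K A).act Dx (matAct K (γ (k + 1))) i p = euler (h (k + 2)) i p := by
  obtain ⟨γ₁, hγ₁⟩ := exists_rep (hγ.covector (k + 1))
  obtain ⟨γ₂, hγ₂⟩ := exists_rep (hγ.covector (k + 2))
  have h1 : actR (D V) N a γ₁ = mulR K fun j => D V (γ₂ j) := funext fun i =>
    (hA.act hγ₁ i).eq fun p hp => (hγ.flow (k + 1) p hp i).trans (Rep.constOp_act K hγ₂ i p hp)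
  rw [hγ.var_deriv (k + 2) p hp i]
  refine ((RepOp.sympOp K hA).act (Rep.matAct K hγ₁) i p hp).trans ?_
  rw [actR_sympR, mulR_inv_mulR hdet, h1, mulR_inv_mulR hdet]
  exact (((hγ₂ i).iter 1).neg p hp).symm

end Potentials

/-! ### Potentials that depend on `u = φ_x` only -/

section FieldVariables

open TopologicalSpace DF

variable {n : ℕ} {V : Opens (Jet n)}

/-- The set of jets of `φ` for which the jet of `φ_x` lies in `V`. -/
def shiftPreimage (V : Opens (Jet n)) : Opens (Jet n) :=
  ⟨shift ⁻¹' (V : Set (Jet n)), isOpen_preimage_shift V.isOpen⟩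

theorem shift_mem {p : Jet n} (hp : p ∈ shiftPreimage V) : shift p ∈ V := hp

theorem exists_shift_eq (q : Jet n) : ∃ p, shift p = q :=
  ⟨fun a => q (a.1 - 1, a.2), rfl⟩

theorem shiftHom_injective :
    Function.Injective (shiftHom fun _ hp => shift_mem hp : DF V → DF (shiftPreimage V)) := by
  intro f g hfg
  refine ext_ex fun q hq => ?_
  obtain ⟨p, rfl⟩ := exists_shift_eq q
  have h1 := (Rep.shift (W := shiftPreimage V) (fun _ hp => shift_mem hp) (Rep.ex f)) p hq
  have h2 := (Rep.shift (W := shiftPreimage V) (fun _ hp => shift_mem hp) (Rep.ex g)) p hq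
  rw [hfg, ← h2] at h1
  exact h1

theorem iterate_shiftHom {U W : Opens (Jet n)} (h : ∀ p ∈ W, shift p ∈ U) (k : ℕ) (f : DF U) :
    ((D W)^[k]) (shiftHom h f) = shiftHom h (((D U)^[k]) f) := by
  induction k with
  | zero => rfl
  | succ k ih => rw [Function.iterate_succ_apply', Function.iterate_succ_apply', ih, D_shiftHom]

/-- A potential `L(u)`, `u = φ_x`, expressed in the variables `u`: by the chain rule the linearization
in `φ` is `ℓ_L ∘ ∂_x`, and its adjoint is `-∂_x ∘ ℓ_L^*`. -/
theorem act_eq_of_isPotential_shift {K : Matrix (Fin n) (Fin n) ℝ}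
    (hdet : IsUnit K.det) {A : MatDiffOp (ℕ × Fin n) n} {N m : ℕ} {a : ℕ → Fin n → Fin n → DF V}
    (hA : RepOp A N a) {L : Fin n → Jet n → ℝ} {L' : Fin n → DF V} (hL : ∀ i, Rep (L i) (L' i))
    (hm : ∀ i, OrderLT m fun a => pdR a (L' i)) (hN : N ≤ m + 1)
    (h : IsPotential (shift ⁻¹' (V : Set (Jet n))) (fun i => -(L i ∘ shift)) (sympOp K A))
    (ξ : Fin n → DF V) (i : Fin n) : actR (D V) (m + 1) a ξ i =
      mulR K (linR (D V) pdR (m + 1) L' (mulR K fun j => D V (ξ j))) i +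
        D V (mulR K (linAdjR (D V) pdR (m + 1) L' (mulR K ξ)) i) := by
  have hW : ∀ p ∈ shiftPreimage V, shift p ∈ V := fun _ hp => shift_mem hp
  set π := shiftHom hW with hπ
  have hA' := hA.mono hN
  have hπL : ∀ i, OrderLT (m + 1) fun a => pdR a (π (L' i)) := by
    rintro i ⟨_ | σ, k⟩ ha
    · simp at ha
    · show pdR (σ + 1, k) (shiftHom hW (L' i)) = 0
      rw [pdR_shiftHom, pr_succ, show pdR (σ, k) (L' i) = 0 from hm i (σ, k) (by simpa using ha),
        map_zero]
  have h1 := (isPotential_iff (V := shiftPreimage V) (RepOp.sympOp K (hA'.shift hW))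
    (fun i => (hL i).shift hW) hπL).1 h fun j => π (mulR K ξ j)
  have h3 : ∀ i, actR (D V) (m + 1) (sympR K a) (mulR K ξ) i =
      linAdjR (D V) (pr pdR) (m + 1) L' (mulR K ξ) i -
        linR (D V) (pr pdR) (m + 1) L' (mulR K ξ) i := by
    intro i
    refine shiftHom_injective ?_
    have h4 := congrFun h1 i
    simp only [actR, Pi.sub_apply, linAdjR, linR, ev_apply, hπ, pdR_shiftHom, iterate_shiftHom,
      ← map_sympR, ← map_mul, ← map_sum] at h4
    have hsgn : ∀ k : ℕ, ((-1 : DF (shiftPreimage V)) ^ k) = shiftHom hW ((-1) ^ k) := by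
      intro k; simp
    simp only [hsgn, ← map_mul, ← map_sum, ← map_sub] at h4
    exact h4
  have h5 : actR (D V) (m + 1) (sympR K a) (mulR K ξ) = -mulR K⁻¹ (actR (D V) (m + 1) a ξ) := by
    rw [actR_sympR, mulR_inv_mulR hdet]
  have h6 : mulR K⁻¹ (actR (D V) (m + 1) a ξ) = fun i =>
      D V (linAdjR (D V) pdR (m + 1) L' (mulR K ξ) i) +
        linR (D V) pdR (m + 1) L' (mulR K fun j => D V (ξ j)) i := by
    funext i
    have h7 := h3 i
    rw [h5, linAdjR_pr _ hm, linR_pr _ hm, Pi.neg_apply] at h7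
    simp only [D_mulR] at h7
    have h8 : (fun i => mulR K (fun j => D V (ξ j)) i) = mulR K fun j => D V (ξ j) := rfl
    rw [h8] at h7
    linear_combination -h7
  rw [← mulR_mulR_inv hdet (actR (D V) (m + 1) a ξ), h6, D_mulR]
  simp only [mulR, smul_add, Finset.sum_add_distrib]
  rw [add_comm]

/-- `A = L_τ(K ∂_x)` with `τ = -K L(u)`, in the variables `u`. -/
theorem act_eq_lieDeriv {K : Matrix (Fin n) (Fin n) ℝ} (hK : K.IsSymm)
    (hdet : IsUnit K.det) {A : MatDiffOp (ℕ × Fin n) n} {N : ℕ} {a : ℕ → Fin n → Fin n → DF V}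
    (hA : RepOp A N a) {L : Fin n → Jet n → ℝ} (hL : IsDiffVec (V : Set (Jet n)) L)
    (h : IsPotential (shift ⁻¹' (V : Set (Jet n))) (fun i => -(L i ∘ shift)) (sympOp K A))
    {ξ : Fin n → Jet n → ℝ} (hξ : IsDiffVec (V : Set (Jet n)) ξ) {q : Jet n} (hq : q ∈ V)
    (i : Fin n) : A.act Dx ξ i q = lieDeriv (-matAct K L) (constOp K) ξ i q := by
  obtain ⟨L', hL'⟩ := exists_rep hL
  obtain ⟨ξ', hξ'⟩ := exists_rep hξ
  obtain ⟨m₁, hm₁⟩ := exists_orderLT_pdR L'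
  obtain ⟨m₂, hm₂⟩ := exists_orderLT_pdR (-mulR K L')
  obtain ⟨M, hM⟩ : ∃ M, M = max N (max m₁ m₂) := ⟨_, rfl⟩
  have hτ : ∀ i, Rep ((-matAct K L) i) ((-mulR K L') i) := fun i => (Rep.matAct K hL' i).neg
  have hτN : ∀ i, OrderLT (M + 1) fun a => pdR a ((-mulR K L') i) :=
    fun i a ha => hm₂ i a (by omega)
  have h1 := act_eq_of_isPotential_shift hdet hA hL' (m := M)
    (fun i a ha => hm₁ i a (by omega)) (by omega) h ξ' i
  have h2 := (((Rep.zero (V := V)).sub (Rep.lin hτ (Rep.constOp_act K hξ') hτN i)).sub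
    (Rep.constOp_act K (Rep.linAdj hτ hξ' hτN) i)) q hq
  have h3 : lieDeriv (-matAct K L) (constOp K) ξ i q = _ :=
    (by rw [lieDeriv, linOp_constOp] : _ = _).trans h2
  rw [h3]
  refine ((hA.mono (show N ≤ M + 1 by omega)).act hξ' i q hq).trans ?_
  rw [h1, linR_neg, linR_mulR, zero_sub, Pi.neg_apply, neg_neg, sub_eq_add_neg, ← D_mulR,
    linAdjR_neg, linAdjR_mulR _ _ _ hK, mulR_neg, Pi.neg_apply, map_neg, neg_neg]

theorem RepOp.res {U W : Opens (Jet n)} (h : W ≤ U) {A : MatDiffOp (ℕ × Fin n) n} {N : ℕ}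
    {a : ℕ → Fin n → Fin n → DF U} (hA : RepOp A N a) :
    RepOp A N fun σ i j => DF.res h (a σ i j) where
  order := hA.order
  coeff σ hσ i j p hp := by rw [hA.coeff σ hσ i j p (h hp), ex_res h _ hp]
  zero σ hσ := by
    funext i j
    simp [hA.zero σ hσ]

theorem IsClosedSkew.res {U W : Opens (Jet n)} (hW : W ≤ U) {K : Matrix (Fin n) (Fin n) ℝ}
    {a : ℕ → Fin n → Fin n → DF U} (h : IsClosedSkew (D U) (pr pdR) (opT (sympR K a))) :
    IsClosedSkew (D W) (pr pdR) (opT (sympR K fun σ i j => DF.res hW (a σ i j))) := by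
  have h1 := h.map (δ' := pr pdR) (DF.res hW) (D_res hW) fun a f => by
    rcases a with ⟨_ | σ, i⟩
    · simp
    · exact pdR_res hW (σ, i) f
  rw [map_opT] at h1
  simpa only [map_sympR] using h1

theorem actR_single (N : ℕ) (hN : 0 < N) (b : ℕ → Fin n → Fin n → DF V) (i j : Fin n) :
    actR (D V) N b (Pi.single j 1) i = b 0 i j := by
  have h1 : ∀ σ, σ ≠ 0 → ∀ k, ((D V)^[σ]) (Pi.single (M := fun _ => DF V) j 1 k) = 0 := by
    intro σ hσ k
    obtain ⟨τ, rfl⟩ := Nat.exists_eq_succ_of_ne_zero hσ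
    have h2 : D V (Pi.single (M := fun _ => DF V) j 1 k) = 0 := by
      rw [Pi.single_apply]
      split_ifs
      · exact Derivation.map_one_eq_zero _
      · exact map_zero _
    rw [Function.iterate_succ_apply, h2, iterate_map_zero]
  rw [actR, Finset.sum_eq_single_of_mem 0 (by simpa using hN)]
  · rw [Finset.sum_eq_single_of_mem j (Finset.mem_univ j)]
    · simp
    · intro k _ hk
      simp [Pi.single_eq_of_ne hk]
  · intro σ _ hσ
    exact Finset.sum_eq_zero fun k _ => by rw [h1 σ hσ, mul_zero]

theorem linR_D_single (N : ℕ) (δ : ℕ × Fin n → Derivation ℝ (DF V) (DF V)) (L : Fin n → DF V)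
    (K : Matrix (Fin n) (Fin n) ℝ) (j : Fin n) :
    linR (D V) δ N L (mulR K fun k => D V (Pi.single (M := fun _ => DF V) j 1 k)) = 0 := by
  have h1 : (mulR K fun k => D V (Pi.single (M := fun _ => DF V) j 1 k)) = 0 := by
    funext i
    refine Finset.sum_eq_zero fun k _ => ?_
    beta_reduce
    rw [Pi.single_apply]
    split_ifs
    · rw [Derivation.map_one_eq_zero, smul_zero]
    · rw [map_zero, smul_zero]
  funext i
  simp [linR, ev_apply, h1, iterate_map_zero]

/-- The zero-order coefficients of an operator with a potential that is a function of `u`. -/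
theorem exists_coeff_zero_eq {K : Matrix (Fin n) (Fin n) ℝ}
    (hdet : IsUnit K.det) {A : MatDiffOp (ℕ × Fin n) n} {N : ℕ} {a : ℕ → Fin n → Fin n → DF V}
    (hA : RepOp A N a) {L : Fin n → Jet n → ℝ} (hL : IsDiffVec (V : Set (Jet n)) L)
    (h : IsPotential (shift ⁻¹' (V : Set (Jet n))) (fun i => -(L i ∘ shift)) (sympOp K A))
    (i j : Fin n) : ∃ g, IsDiffFun (V : Set (Jet n)) g ∧ ∀ r ∈ V, A.coeff 0 i j r = Dx g r := by
  obtain ⟨L', hL'⟩ := exists_rep hL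
  obtain ⟨m, hm⟩ := exists_orderLT_pdR L'
  obtain ⟨M, hM⟩ : ∃ M, M = max N m := ⟨_, rfl⟩
  have h1 := act_eq_of_isPotential_shift hdet hA hL' (m := M) (fun i a ha => hm i a (by omega))
    (by omega) h (Pi.single j 1) i
  rw [actR_single _ (by omega), linR_D_single, show mulR K (0 : Fin n → DF V) i = 0 by simp [mulR],
    zero_add] at h1
  set g := mulR K (linAdjR (D V) pdR (M + 1) L' (mulR K (Pi.single j 1))) i
  refine ⟨g.ex, g.isDiffFun_ex, fun r hr => (hA.coeff 0 (Nat.zero_le _) i j r hr).trans ?_⟩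
  rw [h1]
  exact ((Rep.ex g).iter 1 r hr).symm

/-- A total derivative that does not depend on the derivatives of `u` is zero. -/
theorem D_eq_zero_of_pdR_D {g : DF V} (h : ∀ a : ℕ × Fin n, 1 ≤ a.1 → pdR a (D V g) = 0) :
    D V g = 0 := by
  have h1 : ∀ a : ℕ × Fin n, pdR a g = 0 := fun a =>
    isJetDerivation_pdR.order_of_D (N := 0) h a (Nat.zero_le _)
  rw [show D V g = _ from tdR_eq_sum suc g (S := ∅) fun a _ => h1 a, Finset.sum_empty]

/-- Existence of potentials that are functions of `u`: the obstruction `z_{ij}` is the part of the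
zero-order coefficients that is not a total derivative. -/
theorem exists_isPotential_shift {K : Matrix (Fin n) (Fin n) ℝ} {q : Jet n} (hq : q ∈ V)
    (hV : StarConvex ℝ q (V : Set (Jet n))) {A : MatDiffOp (ℕ × Fin n) n} {N : ℕ}
    {a : ℕ → Fin n → Fin n → DF V} (hA : RepOp A N a)
    (h : IsClosedSkew (D V) (pr pdR) (opT (sympR K a))) (h0 : ∀ i j, ∃ g, a 0 i j = D V g) :
    ∃ L, IsDiffVec (V : Set (Jet n)) L ∧
      IsPotential (shift ⁻¹' (V : Set (Jet n))) (fun i => -(L i ∘ shift)) (sympOp K A) := by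
  have hb : bound₂ (Fin n) (DF V) N (opT (sympR K a)) := JetCalc.bound_opT fun σ hσ => by
    funext i j
    simp [sympR, hA.zero σ (hA.order.trans_le hσ)]
  obtain ⟨⟨m₁, S₁, hS₁, h₁⟩, m₂, S₂, hS₂, h₂⟩ := h
  obtain ⟨L, m, S, z, hS, hz, -, hpot⟩ := exists_potential_of_cyc isJetDerivation_pr_pdR
    (radialShift hq hV) hb hS₁ h₁ hS₂ h₂
  obtain ⟨m₃, hm₃⟩ := exists_orderLT_pdR L
  obtain ⟨M, hM⟩ : ∃ M, M = max (max N m₃) (m + 1) := ⟨_, rfl⟩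
  have hz0 : z = 0 := by
    funext i j
    choose g hg using h0
    have h3 := congrFun (congrArg (fun T => red₂ (D V) (M + 1) T (Pi.single j 1)) hpot) i
    simp only [red₂_add] at h3
    rw [red₂_opT _ (by omega), Pi.add_apply, Pi.add_apply, red₂_ext₁ _ (by omega),
      red₂_slot₂ (D V) hS ((isOrderBound₂ (D V)).mono _ _ _ (by omega)
        ((isOrderBound₂ (D V)).step _ _ hS)), red₂_ofZero₂ _ (by omega), Pi.sub_apply,
      linAdjR_pr (N := M) _ fun i a ha => hm₃ i a (by omega),
      linR_pr (N := M) _ fun i a ha => hm₃ i a (by omega), actR_single _ (by omega)] at h3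
    have h4 := linR_D_single (M + 1) pdR L 1 j
    rw [mulR_one] at h4
    rw [h4] at h3
    have h5 : ∃ g', z i j = D V g' := by
      refine ⟨-(∑ r, ∑ s, (K⁻¹ i r * K⁻¹ s j) • g r s) +
        linAdjR (D V) pdR (M + 1) L (Pi.single j 1) i, ?_⟩
      rw [map_add, map_neg, map_sum]
      simp only [map_sum, Derivation.map_smul, ← hg]
      simp only [sympR, Pi.single_apply, mul_ite, mul_one, mul_zero, Finset.sum_ite_eq',
        Finset.mem_univ, if_true, Pi.zero_apply, add_zero, sub_zero] at h3
      linear_combination -h3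
    obtain ⟨g', hg'⟩ := h5
    rw [hg', Pi.zero_apply, Pi.zero_apply]
    refine D_eq_zero_of_pdR_D fun b hb => ?_
    rw [← hg']
    exact hz (b.1 + 1, b.2) i j (by simpa using hb)
  have hofz : ofZero₂ z = 0 := by
    rw [hz0]
    funext a c
    simp [ofZero₂]
  rw [hofz, add_zero] at hpot
  have hW : ∀ p ∈ shiftPreimage V, shift p ∈ V := fun _ hp => shift_mem hp
  refine ⟨fun i => (L i).ex, isDiffVec_ex L, isPotential_of_eq (V := shiftPreimage V)
    (S := fun c e => shiftHom hW (S c e)) (m := m) (RepOp.sympOp K (hA.shift hW))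
    (fun i => (Rep.ex (L i)).shift hW)
    (bound₂_iff.2 fun c e hce => by rw [bound₂_iff.1 hS c e hce, map_zero]) ?_⟩
  have h6 : (fun c e => shiftHom hW (opT (sympR K a) c e)) =
      opT (sympR K fun σ i j => shiftHom hW (a σ i j)) := by
    rw [map_opT]
    simp only [map_sympR]
  rw [← h6, hpot, ← map_slot₂ (shiftHom hW) (D_shiftHom hW), ← map_ext₁_ofZero (shiftHom hW)
    (pdR_shiftHom hW)]
  funext c e
  exact map_add (shiftHom hW) _ _

end FieldVariables

/-! ### Lagrangians on jets in `x` and `t` -/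

section SpaceTime

open TopologicalSpace DF

variable {n : ℕ} {V : Opens (Jet n)}

/-- The jets in `x` and `t` over the jets in `V`. -/
def spaceTime (V : Opens (Jet n)) : Opens (ℕ × (ℕ × Fin n) → ℝ) :=
  ⟨spaceJet ⁻¹' (V : Set (Jet n)),
    V.isOpen.preimage (continuous_pi fun a => continuous_apply (a.1, 0, a.2))⟩

/-- The coordinate on space-time jets that restricts to the coordinate `a` on jets in `x`. -/
def incl (a : ℕ × Fin n) : ℕ × (ℕ × Fin n) := (a.1, 0, a.2)

theorem incl_injective : Function.Injective (incl : ℕ × Fin n → ℕ × (ℕ × Fin n)) := by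
  rintro ⟨σ, i⟩ ⟨τ, j⟩ h
  simpa [incl] using h

theorem comp_incl_mem : ∀ P ∈ spaceTime V, P ∘ incl ∈ V := fun _ hp => hp

/-- Functions of the jets in `x` as functions of the jets in `x` and `t`. -/
noncomputable def spaceHom : DF V →ₐ[ℝ] DF (spaceTime V) := DF.pull incl comp_incl_mem

theorem Rep.space {f : Jet n → ℝ} {f' : DF V} (hf : Rep f f') :
    Rep (V := spaceTime V) (fun P => f (spaceJet P)) (spaceHom f') :=
  Rep.pull comp_incl_mem hf

theorem D_spaceHom (f : DF V) : D (spaceTime V) (spaceHom f) = spaceHom (D V f) :=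
  tdR_pull (s := suc) (t := suc) comp_incl_mem incl_injective
    (fun _ => rfl) f

theorem iterate_spaceHom (k : ℕ) (f : DF V) :
    ((D (spaceTime V))^[k]) (spaceHom f) = spaceHom (((D V)^[k]) f) := by
  induction k with
  | zero => rfl
  | succ k ih => rw [Function.iterate_succ_apply', Function.iterate_succ_apply', ih, D_spaceHom]

theorem pdR_spaceHom (a : ℕ × Fin n) (f : DF V) :
    pdR (V := spaceTime V) (incl a) (spaceHom f) = spaceHom (pdR a f) :=
  pdR_pull comp_incl_mem incl_injective a f

theorem pdR_succ_spaceHom (σ k : ℕ) (i : Fin n) (f : DF V) :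
    pdR (V := spaceTime V) (σ, k + 1, i) (spaceHom f) = 0 := by
  refine pdR_pull_of_notMem comp_incl_mem ?_ f
  rintro ⟨b, hb⟩
  simp [incl] at hb

/-- The shift of labels that belongs to the total `t`-derivative. -/
def sucT (a : ℕ × (ℕ × Fin n)) : ℕ × (ℕ × Fin n) := (a.1, a.2.1 + 1, a.2.2)

/-- The field `φ_t` as a vector of differential functions. -/
noncomputable def phiTR (V : Opens (Jet n)) (m : Fin n) : DF (spaceTime V) :=
  coord (spaceTime V) (0, 1, m)

theorem rep_phiT (m : Fin n) : Rep (phiT m) (phiTR V m) := fun _ hp => (ex_coord _ hp).symm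

/-- The total `t`-derivative of a function of the jets in `x` is its linearization along `φ_t`. -/
theorem tdR_sucT_spaceHom {N : ℕ} {f : DF V} (hf : OrderLT N fun a => pdR a f) :
    tdR sucT (spaceHom f) = ev (D (spaceTime V)) N (phiTR V)
      fun a => pdR (incl a) (spaceHom f) := by
  rw [tdR_eq_sum sucT _ (S := (box (Fin n) N).map ⟨incl, incl_injective⟩), Finset.sum_map, ev_apply]
  · refine Finset.sum_congr rfl fun a _ => ?_
    rw [phiTR, iterate_coord, mul_comm]
    simp [incl, sucT]
  · rintro ⟨σ, k, i⟩ ha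
    rcases k with _ | k
    · rw [show ((σ, 0, i) : ℕ × (ℕ × Fin n)) = incl (σ, i) from rfl, pdR_spaceHom,
        show pdR (σ, i) f = 0 from hf (σ, i) ?_, map_zero]
      by_contra h
      refine ha (Finset.mem_map.2 ⟨(σ, i), ?_, rfl⟩)
      rw [mem_box]
      simpa using h
    · exact pdR_succ_spaceHom σ k i f

theorem pdR_phiTR (a : ℕ × (ℕ × Fin n)) (m : Fin n) :
    pdR a (phiTR V m) = if a = (0, 1, m) then 1 else 0 := pdR_coord _ _

/-- The Euler–Lagrange expressions of `L_m φ^m_t - h`. -/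
theorem rep_euler2 {L : Fin n → Jet n → ℝ} {h : Jet n → ℝ} {L' : Fin n → DF V} {h' : DF V}
    (hL : ∀ i, Rep (L i) (L' i)) (hh : Rep h h') {N : ℕ} (hN : 0 < N)
    (hLN : ∀ i, OrderLT N fun a => pdR a (L' i)) (hhN : OrderLT N fun a => pdR a h') (i : Fin n) :
    Rep (fun P => euler2 (lagrangianRep L h) i P + euler h i (spaceJet P))
      (linAdjR (D (spaceTime V)) (fun a => pdR (incl a)) N (fun j => spaceHom (L' j)) (phiTR V) i -
        linR (D (spaceTime V)) (fun a => pdR (incl a)) N (fun j => spaceHom (L' j)) (phiTR V) i) := by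
  set Λ : DF (spaceTime V) := ∑ m, spaceHom (L' m) * phiTR V m - spaceHom h' with hΛ
  have hΛr : Rep (lagrangianRep L h) Λ :=
    (Rep.sum _ fun m _ => (hL m).space.mul (rep_phiT m)).sub hh.space
  have h0 : ∀ σ, pdR (σ, 0, i) Λ = ∑ m, pdR (incl (σ, i)) (spaceHom (L' m)) * phiTR V m -
      spaceHom (pdR (σ, i) h') := by
    intro σ
    rw [hΛ, map_sub, map_sum, ← pdR_spaceHom]
    congr 1
    refine Finset.sum_congr rfl fun m _ => ?_
    rw [Derivation.leibniz, pdR_phiTR, if_neg (by simp), smul_zero, zero_add, smul_eq_mul, mul_comm]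
    rfl
  have h1 : ∀ σ k, pdR (σ, k + 1, i) Λ = if σ = 0 ∧ k = 0 then spaceHom (L' i) else 0 := by
    intro σ k
    rw [hΛ, map_sub, map_sum, pdR_succ_spaceHom, sub_zero]
    rw [Finset.sum_eq_single_of_mem i (Finset.mem_univ _), Derivation.leibniz, pdR_succ_spaceHom,
      smul_zero, add_zero, pdR_phiTR, smul_eq_mul, mul_ite, mul_one, mul_zero]
    · simp
    · intro m _ hm
      rw [Derivation.leibniz, pdR_succ_spaceHom, pdR_phiTR, if_neg, smul_zero, smul_zero, add_zero]
      simp only [Prod.mk.injEq]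
      exact fun h => hm h.2.2.symm
  have h2 : Rep (euler2 (lagrangianRep L h) i) (∑ a ∈ Finset.range N ×ˢ Finset.range 2,
      (-1) ^ (a.1 + a.2) * ((D (spaceTime V))^[a.1]) (((tdR sucT)^[a.2]) (pdR (a.1, a.2, i) Λ))) := by
    refine Rep.finsum (fun a : ℕ × ℕ => Rep.neg_one_pow_mul _ (Rep.iter (fun p hp =>
      ex_iterate_tdR sucT _ (hΛr.pd (a.1, a.2, i)) a.2 hp) a.1)) ?_
    rintro ⟨σ, k⟩ ha
    have h3 : pdR (σ, k, i) Λ = 0 := by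
      simp only [Finset.mem_product, Finset.mem_range] at ha
      rcases k with _ | k
      · have hσ : N ≤ σ := by omega
        rw [h0, show pdR (σ, i) h' = 0 from hhN (σ, i) hσ, map_zero, sub_zero]
        refine Finset.sum_eq_zero fun m _ => ?_
        rw [pdR_spaceHom, show pdR (σ, i) (L' m) = 0 from hLN m (σ, i) hσ, map_zero, zero_mul]
      · rw [h1, if_neg (by omega)]
    simp only [h3, iterate_map_zero, mul_zero]
  have h4 : Rep (fun P => euler h i (spaceJet P)) (spaceHom (∑ σ ∈ Finset.range N,
      (-1) ^ σ * ((D V)^[σ]) (pdR (σ, i) h'))) := by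
    refine Rep.space (Rep.finsum_range (fun σ => (Rep.iter (hh.pd (σ, i)) σ).neg_one_pow_mul σ) ?_)
    intro σ hσ
    rw [show pdR (σ, i) h' = 0 from hhN (σ, i) hσ, iterate_map_zero, mul_zero]
  have h5 : ∑ σ ∈ Finset.range N, (-1) ^ (σ + 1) * ((D (spaceTime V))^[σ])
      (tdR sucT (pdR (σ, 1, i) Λ)) = -tdR sucT (spaceHom (L' i)) := by
    rw [Finset.sum_eq_single_of_mem 0 (by simpa using hN)]
    · rw [h1]
      simp
    · intro σ _ hσ
      rw [h1, if_neg (by omega), map_zero, iterate_map_zero, mul_zero]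
  convert h2.add h4 using 1
  rw [Finset.sum_product]
  simp only [Finset.sum_range_succ, Finset.sum_range_zero, zero_add, h0, Function.iterate_zero_apply,
    Function.iterate_one, Finset.sum_add_distrib, h5, tdR_sucT_spaceHom (hLN i), linR, linAdjR,
    iterate_map_sub, mul_sub, Finset.sum_sub_distrib, add_zero, iterate_spaceHom, map_sum, map_mul,
    map_pow, map_neg, map_one]
  ring

/-- Every potential `-L` of `B` gives a Lagrangian `L_m φ^m_t - h` of the system `B φ_t = δH/δφ`. -/
theorem euler2_lagrangianRep {B : MatDiffOp (ℕ × Fin n) n} {N : ℕ}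
    {b : ℕ → Fin n → Fin n → DF V} (hB : RepOp B N b) {L : Fin n → Jet n → ℝ} {h : Jet n → ℝ}
    (hL : IsDiffVec (V : Set (Jet n)) L) (hh : IsDiffFun (V : Set (Jet n)) h)
    (hpot : IsPotential (V : Set (Jet n)) (-L) B) {P : Jet2 n} (hP : spaceJet P ∈ V) (i : Fin n) :
    euler2 (lagrangianRep L h) i P =
      (B.pullback spaceJet).act Dx2 phiT i P - euler h i (spaceJet P) := by
  obtain ⟨L', hL'⟩ := exists_rep hL
  obtain ⟨m, S, hS, hbS⟩ := exists_eq_of_isPotential hB hL' hpot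
  obtain ⟨m₁, hm₁⟩ := exists_orderLT_pdR L'
  obtain ⟨m₂, hm₂⟩ := exists_order (DF.mk h hh)
  obtain ⟨M, hM⟩ : ∃ M, M = max (max N (m + 1)) (max m₁ m₂) := ⟨_, rfl⟩
  have hM0 : 0 < M := by omega
  have hB' := hB.mono (show N ≤ M by omega)
  have hBP : RepOp (V := spaceTime V) (B.pullback spaceJet) M fun σ i j => spaceHom (b σ i j) :=
    ⟨hB'.order, fun σ hσ i j => (hB'.coeff σ hσ i j).space, fun σ hσ => by
      funext i j
      simp [hB'.zero σ hσ]⟩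
  have h1 : opT (fun σ i j => (spaceHom (b σ i j) : DF (spaceTime V))) =
      ext₁ (fun a => pdR (incl a)) (ofZero fun j => spaceHom (L' j)) +
        slot₂ (D (spaceTime V)) fun c a => spaceHom (S c a) := by
    rw [← map_opT spaceHom b, hbS, ← map_slot₂ spaceHom D_spaceHom, ← map_ext₁_ofZero spaceHom
      pdR_spaceHom]
    funext c a
    exact map_add spaceHom _ _
  have hS' : bound₂ (Fin n) (DF (spaceTime V)) m fun c a => spaceHom (S c a) :=
    bound₂_iff.2 fun c e hce => by rw [bound₂_iff.1 hS c e hce, map_zero]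
  have h2 : actR (D (spaceTime V)) M (fun σ i j => spaceHom (b σ i j)) (phiTR V) =
      linAdjR (D (spaceTime V)) (fun a => pdR (incl a)) M (fun j => spaceHom (L' j)) (phiTR V) -
        linR (D (spaceTime V)) (fun a => pdR (incl a)) M (fun j => spaceHom (L' j)) (phiTR V) := by
    rw [← red₂_opT _ hM0, h1, red₂_add, red₂_ext₁ _ hM0, red₂_slot₂ (D (spaceTime V)) hS'
      ((isOrderBound₂ (D (spaceTime V))).mono _ _ _ (by omega)
        ((isOrderBound₂ (D (spaceTime V))).step _ _ hS')), add_zero]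
  have h3 := rep_euler2 hL' (Rep.mk hh) hM0 (fun i a ha => hm₁ i a (by omega))
    (fun a ha => hm₂ a (by omega)) i P hP
  have h4 := hBP.act rep_phiT i P hP
  rw [h2] at h4
  exact eq_sub_of_add_eq (h3.trans h4.symm)

end SpaceTime

end JetCalc

theorem mainTheorem1 (n : ℕ) (K : Matrix (Fin n) (Fin n) ℝ) (hKsymm : K.IsSymm)
    (hKdet : IsUnit K.det) (U : Set (Jet n)) (hU : IsOpen U) (A₂ : MatDiffOp (ℕ × Fin n) n)
    (hA₂ : A₂.IsSmoothOn U) (hHam : IsHamiltonian U A₂)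
    (hcomp : SchoutenVanishes U (constOp K) A₂) :
    -- the operator `B` is symplectic
    IsSymplectic (shift ⁻¹' U) (sympOp K A₂) ∧
    -- the flows `φ_{t^k} = K δH_{k+1}/δu` of a hierarchy satisfy `B φ_{t^k} = δH_{k+2}/δφ`
    (∀ (V : Set (Jet n)) (h : ℕ → Jet n → ℝ) (γ : ℕ → Fin n → Jet n → ℝ),
      IsOpen V → V ⊆ shift ⁻¹' U → IsHierarchy V K A₂ h γ →
      ∀ k, ∀ p ∈ V, ∀ i,
        (sympOp K A₂).act Dx (matAct K (γ (k + 1))) i p = euler (h (k + 2)) i p) ∧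
    -- `B` has a potential `ψ = -L` near every jet of `φ`
    (∀ p ∈ shift ⁻¹' U, ∃ V : Set (Jet n), IsOpen V ∧ p ∈ V ∧ V ⊆ shift ⁻¹' U ∧
      ∃ L : Fin n → Jet n → ℝ, IsDiffVec V L ∧ IsPotential V (-L) (sympOp K A₂)) ∧
    -- every potential gives a Lagrangian of `B φ_t = δH/δφ`, and `A₂ = L_τ A₁` with `τ = -K L`
    (∀ (V : Set (Jet n)) (L : Fin n → Jet n → ℝ), IsOpen V → V ⊆ shift ⁻¹' U → IsDiffVec V L →
      IsPotential V (-L) (sympOp K A₂) →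
      (∀ h, IsDiffFun V h → ∀ P, spaceJet P ∈ V → ∀ i,
        euler2 (lagrangianRep L h) i P =
          ((sympOp K A₂).pullback spaceJet).act Dx2 phiT i P - euler h i (spaceJet P)) ∧
      (∀ ξ, IsDiffVec V ξ → ∀ p ∈ V, ∀ i,
        (A₂.pullback shift).act Dx ξ i p = lieDerivPot (-matAct K L) K ξ i p)) ∧
    -- the same in the variables `u`, for a potential that depends on `φ` through `u = φ_x` only
    (∀ (V : Set (Jet n)) (L : Fin n → Jet n → ℝ), IsOpen V → V ⊆ U → IsDiffVec V L →
      IsPotential (shift ⁻¹' V) (fun i => -(L i ∘ shift)) (sympOp K A₂) →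
      ∀ ξ, IsDiffVec V ξ → ∀ q ∈ V, ∀ i,
        A₂.act Dx ξ i q = lieDeriv (-matAct K L) (constOp K) ξ i q) ∧
    -- such a potential exists near a jet of `u` exactly if the zero-order coefficients of `A₂`
    -- are total derivatives there
    (∀ q ∈ U,
      (∃ V : Set (Jet n), IsOpen V ∧ q ∈ V ∧ V ⊆ U ∧
        ∃ L : Fin n → Jet n → ℝ, IsDiffVec V L ∧
          IsPotential (shift ⁻¹' V) (fun i => -(L i ∘ shift)) (sympOp K A₂)) ↔
      (∃ V : Set (Jet n), IsOpen V ∧ q ∈ V ∧ V ⊆ U ∧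
        ∀ i j, ∃ g, IsDiffFun V g ∧ ∀ r ∈ V, A₂.coeff 0 i j r = Dx g r)) := by
  have hrep := repOp_coefR (V := ⟨U, hU⟩) hA₂
  have hcl := isClosedSkew_sympR hKsymm hKdet hrep hHam.1 hcomp
  refine ⟨?_, ?_, ?_, ?_, ?_, ?_⟩
  · have hW : ∀ p ∈ shiftPreimage ⟨U, hU⟩, shift p ∈ (⟨U, hU⟩ : TopologicalSpace.Opens (Jet n)) := fun _ hp => hp
    exact isSymplectic_of_isClosedSkew (V := shiftPreimage ⟨U, hU⟩)
      (RepOp.sympOp K (hrep.shift hW)) (hcl.shift hW)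
  · intro V h γ hV hVU hγ k p hp i
    have hW : ∀ p ∈ (⟨V, hV⟩ : TopologicalSpace.Opens (Jet n)), shift p ∈ (⟨U, hU⟩ : TopologicalSpace.Opens (Jet n)) :=
      fun _ hp => hVU hp
    exact sympOp_act_matAct hKdet (hrep.shift hW) hγ k hp i
  · intro p hp
    obtain ⟨W, hWU, hpW, hs⟩ := exists_starConvex (shiftPreimage ⟨U, hU⟩) (p₀ := p) hp
    have hW : ∀ p ∈ W, shift p ∈ (⟨U, hU⟩ : TopologicalSpace.Opens (Jet n)) := fun _ hp => hWU hp
    exact ⟨W, W.isOpen, hpW, hWU,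
      exists_isPotential hpW hs (RepOp.sympOp K (hrep.shift hW)) (hcl.shift hW)⟩
  · intro V L hV hVU hL hpot
    have hW : ∀ p ∈ (⟨V, hV⟩ : TopologicalSpace.Opens (Jet n)), shift p ∈ (⟨U, hU⟩ : TopologicalSpace.Opens (Jet n)) :=
      fun _ hp => hVU hp
    have hA := hrep.shift hW
    exact ⟨fun h hh P hP i =>
        euler2_lagrangianRep (V := ⟨V, hV⟩) (RepOp.sympOp K hA) hL hh hpot hP i,
      fun ξ hξ p hp i => act_eq_lieDerivPot hKsymm hKdet hA hL hpot hξ hp i⟩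
  · intro V L hV hVU hL hpot ξ hξ q hq i
    exact act_eq_lieDeriv hKsymm hKdet (hrep.res (W := ⟨V, hV⟩) hVU) hL hpot hξ hq i
  · intro q hq
    constructor
    · rintro ⟨V, hV, hqV, hVU, L, hL, hpot⟩
      exact ⟨V, hV, hqV, hVU,
        exists_coeff_zero_eq hKdet (hrep.res (W := ⟨V, hV⟩) hVU) hL hpot⟩
    · rintro ⟨V, hV, hqV, hVU, hg⟩
      obtain ⟨W, hWV, hqW, hs⟩ := exists_starConvex (⟨V, hV⟩ : TopologicalSpace.Opens (Jet n)) (p₀ := q) hqV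
      have hWU : W ≤ ⟨U, hU⟩ := fun _ hp => hVU (hWV hp)
      have hA := hrep.res hWU
      obtain ⟨L, hL, hpot⟩ := exists_isPotential_shift (K := K) hqW hs hA (hcl.res hWU) fun i j => by
        obtain ⟨g, hg, hAg⟩ := hg i j
        refine ⟨DF.mk g (hg.mono hWV), (hA.coeff 0 (Nat.zero_le _) i j).eq fun p hp => ?_⟩
        exact (hAg p (hWV hp)).trans ((Rep.mk (hg.mono hWV)).iter 1 p hp)
      exact ⟨W, W.isOpen, hqW, fun _ hp => hVU (hWV hp), L, hL, hpot⟩
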